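/- For $\nu,z\in\mathbb C$ let $$J^*_\nu(z)=\sum_{m\ge 0}\frac{(-1)^m(z/2)^{2m}}{m!\,\Gamma(\nu+m+1)},$$ the entire function of $z$ that equals $J_\nu(z)(z/2)^{-\nu}$ for $z>0$. For $p\in\mathbb Z$ and $u\in\mathbb C^\times=\mathbb C\setminus\{0\}$ put $$\mathcal J_{\nu,p}(u)=|u/2|^{2\nu}(u/|u|)^{-2p}J^*_{\nu-p}(u)J^*_{\nu+p}(\bar u),\qquad \mathcal K_{\nu,p}(u)=\frac{\mathcal J_{-\nu,-p}(u)-\mathcal J_{\nu,p}(u)}{\sin\pi\nu},$$ where the removable singularities at $\nu\in\mathbb Z$ are filled in by the limit. Let $d^\times u=|u|^{-2}\,d_+u$ with $d_+u$ the Lebesgue measure on $\mathbb C$, and put $$\mathrm Kf(\nu,p)=\int_{\mathbb C^\times}\mathcal K_{\nu,p}(u)f(u)\,d^\times u,\qquad \mathrm Bh(u)=\sum_{p\in\mathbb Z}\frac1{8\pi i}\int_{(0)}\mathcal K_{\nu,p}(u)\,h(\nu,p)\,(p^2-\nu^2)\,d\nu,$$ where $(0)$ is the line $\operatorname{Re}\nu=0$,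 oriented upwards. Theorem 11.1. Let $f:\mathbb C^\times\to\mathbb C$ be even (that is, $f(-u)=f(u)$), smooth, and compactly supported on $\mathbb C^\times$. Then the integral defining $\mathrm Kf(\nu,p)$ converges absolutely for all $\nu\in\mathbb C$, $p\in\mathbb Z$; for every $u\in\mathbb C^\times$ the sum and integrals defining $\mathrm B\mathrm Kf(u)$ converge absolutely (the integrals of the absolute values are finite and have a finite sum over $p$); and $$2\pi\,\mathrm B\mathrm Kf(u)=f(u)\qquad\text{for all }u\in\mathbb C^\times .$$ -/

import Mathlib

noncomputable section

/-- The entire function `J*_ν`, that is `J_ν(x) (x/2)^{-ν}` for `x > 0`, where `J_ν` is the Bessel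
function of the first kind: `J*_ν(z) = ∑_m (-1)^m (z/2)^{2m} / (m! Γ(ν+m+1))`.
At a pole of `Γ` the reciprocal is `0` (Mathlib puts `Γ = 0` there, and `x / 0 = 0`), as it
should be. -/
def besselJStar (ν z : ℂ) : ℂ :=
  ∑' m : ℕ, (-1 : ℂ) ^ m * (z / 2) ^ (2 * m) / ((m.factorial : ℂ) * Complex.Gamma (ν + m + 1))

/-- `𝒥_{ν,p}(u) = |u/2|^{2ν} (u/|u|)^{-2p} J*_{ν-p}(u) J*_{ν+p}(ū)` for `u ≠ 0`. -/
def besselJKernel (ν : ℂ) (p : ℤ) (u : ℂ) : ℂ :=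
  ((‖u / 2‖ : ℝ) : ℂ) ^ (2 * ν) * (u / ((‖u‖ : ℝ) : ℂ)) ^ (-2 * p) *
    besselJStar (ν - p) u * besselJStar (ν + p) ((starRingEnd ℂ) u)

/-- The quotient `(𝒥_{-ν,-p}(u) - 𝒥_{ν,p}(u)) / sin πν`. -/
def besselKQuotient (ν : ℂ) (p : ℤ) (u : ℂ) : ℂ :=
  (besselJKernel (-ν) (-p) u - besselJKernel ν p u) / Complex.sin (Real.pi * ν)

open Classical in
/-- The Bessel kernel `𝒦_{ν,p}(u) = (𝒥_{-ν,-p}(u) - 𝒥_{ν,p}(u)) / sin πν`; at the integers `ν`,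
which are removable singularities, its value is the limit. -/
def besselK (ν : ℂ) (p : ℤ) (u : ℂ) : ℂ :=
  if Complex.sin (Real.pi * ν) = 0 then
    Filter.limUnder (nhdsWithin ν {ν}ᶜ) (fun s : ℂ => besselKQuotient s p u)
  else besselKQuotient ν p u

/-- The measure `d^×u = |u|^{-2} d_+u` on `ℂ^×`, with `d_+u` the Lebesgue measure on `ℂ`,
regarded as a measure on `ℂ` (for which `{0}` is a null set). -/
def mulLebesgue : MeasureTheory.Measure ℂ :=
  MeasureTheory.volume.withDensity (fun u : ℂ => ENNReal.ofReal ((‖u‖ ^ 2)⁻¹))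

/-- `Kf(ν,p) = ∫_{ℂ^×} 𝒦_{ν,p}(u) f(u) d^×u`. -/
def besselKTransform (f : ℂ → ℂ) (ν : ℂ) (p : ℤ) : ℂ :=
  ∫ u, besselK ν p u * f u ∂mulLebesgue

/-- The integrand `𝒦_{ν,p}(u) h(ν,p) (p² - ν²) dν` on the line `Re ν = 0`, with `ν = it`
and `dν = i dt`. -/
def besselBIntegrand (h : ℂ → ℤ → ℂ) (u : ℂ) (p : ℤ) (t : ℝ) : ℂ :=
  besselK (t * Complex.I) p u * h (t * Complex.I) p *
    ((p : ℂ) ^ 2 - (t * Complex.I) ^ 2) * Complex.I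

/-- The Bessel transform
`Bh(u) = ∑_{p ∈ ℤ} (1/(8πi)) ∫_{Re ν = 0} 𝒦_{ν,p}(u) h(ν,p) (p² - ν²) dν`. -/
def besselB (h : ℂ → ℤ → ℂ) (u : ℂ) : ℂ :=
  ∑' p : ℤ, 1 / (8 * (Real.pi : ℂ) * Complex.I) * ∫ t : ℝ, besselBIntegrand h u p t

end

noncomputable section

/-! The transform is inverted by duality with explicit test functions. Let `g` be `u^(2q)` or its
conjugate, times a Gaussian `exp(-τ|u|²)`, and integrate `g` against `𝒦_{it,p}`. The kernel is a
double power series, and in the term-by-term integral the angular variable keeps only one diagonal.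
The Chu-Vandermonde identity resums this diagonal, and the connection formula between the modified
Bessel functions `I` and `K` combines the two halves of `𝒦`. The result is a binomial sum of
products `K_{it+q-j}(2a) c_{p+q-j}(a)` with `a = 1/(4τ)`, where `K` is the Macdonald function and
`c_N(a)` are the Laurent coefficients of `exp(-a(z + 1/z))` (`integral_besselK_mul_gaussMonomial`).

Both factors are Fourier transforms, the first over a line and the second over a circle. So the
transform of `g` is, up to a constant, the Fourier transform on a cylinder with coordinate `ζ` of
`conj(2 cosh ζ)^(2q)` times `exp(-a|2 cosh ζ|²)`. There Parseval's formula is classical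
(`isParsevalPair_of_mem_trigSpan`). The spectral density factors as `p² + t² = (p - it)(p + it)`,
and the two factors act on the cylinder as `∂/∂ζ` and minus its conjugate. By the chain rule for `w
= 2 cosh ζ` they contribute `|2 sinh ζ|²`, which is the Jacobian of this change of variables. The
cylinder integral thereby becomes a Gaussian moment in the `w`-plane. Comparison with the moments in
the `u`-plane gives, for two test functions `g, h` with transforms `ĝ, ĥ`, the formula `∑_p ∫ ĝ ĥ
(p² + t²) dt = 4 ∫ g h |u|² du` (`hasSum_integral_cylTransform`).

Even functions that are continuous off `0` and of moderate growth are determined by their pairings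
with the test functions (`eq_zero_of_forall_integral_mul_gaussTest_eq_zero`), by Fourier inversion
in `|u|²` and Fourier series in the angle. So Parseval's formula upgrades to pointwise inversion for
each test function (`kernelSum_cylTransform`). For a general `f`, Fubini's theorem moves the kernel
from `f` to the test function, where inversion is known (`kernelSum_besselKTransform`).

Convergence rests on two estimates. On the line `Re ν = 0` the kernel grows at most linearly in `p`,
uniformly in `ν` (`exists_norm_besselK_le`). Moreover `Kf` decays faster than any power of `p² +
t²`, because `(u ∂/∂u)² + u²` acts on the transform as multiplication by `(ν - p)²`
(`besselKTransform_besselOperator`). -/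

theorem HasSum.of_forall_eq {ι : Type*} {f g : ι → ℂ} {a : ℂ} (h : HasSum g a)
    (e : ∀ i, f i = g i) : HasSum f a :=
  (funext e : f = g) ▸ h

/-! ### The Bessel-Clifford function and products of two of them -/

/-- The Bessel-Clifford function `∑ y^m / (m! Γ(μ+m+1))`. -/
def clifford (μ y : ℂ) : ℂ :=
  ∑' m : ℕ, y ^ m / (m.factorial : ℂ) * (Complex.Gamma (μ + m + 1))⁻¹

theorem besselJStar_eq_clifford (ν z : ℂ) : besselJStar ν z = clifford ν (-(z / 2) ^ 2) := by
  unfold besselJStar clifford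
  refine tsum_congr fun m => ?_
  rw [neg_pow ((z / 2) ^ 2), ← pow_mul, div_mul_eq_div_div, div_eq_mul_inv _ (Complex.Gamma _)]

/-- Compactness bounds the finitely many `m ≤ ⌈R⌉`. Beyond them `1/Γ(s) = s · 1/Γ(s+1)` with `|s| =
|μ+m+1| ≥ 1`, so the modulus does not increase with `m`. -/
theorem exists_norm_inv_Gamma_le (R : ℝ) :
    ∃ C : ℝ, 0 < C ∧ ∀ μ : ℂ, ‖μ‖ ≤ R → ∀ m : ℕ, ‖(Complex.Gamma (μ + m + 1))⁻¹‖ ≤ C := by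
  have hcont : ∀ m : ℕ, ∃ C : ℝ, ∀ μ ∈ Metric.closedBall (0 : ℂ) R,
      ‖(Complex.Gamma (μ + m + 1))⁻¹‖ ≤ C := fun m =>
    (isCompact_closedBall (0 : ℂ) R).exists_bound_of_continuousOn
      (f := fun μ : ℂ => (Complex.Gamma (μ + m + 1))⁻¹)
      ((Complex.differentiable_one_div_Gamma.continuous.comp (by fun_prop :
        Continuous fun μ : ℂ => μ + m + 1)).continuousOn)
  choose c hc using hcont
  set N := ⌈R⌉₊ with hN
  refine ⟨∑ i ∈ Finset.range (N + 1), |c i| + 1,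
    add_pos_of_nonneg_of_pos (Finset.sum_nonneg fun _ _ => abs_nonneg _) one_pos,
    fun μ hμ m => ?_⟩
  have hμ' : μ ∈ Metric.closedBall (0 : ℂ) R := by simpa using hμ
  have small : ∀ m ≤ N, ‖(Complex.Gamma (μ + m + 1))⁻¹‖ ≤
      ∑ i ∈ Finset.range (N + 1), |c i| + 1 := by
    intro m hm
    have h1 := (hc m μ hμ').trans (le_abs_self _)
    have h2 := Finset.single_le_sum (f := fun i => |c i|) (fun i _ => abs_nonneg _)
      (Finset.mem_range.2 (Nat.lt_succ_of_le hm))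
    linarith
  rcases le_total m N with hm | hm
  · exact small m hm
  · induction m, hm using Nat.le_induction with
    | base => exact small N le_rfl
    | succ m hm ih =>
      refine le_trans ?_ ih
      rw [Complex.one_div_Gamma_eq_self_mul_one_div_Gamma_add_one (μ + m + 1), norm_mul]
      have hR : R ≤ m := (Nat.le_ceil R).trans (by exact_mod_cast hm)
      have h1 : (1 : ℝ) ≤ ‖μ + m + 1‖ := by
        have : ‖(m : ℂ) + 1‖ ≤ ‖μ + m + 1‖ + ‖μ‖ := by
          have := norm_sub_le (μ + m + 1) μ
          rwa [show μ + m + 1 - μ = (m : ℂ) + 1 by ring] at this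
        have h2 : ‖(m : ℂ) + 1‖ = m + 1 := by
          have := Complex.norm_natCast (m + 1)
          push_cast at this
          exact this
        linarith
      rw [show μ + ((m + 1 : ℕ) : ℂ) + 1 = μ + m + 1 + 1 by push_cast; ring]
      exact le_mul_of_one_le_left (norm_nonneg _) h1

theorem norm_clifford_term_le {R C : ℝ}
    (hC : ∀ μ : ℂ, ‖μ‖ ≤ R → ∀ m : ℕ, ‖(Complex.Gamma (μ + m + 1))⁻¹‖ ≤ C)
    {μ y : ℂ} {Y : ℝ} (hμ : ‖μ‖ ≤ R) (hy : ‖y‖ ≤ Y) (m : ℕ) :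
    ‖y ^ m / (m.factorial : ℂ) * (Complex.Gamma (μ + m + 1))⁻¹‖ ≤ Y ^ m / m.factorial * C := by
  rw [norm_mul, norm_div, norm_pow, Complex.norm_natCast]
  have := hC μ hμ m
  have hY : 0 ≤ Y := (norm_nonneg y).trans hy
  gcongr

theorem summable_norm_clifford (μ y : ℂ) :
    Summable fun m : ℕ => ‖y ^ m / (m.factorial : ℂ) * (Complex.Gamma (μ + m + 1))⁻¹‖ := by
  obtain ⟨C, -, hC⟩ := exists_norm_inv_Gamma_le ‖μ‖
  exact Summable.of_nonneg_of_le (fun _ => norm_nonneg _)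
    (norm_clifford_term_le hC le_rfl le_rfl) ((Real.summable_pow_div_factorial ‖y‖).mul_right C)

theorem summable_clifford (μ y : ℂ) :
    Summable fun m : ℕ => y ^ m / (m.factorial : ℂ) * (Complex.Gamma (μ + m + 1))⁻¹ :=
  (summable_norm_clifford μ y).of_norm

theorem norm_clifford_le {R C : ℝ}
    (hC : ∀ μ : ℂ, ‖μ‖ ≤ R → ∀ m : ℕ, ‖(Complex.Gamma (μ + m + 1))⁻¹‖ ≤ C)
    {μ : ℂ} (hμ : ‖μ‖ ≤ R) (y : ℂ) : ‖clifford μ y‖ ≤ Real.exp ‖y‖ * C := by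
  have hs := (Real.summable_pow_div_factorial ‖y‖).mul_right C
  refine (tsum_of_norm_bounded hs.hasSum (norm_clifford_term_le hC hμ le_rfl)).trans ?_
  rw [tsum_mul_right, Real.exp_eq_exp_ℝ, NormedSpace.exp_eq_tsum_div]

theorem continuous_clifford : Continuous fun x : ℂ × ℂ => clifford x.1 x.2 := by
  rw [continuous_iff_continuousAt]
  rintro ⟨μ₀, y₀⟩
  obtain ⟨C, -, hC⟩ := exists_norm_inv_Gamma_le (‖μ₀‖ + 1)
  have hopen : IsOpen (Metric.ball (0 : ℂ) (‖μ₀‖ + 1) ×ˢ Metric.ball (0 : ℂ) (‖y₀‖ + 1)) :=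
    Metric.isOpen_ball.prod Metric.isOpen_ball
  refine ContinuousOn.continuousAt (s := Metric.ball (0 : ℂ) (‖μ₀‖ + 1) ×ˢ
    Metric.ball (0 : ℂ) (‖y₀‖ + 1)) ?_ (hopen.mem_nhds (by simp))
  refine continuousOn_tsum (u := fun m : ℕ => (‖y₀‖ + 1) ^ m / m.factorial * C) (fun m => ?_)
    ((Real.summable_pow_div_factorial _).mul_right C) (fun m x hx => ?_)
  · have := Complex.differentiable_one_div_Gamma.continuous
    exact (Continuous.mul (by fun_prop) (this.comp (by fun_prop :
      Continuous fun x : ℂ × ℂ => x.1 + m + 1))).continuousOn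
  · simp only [Set.mem_prod, Metric.mem_ball, dist_zero_right] at hx
    exact norm_clifford_term_le hC hx.1.le hx.2.le m

theorem differentiable_clifford_left (y : ℂ) : Differentiable ℂ fun μ => clifford μ y := by
  intro μ₀
  obtain ⟨C, -, hC⟩ := exists_norm_inv_Gamma_le (‖μ₀‖ + 1)
  have hd : DifferentiableOn ℂ (fun μ => clifford μ y) (Metric.ball (0 : ℂ) (‖μ₀‖ + 1)) := by
    refine Complex.differentiableOn_tsum_of_summable_norm
      (u := fun m : ℕ => ‖y‖ ^ m / m.factorial * C)
      ((Real.summable_pow_div_factorial _).mul_right C) (fun m => ?_) Metric.isOpen_ball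
      (fun m μ hμ => norm_clifford_term_le hC (by simpa using (Metric.mem_ball.1 hμ).le) le_rfl m)
    have := Complex.differentiable_one_div_Gamma.comp
      (by fun_prop : Differentiable ℂ fun μ : ℂ => μ + m + 1)
    exact (this.const_mul _).differentiableOn
  exact hd.differentiableAt (Metric.isOpen_ball.mem_nhds (by simp))

theorem hasDerivAt_clifford (μ y : ℂ) : HasDerivAt (clifford μ) (clifford (μ + 1) y) y := by
  obtain ⟨C, -, hC⟩ := exists_norm_inv_Gamma_le (‖μ‖ + 1)
  have hC1 : ∀ m : ℕ, ‖(Complex.Gamma (μ + 1 + m + 1))⁻¹‖ ≤ C :=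
    hC (μ + 1) ((norm_add_le _ _).trans (by simp))
  have key := hasDerivAt_tsum_of_isPreconnected (𝕜 := ℂ) (F := ℂ)
    (u := fun m : ℕ => (m : ℝ) * (‖y‖ + 1) ^ (m - 1) / m.factorial * C)
    (g := fun (m : ℕ) (y : ℂ) => y ^ m / (m.factorial : ℂ) * (Complex.Gamma (μ + m + 1))⁻¹)
    (g' := fun (m : ℕ) (y : ℂ) =>
      (m * y ^ (m - 1)) / (m.factorial : ℂ) * (Complex.Gamma (μ + m + 1))⁻¹)
    (t := Metric.ball (0 : ℂ) (‖y‖ + 1)) (y₀ := 0) (y := y) ?_ Metric.isOpen_ball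
    (convex_ball _ _).isPreconnected ?_ ?_ (by simp; positivity) (summable_clifford μ 0) (by simp)
  · refine HasDerivAt.congr_deriv key ?_
    rw [Summable.tsum_eq_zero_add]
    · simp only [Nat.cast_zero, zero_mul, zero_div, zero_add, clifford]
      refine tsum_congr fun m => ?_
      rw [Nat.factorial_succ, Nat.add_sub_cancel, Nat.cast_mul,
        mul_div_mul_left _ _ (by exact_mod_cast Nat.succ_ne_zero m)]
      congr 3
      push_cast; ring
    · rw [← summable_nat_add_iff 1]
      refine (summable_clifford (μ + 1) y).congr fun m => ?_
      rw [Nat.factorial_succ, Nat.add_sub_cancel, Nat.cast_mul,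
        mul_div_mul_left _ _ (by exact_mod_cast Nat.succ_ne_zero m)]
      congr 3
      push_cast; ring
  · rw [← summable_nat_add_iff 1]
    refine ((Real.summable_pow_div_factorial (‖y‖ + 1)).mul_right C).congr fun m => ?_
    rw [Nat.factorial_succ, Nat.add_sub_cancel, Nat.cast_mul,
        mul_div_mul_left _ _ (by exact_mod_cast Nat.succ_ne_zero m)]
  · intro m z _
    exact ((hasDerivAt_pow m z).div_const _).mul_const _
  · intro m z hz
    rw [norm_mul, norm_div, norm_mul, norm_pow, Complex.norm_natCast, Complex.norm_natCast]
    have h1 : ‖z‖ ≤ ‖y‖ + 1 := by simpa using (Metric.mem_ball.1 hz).le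
    have h2 := hC μ (by linarith) m
    gcongr

/-- Comes from writing `1/Γ(μ+m) = (μ+m)/Γ(μ+m+1)`: the summand `m` cancels against `m!` and shifts
the series by one. -/
theorem clifford_recurrence (μ y : ℂ) :
    clifford (μ - 1) y = μ * clifford μ y + y * clifford (μ + 1) y := by
  have h1 : ∀ m : ℕ, y ^ m / (m.factorial : ℂ) * (Complex.Gamma (μ - 1 + m + 1))⁻¹ =
      μ * (y ^ m / (m.factorial : ℂ) * (Complex.Gamma (μ + m + 1))⁻¹) +
      m * (y ^ m / (m.factorial : ℂ) * (Complex.Gamma (μ + m + 1))⁻¹) := by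
    intro m
    rw [show μ - 1 + m + 1 = μ + m by ring,
      Complex.one_div_Gamma_eq_self_mul_one_div_Gamma_add_one (μ + m)]
    ring
  have h2 : ∀ m : ℕ, ((m + 1 : ℕ) : ℂ) * (y ^ (m + 1) / ((m + 1).factorial : ℂ) *
      (Complex.Gamma (μ + (m + 1 : ℕ) + 1))⁻¹) =
      y * (y ^ m / (m.factorial : ℂ) * (Complex.Gamma (μ + 1 + m + 1))⁻¹) := by
    intro m
    rw [Nat.factorial_succ, Nat.cast_mul, show μ + ((m + 1 : ℕ) : ℂ) + 1 = μ + 1 + m + 1 by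
      push_cast; ring, pow_succ]
    have : ((m + 1 : ℕ) : ℂ) ≠ 0 := by exact_mod_cast Nat.succ_ne_zero m
    have : (m.factorial : ℂ) ≠ 0 := by exact_mod_cast m.factorial_ne_zero
    field_simp
  have hs : Summable fun m : ℕ => (m : ℂ) * (y ^ m / (m.factorial : ℂ) *
      (Complex.Gamma (μ + m + 1))⁻¹) := by
    rw [← summable_nat_add_iff 1]
    exact ((summable_clifford (μ + 1) y).mul_left y).congr fun m => (h2 m).symm
  unfold clifford
  rw [tsum_congr h1, Summable.tsum_add ((summable_clifford μ y).mul_left μ) hs, tsum_mul_left,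
    hs.tsum_eq_zero_add, ← tsum_mul_left, ← tsum_mul_left, tsum_congr h2]
  simp

/-- The first `n` coefficients vanish at the poles of `Γ`; the remaining ones are symmetric in `m`
and `m + n`. -/
theorem clifford_neg_natCast (n : ℕ) (y : ℂ) : clifford (-n) y = y ^ n * clifford n y := by
  unfold clifford
  rw [← (summable_clifford (-n) y).sum_add_tsum_nat_add n, Finset.sum_eq_zero, zero_add,
    ← tsum_mul_left]
  · refine tsum_congr fun m => ?_
    rw [show -(n : ℂ) + ((m + n : ℕ) : ℂ) + 1 = m + 1 by push_cast; ring,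
      show (n : ℂ) + m + 1 = ((m + n : ℕ) : ℂ) + 1 by push_cast; ring,
      Complex.Gamma_nat_eq_factorial, Complex.Gamma_nat_eq_factorial, pow_add]
    ring
  · intro m hm
    have hmn := Finset.mem_range.1 hm
    rw [show -(n : ℂ) + m + 1 = -((n - m - 1 : ℕ) : ℂ) by
      rw [Nat.cast_sub (by omega), Nat.cast_sub hmn.le]; push_cast; ring,
      Complex.Gamma_neg_nat_eq_zero, inv_zero, mul_zero]

theorem clifford_neg_intCast (n : ℤ) {y : ℂ} (hy : y ≠ 0) :
    clifford (-n) y = y ^ n * clifford n y := by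
  obtain ⟨k, rfl | rfl⟩ := n.eq_nat_or_neg
  · simpa using clifford_neg_natCast k y
  · have := clifford_neg_natCast k y
    push_cast
    rw [this, neg_neg, zpow_neg, zpow_natCast, inv_mul_cancel_left₀ (pow_ne_zero _ hy)]

/-- Chu-Vandermonde for reciprocal Gamma values. -/
theorem sum_choose_inv_Gamma (N : ℕ) : ∀ a b : ℂ,
    ∑ j ∈ Finset.range (N + 1), (N.choose j : ℂ) *
      ((Complex.Gamma (a - j + 1))⁻¹ * (Complex.Gamma (b + j + 1))⁻¹) =
    (ascPochhammer ℂ N).eval (a + b + 1) *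
      ((Complex.Gamma (a + 1))⁻¹ * (Complex.Gamma (b + N + 1))⁻¹) := by
  induction N with
  | zero => intro a b; simp
  | succ N ih =>
    intro a b
    rw [Finset.sum_range_succ']
    -- Pascal's rule splits the sum into the case `N` at `(a-1, b+1)` and the case `N` at `(a, b)`.
    have e : ∀ j ∈ Finset.range (N + 1), ((N + 1).choose (j + 1) : ℂ) *
        ((Complex.Gamma (a - (j + 1 : ℕ) + 1))⁻¹ * (Complex.Gamma (b + (j + 1 : ℕ) + 1))⁻¹) =
        (N.choose j : ℂ) *
        ((Complex.Gamma ((a - 1) - j + 1))⁻¹ * (Complex.Gamma ((b + 1) + j + 1))⁻¹) +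
        (N.choose (j + 1) : ℂ) *
        ((Complex.Gamma (a - (j + 1 : ℕ) + 1))⁻¹ * (Complex.Gamma (b + (j + 1 : ℕ) + 1))⁻¹) := by
      intro j _
      rw [Nat.choose_succ_succ]
      push_cast
      rw [show a - ((j : ℂ) + 1) = a - 1 - j by ring, show b + ((j : ℂ) + 1) = b + 1 + j by ring]
      ring
    rw [Finset.sum_congr rfl e, Finset.sum_add_distrib, ih (a - 1) (b + 1), add_assoc]
    have e2 : ∑ j ∈ Finset.range (N + 1), (N.choose (j + 1) : ℂ) *
        ((Complex.Gamma (a - (j + 1 : ℕ) + 1))⁻¹ * (Complex.Gamma (b + (j + 1 : ℕ) + 1))⁻¹) +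
        ((N + 1).choose 0 : ℂ) *
        ((Complex.Gamma (a - (0 : ℕ) + 1))⁻¹ * (Complex.Gamma (b + (0 : ℕ) + 1))⁻¹) =
        ∑ j ∈ Finset.range (N + 1), (N.choose j : ℂ) *
        ((Complex.Gamma (a - j + 1))⁻¹ * (Complex.Gamma (b + j + 1))⁻¹) := by
      rw [Finset.sum_range_succ' (fun j => (N.choose j : ℂ) *
        ((Complex.Gamma (a - j + 1))⁻¹ * (Complex.Gamma (b + j + 1))⁻¹)), Finset.sum_range_succ]
      simp
    rw [e2, ih a b, show a - 1 + (b + 1) + 1 = a + b + 1 by ring, show a - 1 + 1 = a by ring,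
      show b + 1 + (N : ℂ) + 1 = b + N + 1 + 1 by ring, ascPochhammer_succ_eval,
      Complex.one_div_Gamma_eq_self_mul_one_div_Gamma_add_one a,
      Complex.one_div_Gamma_eq_self_mul_one_div_Gamma_add_one (b + N + 1)]
    push_cast
    rw [show b + ((N : ℂ) + 1) + 1 = b + N + 1 + 1 by ring]
    ring

/-- In the Cauchy product at equal arguments each antidiagonal is a Chu-Vandermonde sum, with
parameters `β + n` and `α`. -/
theorem hasSum_clifford_mul (α β y : ℂ) :
    HasSum (fun n : ℕ => y ^ n / (n.factorial : ℂ) * ((ascPochhammer ℂ n).eval (α + β + n + 1) *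
      ((Complex.Gamma (α + n + 1))⁻¹ * (Complex.Gamma (β + n + 1))⁻¹)))
      (clifford α y * clifford β y) := by
  have h := summable_norm_sum_mul_antidiagonal_of_summable_norm (summable_norm_clifford α y)
    (summable_norm_clifford β y)
  have h2 := tsum_mul_tsum_eq_tsum_sum_antidiagonal_of_summable_norm (summable_norm_clifford α y)
    (summable_norm_clifford β y)
  have h3 := h.of_norm.hasSum
  rw [← h2] at h3
  refine h3.of_forall_eq fun n => ?_
  have key := sum_choose_inv_Gamma n (β + n) α
  rw [show β + n + α + 1 = α + β + n + 1 by ring] at key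
  rw [mul_comm (Complex.Gamma (α + n + 1))⁻¹, ← key, Finset.mul_sum,
    Finset.Nat.sum_antidiagonal_eq_sum_range_succ (fun k l =>
      y ^ k / (k.factorial : ℂ) * (Complex.Gamma (α + k + 1))⁻¹ *
      (y ^ l / (l.factorial : ℂ) * (Complex.Gamma (β + l + 1))⁻¹))]
  refine Finset.sum_congr rfl fun j hj => ?_
  have hjn : j ≤ n := Nat.lt_succ_iff.1 (Finset.mem_range.1 hj)
  rw [Nat.cast_choose ℂ hjn, Nat.cast_sub hjn, show β + n - j + 1 = β + (n - j) + 1 by ring]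
  have h1 : (n.factorial : ℂ) ≠ 0 := by exact_mod_cast n.factorial_ne_zero
  have hy : y ^ n = y ^ j * y ^ (n - j) := by rw [← pow_add, Nat.add_sub_cancel' hjn]
  rw [hy]
  field_simp

/-- The sum of the two indices is the same for all `j`, so the Pochhammer factor of the product
series is common to all summands. A second Chu-Vandermonde sum over `j` supplies `N` further
factors. This is the series that the Gaussian integrals of the kernel produce, read there from left
to right. -/
theorem hasSum_sum_choose_clifford_mul (N : ℕ) (α β y : ℂ) :
    HasSum (fun n : ℕ => y ^ n / (n.factorial : ℂ) *
      ((ascPochhammer ℂ (n + N)).eval (α + β + n + 1) *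
      ((Complex.Gamma (α + n + 1))⁻¹ * (Complex.Gamma (β + N + n + 1))⁻¹)))
      (∑ j ∈ Finset.range (N + 1), (N.choose j : ℂ) * (clifford (α - j) y * clifford (β + j) y)) := by
  have h := hasSum_sum (s := Finset.range (N + 1)) fun j _ =>
    (hasSum_clifford_mul (α - j) (β + j) y).mul_left (N.choose j : ℂ)
  refine h.of_forall_eq fun n => ?_
  have key := sum_choose_inv_Gamma N (α + n) (β + n)
  have hp : (ascPochhammer ℂ (n + N)).eval (α + β + n + 1) =
      (ascPochhammer ℂ n).eval (α + β + n + 1) *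
      (ascPochhammer ℂ N).eval (α + n + (β + n) + 1) := by
    rw [← ascPochhammer_mul, Polynomial.eval_mul, Polynomial.eval_comp]
    simp only [Polynomial.eval_add, Polynomial.eval_X, Polynomial.eval_natCast]
    congr 2; ring
  rw [hp, show β + N + n + 1 = β + n + N + 1 by ring, mul_assoc, ← key, Finset.mul_sum,
    Finset.mul_sum]
  refine Finset.sum_congr rfl fun j _ => ?_
  rw [show α - j + (β + j) + n + 1 = α + β + n + 1 by ring,
    show α + n - j + 1 = α - j + n + 1 by ring, show β + n + j + 1 = β + j + n + 1 by ring]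
  ring

end

/-! ### Regularity and symmetries of the kernel -/

noncomputable section

theorem sin_pi_mul_eq_zero_iff (ν : ℂ) : Complex.sin (Real.pi * ν) = 0 ↔ ∃ n : ℤ, ν = n := by
  rw [Complex.sin_eq_zero_iff]
  have hpi : (Real.pi : ℂ) ≠ 0 := by exact_mod_cast Real.pi_ne_zero
  refine exists_congr fun n => ?_
  rw [mul_comm, mul_left_inj' hpi]

theorem norm_half_ne_zero {u : ℂ} (hu : u ≠ 0) : ((‖u / 2‖ : ℝ) : ℂ) ≠ 0 := by
  simpa using hu

theorem differentiable_besselJKernel (p : ℤ) {u : ℂ} (hu : u ≠ 0) :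
    Differentiable ℂ fun ν => besselJKernel ν p u := by
  have h := norm_half_ne_zero hu
  simp only [besselJKernel, besselJStar_eq_clifford]
  have h1 : Differentiable ℂ fun ν : ℂ => ((‖u / 2‖ : ℝ) : ℂ) ^ (2 * ν) := fun ν =>
    ((by fun_prop : DifferentiableAt ℂ (fun ν : ℂ => 2 * ν) ν)).const_cpow (Or.inl h)
  have h2 : Differentiable ℂ fun ν : ℂ => clifford (ν - p) (-(u / 2) ^ 2) :=
    (differentiable_clifford_left _).comp (by fun_prop : Differentiable ℂ fun ν : ℂ => ν - p)
  have h3 : Differentiable ℂ fun ν : ℂ => clifford (ν + p) (-((starRingEnd ℂ) u / 2) ^ 2) :=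
    (differentiable_clifford_left _).comp (by fun_prop : Differentiable ℂ fun ν : ℂ => ν + p)
  exact ((h1.mul_const _).mul h2).mul h3

theorem continuousOn_besselJKernel (p : ℤ) :
    ContinuousOn (fun x : ℂ × ℂ => besselJKernel x.1 p x.2) {x | x.2 ≠ 0} := by
  simp only [besselJKernel, besselJStar_eq_clifford]
  refine ContinuousOn.mul (ContinuousOn.mul (ContinuousOn.mul ?_ ?_) ?_) ?_
  · refine ContinuousOn.cpow (by fun_prop) (by fun_prop) fun x hx => ?_
    left
    rw [Complex.ofReal_re]
    exact norm_pos_iff.2 (div_ne_zero hx two_ne_zero)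
  · refine ContinuousOn.zpow₀ (ContinuousOn.div (by fun_prop) (by fun_prop) fun x hx => ?_) _
      fun x hx => Or.inl ?_
    · simpa using hx
    · refine div_ne_zero hx ?_
      simpa using hx
  · exact (continuous_clifford.comp (by fun_prop :
      Continuous fun x : ℂ × ℂ => (x.1 - p, -(x.2 / 2) ^ 2))).continuousOn
  · have : Continuous fun x : ℂ × ℂ => (x.1 + p, -((starRingEnd ℂ) x.2 / 2) ^ 2) := by
      have := Complex.continuous_conj
      fun_prop
    exact (continuous_clifford.comp this).continuousOn

/-- Both Clifford factors are reflected by `clifford_neg_intCast`, and the resulting powers of `u`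
and its conjugate cancel against the modulus and the angular factor. So the numerator of the
quotient vanishes at every integer and the singularities are removable. -/
theorem besselJKernel_neg_intCast (n p : ℤ) {u : ℂ} (hu : u ≠ 0) :
    besselJKernel (-n) (-p) u = besselJKernel n p u := by
  have hc : (starRingEnd ℂ) u ≠ 0 := by simpa using hu
  have hr : ((‖u‖ : ℝ) : ℂ) ≠ 0 := by simpa using hu
  have hmul : u * (starRingEnd ℂ) u = ((‖u‖ : ℝ) : ℂ) ^ 2 := by
    rw [Complex.mul_conj, Complex.normSq_eq_norm_sq]; push_cast; rfl
  simp only [besselJKernel, besselJStar_eq_clifford]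
  have e1 := clifford_neg_intCast (n - p) (y := -(u / 2) ^ 2) (by simpa using hu)
  have e2 := clifford_neg_intCast (n + p) (y := -((starRingEnd ℂ) u / 2) ^ 2) (by simpa using hc)
  push_cast at e1 e2 ⊢
  rw [show -(n : ℂ) - -p = -(n - p) by ring, show -(n : ℂ) + -p = -(n + p) by ring, e1, e2]
  have p1 : ((‖u / 2‖ : ℝ) : ℂ) ^ (2 * -(n : ℂ)) = (((‖u / 2‖ : ℝ) : ℂ) ^ 2) ^ (-n) := by
    rw [← zpow_natCast, ← zpow_mul, ← Complex.cpow_intCast]; push_cast; ring_nf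
  have p2 : ((‖u / 2‖ : ℝ) : ℂ) ^ (2 * (n : ℂ)) = (((‖u / 2‖ : ℝ) : ℂ) ^ 2) ^ n := by
    rw [← zpow_natCast, ← zpow_mul, ← Complex.cpow_intCast]; push_cast; ring_nf
  have p3 : -2 * -p = (2 : ℤ) * p := by ring
  have hn : ((‖u / 2‖ : ℝ) : ℂ) ^ 2 = (u / 2) * ((starRingEnd ℂ) u / 2) := by
    rw [norm_div]; push_cast; rw [div_pow, ← hmul]; simp; ring
  have key : (((‖u / 2‖ : ℝ) : ℂ) ^ 2) ^ (-n) * (u / ((‖u‖ : ℝ) : ℂ)) ^ (2 * p) *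
      (-(u / 2) ^ 2) ^ (n - p) * (-((starRingEnd ℂ) u / 2) ^ 2) ^ (n + p) =
      (((‖u / 2‖ : ℝ) : ℂ) ^ 2) ^ n * (u / ((‖u‖ : ℝ) : ℂ)) ^ (-(2 * p)) := by
    have hsq : (u / ((‖u‖ : ℝ) : ℂ)) ^ 2 = u / (starRingEnd ℂ) u := by
      rw [div_pow, ← hmul]; field_simp
    rw [hn, zpow_neg _ (2 * p), zpow_mul, zpow_ofNat, hsq]
    have ha : u / 2 ≠ 0 := by simpa using hu
    have hb : (starRingEnd ℂ) u / 2 ≠ 0 := by simpa using hu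
    rw [show u / (starRingEnd ℂ) u = (u / 2) / ((starRingEnd ℂ) u / 2) by field_simp]
    generalize u / 2 = a at *
    generalize (starRingEnd ℂ) u / 2 = b at *
    have hna : -a ^ 2 ≠ 0 := neg_ne_zero.2 (pow_ne_zero _ ha)
    have hnb : -b ^ 2 ≠ 0 := neg_ne_zero.2 (pow_ne_zero _ hb)
    have h1 : (-a ^ 2) ^ n * (-b ^ 2) ^ n = (a * b) ^ n * (a * b) ^ n := by
      rw [← mul_zpow, ← mul_zpow]; ring_nf
    have h2 : (-b ^ 2) ^ p = (-a ^ 2) ^ p * (((a / b) ^ p)⁻¹ * ((a / b) ^ p)⁻¹) := by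
      rw [← inv_zpow, ← mul_zpow, ← mul_zpow, inv_div]
      congr 1; field_simp
    have h3 := zpow_ne_zero n (mul_ne_zero ha hb)
    have h4 := zpow_ne_zero p (div_ne_zero ha hb)
    have h5 := zpow_ne_zero p hna
    rw [zpow_sub₀ hna, zpow_add₀ hnb, zpow_neg, h2]
    generalize (a / b) ^ p = x at *
    generalize (-a ^ 2) ^ p = y at *
    calc _ = ((a * b) ^ n)⁻¹ * ((-a ^ 2) ^ n * (-b ^ 2) ^ n) * (x * x⁻¹) * x⁻¹ * (y / y) := by
          ring
      _ = _ := by rw [h1, mul_inv_cancel₀ h4, div_self h5, mul_one, mul_one,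
                    inv_mul_cancel_left₀ h3]
  rw [p1, p2, p3, show (-2 : ℤ) * p = -(2 * p) by ring]
  linear_combination (clifford (n - p) (-(u / 2) ^ 2) *
    clifford (n + p) (-((starRingEnd ℂ) u / 2) ^ 2)) * key

theorem besselK_of_sin_ne_zero {ν : ℂ} (h : Complex.sin (Real.pi * ν) ≠ 0) (p : ℤ) (u : ℂ) :
    besselK ν p u = besselKQuotient ν p u := by
  unfold besselK; rw [if_neg h]

theorem differentiable_besselKQuotient_num (p : ℤ) {u : ℂ} (hu : u ≠ 0) :
    Differentiable ℂ fun ν => besselJKernel (-ν) (-p) u - besselJKernel ν p u :=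
  ((differentiable_besselJKernel (-p) hu).comp differentiable_neg).sub
    (differentiable_besselJKernel p hu)

theorem eventually_sin_pi_mul_ne_zero (n : ℤ) :
    ∀ᶠ s : ℂ in nhds (n : ℂ), s ≠ n → Complex.sin (Real.pi * s) ≠ 0 := by
  filter_upwards [Metric.ball_mem_nhds (n : ℂ) one_pos] with s hs hsn h0
  obtain ⟨m, rfl⟩ := (sin_pi_mul_eq_zero_iff s).1 h0
  rw [Metric.mem_ball, dist_eq_norm, ← Int.cast_sub, Complex.norm_intCast] at hs
  have : |m - n| < 1 := by exact_mod_cast hs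
  exact hsn (by rw [show m = n by rw [abs_lt] at this; omega])

/-- The Bessel kernel is entire in its parameter. -/
theorem differentiable_besselK (p : ℤ) {u : ℂ} (hu : u ≠ 0) :
    Differentiable ℂ fun ν => besselK ν p u := by
  intro ν
  have hD := differentiable_besselKQuotient_num p hu
  have hsin : Differentiable ℂ fun ν : ℂ => Complex.sin (Real.pi * ν) := by fun_prop
  by_cases h : Complex.sin (Real.pi * ν) = 0
  · obtain ⟨n, rfl⟩ := (sin_pi_mul_eq_zero_iff ν).1 h
    set D : ℂ → ℂ := fun ν => besselJKernel (-ν) (-p) u - besselJKernel ν p u with hDdef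
    set S : ℂ → ℂ := fun ν => Complex.sin (Real.pi * ν) with hSdef
    -- Numerator and denominator both vanish at `n`, so away from `n` the quotient equals the
    -- quotient of the difference quotients. The latter is differentiable at `n` because the zero of
    -- the sine is simple.
    set g : ℂ → ℂ := fun s => dslope D n s / dslope S n s with hg
    have hS0 : dslope S n n ≠ 0 := by
      have : HasDerivAt S (Complex.cos (Real.pi * n) * (Real.pi * 1)) n :=
        ((hasDerivAt_id (n : ℂ)).const_mul (Real.pi : ℂ)).csin
      rw [dslope_same, this.deriv, mul_one]
      refine mul_ne_zero ?_ (by exact_mod_cast Real.pi_ne_zero)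
      intro hc
      have := Complex.sin_sq_add_cos_sq (Real.pi * n)
      rw [hc, h] at this
      simp at this
    have hd1 : DifferentiableAt ℂ (dslope D n) n :=
      ((Complex.differentiableOn_dslope Filter.univ_mem).2 hD.differentiableOn).differentiableAt
        Filter.univ_mem
    have hd2 : DifferentiableAt ℂ (dslope S n) n :=
      ((Complex.differentiableOn_dslope Filter.univ_mem).2 hsin.differentiableOn).differentiableAt
        Filter.univ_mem
    have hgd : DifferentiableAt ℂ g n := hd1.div hd2 hS0
    have hQ : ∀ s : ℂ, s ≠ n → besselKQuotient s p u = g s := by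
      intro s hs
      have h0 : D n = 0 := by
        rw [hDdef]; simp only; rw [besselJKernel_neg_intCast n p hu, sub_self]
      have h1 : S n = 0 := h
      rw [hg]
      simp only
      rw [dslope_of_ne _ hs, dslope_of_ne _ hs, slope_def_field, slope_def_field, h0, h1, sub_zero,
        sub_zero, div_div_div_cancel_right₀ (sub_ne_zero.2 hs)]
      rfl
    refine hgd.congr_of_eventuallyEq ?_
    filter_upwards [eventually_sin_pi_mul_ne_zero n] with s hs
    by_cases hsn : s = n
    · subst hsn
      unfold besselK
      rw [if_pos h]
      refine Filter.Tendsto.limUnder_eq ?_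
      refine (hgd.continuousAt.tendsto.mono_left nhdsWithin_le_nhds).congr' ?_
      filter_upwards [self_mem_nhdsWithin] with s hs
      exact (hQ s hs).symm
    · rw [besselK_of_sin_ne_zero (hs hsn), hQ s hsn]
  · have hq : DifferentiableAt ℂ (fun ν => besselKQuotient ν p u) ν := (hD ν).div (hsin ν) h
    refine hq.congr_of_eventuallyEq ?_
    filter_upwards [hsin.continuous.continuousAt.eventually_ne h] with s hs
    exact besselK_of_sin_ne_zero hs p u

/-- The maximum principle in the parameter. It gives bounds at and near integer parameters, where
the defining quotient is of the form `0/0`. -/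
theorem norm_besselK_le_of_sphere (p : ℤ) {u : ℂ} (hu : u ≠ 0) {c : ℂ} {r B : ℝ} (hr : r ≠ 0)
    (hB : ∀ z ∈ Metric.sphere c r, ‖besselK z p u‖ ≤ B) {s : ℂ} (hs : s ∈ Metric.closedBall c r) :
    ‖besselK s p u‖ ≤ B := by
  refine Complex.norm_le_of_forall_mem_frontier_norm_le Metric.isBounded_ball
    (differentiable_besselK p hu).diffContOnCl ?_ (by rwa [closure_ball c hr])
  rwa [frontier_ball c hr]

theorem continuousOn_besselKQuotient (p : ℤ) :
    ContinuousOn (fun x : ℂ × ℂ => besselKQuotient x.1 p x.2)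
      {x | Complex.sin (Real.pi * x.1) ≠ 0 ∧ x.2 ≠ 0} := by
  unfold besselKQuotient
  have hsub : ∀ x ∈ {x : ℂ × ℂ | Complex.sin (Real.pi * x.1) ≠ 0 ∧ x.2 ≠ 0}, x.2 ≠ 0 :=
    fun x hx => hx.2
  have h1 : ContinuousOn (fun x : ℂ × ℂ => besselJKernel (-x.1) (-p) x.2)
      {x | Complex.sin (Real.pi * x.1) ≠ 0 ∧ x.2 ≠ 0} :=
    ContinuousOn.comp (g := fun x : ℂ × ℂ => besselJKernel x.1 (-p) x.2)
      (f := fun x : ℂ × ℂ => (-x.1, x.2)) (continuousOn_besselJKernel (-p))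
      (by fun_prop) hsub
  have h2 : Continuous fun x : ℂ × ℂ => Complex.sin (Real.pi * x.1) := by fun_prop
  exact (h1.sub ((continuousOn_besselJKernel p).mono hsub)).div h2.continuousOn fun x hx => hx.1

theorem continuousOn_besselK (p : ℤ) :
    ContinuousOn (fun x : ℂ × ℂ => besselK x.1 p x.2)
      {x | Complex.sin (Real.pi * x.1) ≠ 0 ∧ x.2 ≠ 0} :=
  (continuousOn_besselKQuotient p).congr fun x hx => besselK_of_sin_ne_zero hx.1 p x.2

theorem continuousOn_besselK_right {ν : ℂ} (h : Complex.sin (Real.pi * ν) ≠ 0) (p : ℤ) :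
    ContinuousOn (besselK ν p) {0}ᶜ :=
  ContinuousOn.comp (g := fun x : ℂ × ℂ => besselK x.1 p x.2) (f := fun u : ℂ => (ν, u))
    (continuousOn_besselK p) (by fun_prop) fun _ hu => ⟨h, hu⟩

/-- At an integer `n` the kernel is the pointwise limit of the kernels at `n + 1/(k+1)`, which are
continuous off the origin for large `k`. -/
theorem aestronglyMeasurable_besselK (ν : ℂ) (p : ℤ) :
    MeasureTheory.AEStronglyMeasurable (besselK ν p) MeasureTheory.volume := by
  have hm : ∀ ν : ℂ, Complex.sin (Real.pi * ν) ≠ 0 →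
      MeasureTheory.AEStronglyMeasurable (besselK ν p) MeasureTheory.volume := by
    intro ν h
    have := (continuousOn_besselK_right h p).aestronglyMeasurable (μ := MeasureTheory.volume)
      (measurableSet_singleton (0 : ℂ)).compl
    rwa [MeasureTheory.Measure.restrict_eq_self_of_ae_mem] at this
    exact MeasureTheory.compl_mem_ae_iff.2 (by simp)
  by_cases h : Complex.sin (Real.pi * ν) = 0
  · obtain ⟨n, rfl⟩ := (sin_pi_mul_eq_zero_iff ν).1 h
    have ht : Filter.Tendsto (fun k : ℕ => (n : ℂ) + 1 / ((k : ℂ) + 1)) Filter.atTop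
        (nhds (n : ℂ)) := by
      simpa using (tendsto_one_div_add_atTop_nhds_zero_nat (𝕜 := ℂ)).const_add (n : ℂ)
    have hne : ∀ᶠ k : ℕ in Filter.atTop, Complex.sin (Real.pi * (n + 1 / ((k : ℂ) + 1))) ≠ 0 := by
      filter_upwards [ht.eventually (eventually_sin_pi_mul_ne_zero n)] with k hk
      refine hk ?_
      simpa using Nat.cast_add_one_ne_zero k
    obtain ⟨K, hK⟩ := Filter.eventually_atTop.1 hne
    refine aestronglyMeasurable_of_tendsto_ae (u := Filter.atTop)
      (f := fun (k : ℕ) => besselK (n + 1 / (((k + K : ℕ) : ℂ) + 1)) p)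
      (fun k => hm _ (hK (k + K) (by omega))) ?_
    filter_upwards [MeasureTheory.compl_mem_ae_iff.2
      (by simp : MeasureTheory.volume ({0} : Set ℂ) = 0)] with u hu
    exact ((differentiable_besselK p hu).continuous.tendsto _).comp
      (ht.comp (Filter.tendsto_add_atTop_nat K))
  · exact hm ν h

/-- At an integer parameter joint continuity is available on the circle of radius `1/2` around it,
which contains no integer; the maximum principle brings the bound to the centre. -/
theorem exists_norm_besselK_le_on_compact (ν : ℂ) (p : ℤ) {s : Set ℂ} (hs : IsCompact s)
    (h0 : (0 : ℂ) ∉ s) : ∃ C : ℝ, ∀ u ∈ s, ‖besselK ν p u‖ ≤ C := by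
  have hne : ∀ u ∈ s, u ≠ 0 := fun u hu h => h0 (h ▸ hu)
  by_cases h : Complex.sin (Real.pi * ν) = 0
  · obtain ⟨n, rfl⟩ := (sin_pi_mul_eq_zero_iff ν).1 h
    have hS : ∀ z ∈ Metric.sphere (n : ℂ) (1 / 2), Complex.sin (Real.pi * z) ≠ 0 := by
      intro z hz h0
      obtain ⟨m, rfl⟩ := (sin_pi_mul_eq_zero_iff z).1 h0
      rw [mem_sphere_iff_norm, ← Int.cast_sub, Complex.norm_intCast] at hz
      have h2 : |(((m - n : ℤ)) : ℝ)| * 2 = 1 := by rw [hz]; norm_num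
      rw [← Int.cast_abs] at h2
      have : |m - n| * 2 = 1 := by exact_mod_cast h2
      omega
    obtain ⟨C, hC⟩ := ((isCompact_sphere (n : ℂ) (1 / 2)).prod hs).exists_bound_of_continuousOn
      ((continuousOn_besselK p).mono fun x hx => ⟨hS x.1 hx.1, hne x.2 hx.2⟩)
    refine ⟨C, fun u hu => norm_besselK_le_of_sphere p (hne u hu) (by norm_num : (1 / 2 : ℝ) ≠ 0)
      (fun z hz => hC (z, u) ⟨hz, hu⟩) (Metric.mem_closedBall_self (by norm_num))⟩
  · exact hs.exists_bound_of_continuousOn ((continuousOn_besselK_right h p).mono fun u hu => hne u hu)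

theorem integrable_mulLebesgue_iff (g : ℂ → ℂ) :
    MeasureTheory.Integrable g mulLebesgue ↔
      MeasureTheory.Integrable (fun u => (((‖u‖ ^ 2)⁻¹ : ℝ) : ℂ) * g u) := by
  unfold mulLebesgue
  rw [MeasureTheory.integrable_withDensity_iff_integrable_smul' (by fun_prop)
    (Filter.Eventually.of_forall fun _ => ENNReal.ofReal_lt_top)]
  refine MeasureTheory.integrable_congr (Filter.Eventually.of_forall fun u => ?_)
  simp only
  rw [ENNReal.toReal_ofReal (by positivity), Complex.real_smul]

theorem integral_mulLebesgue (g : ℂ → ℂ) :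
    ∫ u, g u ∂mulLebesgue = ∫ u, (((‖u‖ ^ 2)⁻¹ : ℝ) : ℂ) * g u := by
  unfold mulLebesgue
  rw [integral_withDensity_eq_integral_toReal_smul (by fun_prop)
    (Filter.Eventually.of_forall fun _ => ENNReal.ofReal_lt_top)]
  refine MeasureTheory.integral_congr_ae (Filter.Eventually.of_forall fun u => ?_)
  simp only
  rw [ENNReal.toReal_ofReal (by positivity), Complex.real_smul]

/-- The density of `f(u) d^×u` with respect to Lebesgue measure. -/
def lebesgueDensity (f : ℂ → ℂ) (u : ℂ) : ℂ := (((‖u‖ ^ 2)⁻¹ : ℝ) : ℂ) * f u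

theorem continuous_lebesgueDensity {f : ℂ → ℂ} (hf : Continuous f) (h0 : (0 : ℂ) ∉ tsupport f) :
    Continuous (lebesgueDensity f) := by
  rw [continuous_iff_continuousAt]
  intro u
  by_cases hu : u = 0
  · subst hu
    have : lebesgueDensity f =ᶠ[nhds 0] fun _ => 0 := by
      filter_upwards [(isClosed_tsupport f).isOpen_compl.mem_nhds h0] with v hv
      rw [lebesgueDensity, image_eq_zero_of_notMem_tsupport hv, mul_zero]
    exact continuousAt_const.congr this.symm
  · unfold lebesgueDensity
    refine ContinuousAt.mul ?_ hf.continuousAt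
    exact Complex.continuous_ofReal.continuousAt.comp
      ((by fun_prop : ContinuousAt (fun u : ℂ => ‖u‖ ^ 2) u).inv₀ (by simpa using hu))

theorem hasCompactSupport_lebesgueDensity {f : ℂ → ℂ} (hf : HasCompactSupport f) :
    HasCompactSupport (lebesgueDensity f) := hf.mul_left

theorem tsupport_lebesgueDensity_subset (f : ℂ → ℂ) : tsupport (lebesgueDensity f) ⊆ tsupport f :=
  tsupport_mul_subset_right

theorem integrable_besselK_mul (ν : ℂ) (p : ℤ) {g : ℂ → ℂ} (hg : Continuous g)
    (hc : HasCompactSupport g) (h0 : (0 : ℂ) ∉ tsupport g) :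
    MeasureTheory.Integrable fun u => besselK ν p u * g u := by
  obtain ⟨C, hC⟩ := exists_norm_besselK_le_on_compact ν p hc h0
  refine ((hg.integrable_of_hasCompactSupport hc).norm.const_mul C).mono'
    ((aestronglyMeasurable_besselK ν p).mul hg.aestronglyMeasurable)
    (Filter.Eventually.of_forall fun u => ?_)
  rw [norm_mul]
  by_cases hu : u ∈ tsupport g
  · exact mul_le_mul_of_nonneg_right (hC u hu) (norm_nonneg _)
  · rw [image_eq_zero_of_notMem_tsupport hu]; simp

theorem integrable_besselK_mul_mulLebesgue (ν : ℂ) (p : ℤ) {f : ℂ → ℂ} (hf : Continuous f)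
    (hc : HasCompactSupport f) (h0 : (0 : ℂ) ∉ tsupport f) :
    MeasureTheory.Integrable (fun u => besselK ν p u * f u) mulLebesgue := by
  rw [integrable_mulLebesgue_iff]
  refine (integrable_besselK_mul ν p (continuous_lebesgueDensity hf h0)
    (hasCompactSupport_lebesgueDensity hc)
    fun h => h0 (tsupport_lebesgueDensity_subset f h)).congr
    (Filter.Eventually.of_forall fun u => ?_)
  simp only [lebesgueDensity]
  ring

theorem besselKTransform_eq (f : ℂ → ℂ) (ν : ℂ) (p : ℤ) :
    besselKTransform f ν p = ∫ u, besselK ν p u * lebesgueDensity f u := by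
  rw [besselKTransform, integral_mulLebesgue]
  refine MeasureTheory.integral_congr_ae (Filter.Eventually.of_forall fun u => ?_)
  simp only [lebesgueDensity]
  ring

theorem besselJKernel_neg_arg (ν : ℂ) (p : ℤ) (u : ℂ) :
    besselJKernel ν p (-u) = besselJKernel ν p u := by
  simp only [besselJKernel, besselJStar_eq_clifford, norm_neg, neg_div, map_neg, even_two.neg_pow]
  rw [Even.neg_zpow ⟨-p, by ring⟩]

theorem besselK_neg_arg (ν : ℂ) (p : ℤ) (u : ℂ) : besselK ν p (-u) = besselK ν p u := by
  simp only [besselK, besselKQuotient, besselJKernel_neg_arg]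

/-- Conjugating the argument exchanges the two Clifford factors and inverts the angular factor.
Estimates for negative `p` thus reduce to `p ≥ 0`. -/
theorem besselJKernel_conj (ν : ℂ) (p : ℤ) {u : ℂ} (hu : u ≠ 0) :
    besselJKernel ν p ((starRingEnd ℂ) u) = besselJKernel ν (-p) u := by
  have hr : ((‖u‖ : ℝ) : ℂ) ≠ 0 := by simpa using hu
  have hn : ‖(starRingEnd ℂ) u / 2‖ = ‖u / 2‖ := by simp
  have hz : ((starRingEnd ℂ) u / ((‖u‖ : ℝ) : ℂ)) = (u / ((‖u‖ : ℝ) : ℂ))⁻¹ := by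
    have hmul : u * (starRingEnd ℂ) u = ((‖u‖ : ℝ) : ℂ) ^ 2 := by
      rw [Complex.mul_conj, Complex.normSq_eq_norm_sq]; push_cast; rfl
    rw [inv_div, div_eq_div_iff hr hu, mul_comm, hmul, sq]
  simp only [besselJKernel, hn, Complex.norm_conj, Complex.conj_conj, hz, inv_zpow]
  rw [← zpow_neg, show -(-2 * p) = -2 * -p by ring]
  push_cast
  rw [sub_neg_eq_add, ← sub_eq_add_neg]
  ring

theorem besselK_conj (ν : ℂ) (p : ℤ) {u : ℂ} (hu : u ≠ 0) :
    besselK ν p ((starRingEnd ℂ) u) = besselK ν (-p) u := by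
  simp only [besselK, besselKQuotient, besselJKernel_conj _ _ hu]

end

/-! ### Growth of the kernel on the line `Re ν = 0` -/

noncomputable section

/-- `ν` keeps distance at least `1/4` from the integers. -/
def FarFromInt (ν : ℂ) : Prop := ∀ j : ℤ, 1 / 4 ≤ ‖(j : ℂ) + ν‖

theorem FarFromInt.neg {ν : ℂ} (h : FarFromInt ν) : FarFromInt (-ν) := fun j => by
  have := h (-j)
  rwa [← norm_neg, show -(((-j : ℤ) : ℂ) + ν) = j + -ν by push_cast; ring] at this

theorem FarFromInt.sin_ne_zero {ν : ℂ} (h : FarFromInt ν) : Complex.sin (Real.pi * ν) ≠ 0 := by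
  intro h0
  obtain ⟨n, rfl⟩ := (sin_pi_mul_eq_zero_iff ν).1 h0
  have := h (-n)
  simp at this
  norm_num at this

theorem farFromInt_mul_I {t : ℝ} (ht : 1 / 4 ≤ |t|) : FarFromInt (t * Complex.I) := fun j => by
  refine ht.trans ?_
  have := Complex.abs_im_le_norm ((j : ℂ) + t * Complex.I)
  simpa using this

theorem farFromInt_of_norm_eq {ν : ℂ} (h : ‖ν‖ = 1 / 2) : FarFromInt ν := fun j => by
  rcases eq_or_ne j 0 with rfl | hj
  · simp [h]; norm_num
  · have h1 : (1 : ℝ) ≤ ‖(j : ℂ)‖ := by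
      rw [Complex.norm_intCast]
      exact_mod_cast Int.one_le_abs hj
    have h2 := norm_sub_le ((j : ℂ) + ν) ν
    rw [add_sub_cancel_right] at h2
    linarith

/-- For `m = 0` this is the reflection formula; its factor `sin πν` later cancels the denominator of
the kernel. Each further step divides by `ν - p + m + 1`, which has modulus at least `1/4`. -/
theorem norm_inv_Gamma_sub_le {ν : ℂ} (h : FarFromInt ν) (p m : ℕ) :
    ‖(Complex.Gamma (ν - p + m + 1))⁻¹‖ ≤
      4 ^ m * (‖Complex.sin (Real.pi * ν)‖ / Real.pi * ‖Complex.Gamma (p - ν)‖) := by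
  induction m with
  | zero =>
    have hs : Complex.sin (Real.pi * (p - ν)) = (-1) ^ p * -Complex.sin (Real.pi * ν) := by
      have hc : Complex.cos (p * Real.pi) = (-1) ^ p := by
        have := Real.cos_nat_mul_pi p
        exact_mod_cast congrArg Complex.ofReal this
      rw [mul_sub, mul_comm (Real.pi : ℂ) (p : ℂ), Complex.sin_sub, Complex.sin_nat_mul_pi, hc]
      ring
    have hr := Complex.Gamma_mul_Gamma_one_sub (p - ν)
    rw [hs, show 1 - ((p : ℂ) - ν) = ν - p + 1 by ring] at hr
    have hn := congrArg norm hr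
    rw [norm_mul, norm_div, norm_mul, norm_neg, norm_pow, norm_neg, norm_one, one_pow, one_mul,
      Complex.norm_real, Real.norm_of_nonneg Real.pi_pos.le] at hn
    have hS : 0 < ‖Complex.sin (Real.pi * ν)‖ := norm_pos_iff.2 h.sin_ne_zero
    have hpi := Real.pi_pos
    have hG : ‖Complex.Gamma (ν - p + 1)‖ ≠ 0 := by
      intro h0
      rw [h0, mul_zero] at hn
      exact (div_pos hpi hS).ne hn
    simp only [Nat.cast_zero, add_zero, pow_zero, one_mul, norm_inv]
    rw [inv_eq_one_div, div_le_iff₀ (lt_of_le_of_ne (norm_nonneg _) hG.symm)]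
    rw [mul_assoc, hn]
    field_simp
    rfl
  | succ m ih =>
    have h4 := h (-(p : ℤ) + m + 1)
    push_cast at h4
    rw [show -(p : ℂ) + m + 1 + ν = ν - p + m + 1 by ring] at h4
    rw [Complex.one_div_Gamma_eq_self_mul_one_div_Gamma_add_one, norm_mul] at ih
    rw [show ν - p + ((m + 1 : ℕ) : ℂ) + 1 = ν - p + m + 1 + 1 by push_cast; ring, pow_succ']
    have := mul_le_mul_of_nonneg_right h4 (norm_nonneg (Complex.Gamma (ν - p + m + 1 + 1))⁻¹)
    linarith

theorem norm_inv_Gamma_add_le {ν : ℂ} (h : FarFromInt ν) (p n : ℕ) :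
    ‖(Complex.Gamma (ν + p + n + 1))⁻¹‖ ≤ 4 ^ n * (4 * ‖(Complex.Gamma (p + ν))⁻¹‖) := by
  induction n with
  | zero =>
    have h4 := h p
    push_cast at h4
    rw [Complex.one_div_Gamma_eq_self_mul_one_div_Gamma_add_one (p + ν), norm_mul]
    have := mul_le_mul_of_nonneg_right h4 (norm_nonneg (Complex.Gamma (p + ν + 1))⁻¹)
    rw [show ν + p + ((0 : ℕ) : ℂ) + 1 = p + ν + 1 by push_cast; ring]
    linarith
  | succ n ih =>
    have h4 := h (p + n + 1)
    push_cast at h4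
    rw [show (p : ℂ) + n + 1 + ν = ν + p + n + 1 by ring] at h4
    rw [Complex.one_div_Gamma_eq_self_mul_one_div_Gamma_add_one, norm_mul] at ih
    rw [show ν + p + ((n + 1 : ℕ) : ℂ) + 1 = ν + p + n + 1 + 1 by push_cast; ring, pow_succ']
    have := mul_le_mul_of_nonneg_right h4 (norm_nonneg (Complex.Gamma (ν + p + n + 1 + 1))⁻¹)
    linarith

/-- The loss `4^m` only rescales the argument of the exponential series, so the bound stays uniform
in the index up to `B`. -/
theorem norm_clifford_le_of_geometric {μ : ℂ} {B : ℝ}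
    (hB : ∀ m : ℕ, ‖(Complex.Gamma (μ + m + 1))⁻¹‖ ≤ 4 ^ m * B) (y : ℂ) :
    ‖clifford μ y‖ ≤ Real.exp (4 * ‖y‖) * B := by
  have hs := (Real.summable_pow_div_factorial (4 * ‖y‖)).mul_right B
  refine (tsum_of_norm_bounded hs.hasSum fun m => ?_).trans ?_
  · rw [norm_mul, norm_div, norm_pow, Complex.norm_natCast, mul_pow]
    calc ‖y‖ ^ m / m.factorial * ‖(Complex.Gamma (μ + m + 1))⁻¹‖
        ≤ ‖y‖ ^ m / m.factorial * (4 ^ m * B) := by gcongr; exact hB m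
      _ = _ := by ring
  · rw [tsum_mul_right, Real.exp_eq_exp_ℝ, NormedSpace.exp_eq_tsum_div]

theorem norm_besselJKernel_le {ν : ℂ} (h : FarFromInt ν) (p : ℕ) {u : ℂ} (hu : u ≠ 0) :
    ‖besselJKernel ν p u‖ ≤ ‖u / 2‖ ^ (2 * ν.re) * (‖Complex.sin (Real.pi * ν)‖ * (4 / Real.pi) *
      (‖Complex.Gamma (p - ν)‖ * ‖(Complex.Gamma (p + ν))⁻¹‖) * Real.exp (2 * ‖u‖ ^ 2)) := by
  have h1 := norm_clifford_le_of_geometric (norm_inv_Gamma_sub_le h p) (-(u / 2) ^ 2)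
  have h2 := norm_clifford_le_of_geometric (norm_inv_Gamma_add_le h p)
    (-((starRingEnd ℂ) u / 2) ^ 2)
  have e1 : 4 * ‖-(u / 2) ^ 2‖ = ‖u‖ ^ 2 := by
    rw [norm_neg, norm_pow, norm_div, Complex.norm_ofNat]; ring
  have e2 : 4 * ‖-((starRingEnd ℂ) u / 2) ^ 2‖ = ‖u‖ ^ 2 := by
    rw [norm_neg, norm_pow, norm_div, Complex.norm_ofNat, Complex.norm_conj]; ring
  rw [e1] at h1
  rw [e2] at h2
  have h3 : ‖(u / ((‖u‖ : ℝ) : ℂ)) ^ (-2 * (p : ℤ))‖ = 1 := by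
    rw [norm_zpow, norm_div, Complex.norm_real, norm_norm, div_self (norm_ne_zero_iff.2 hu),
      one_zpow]
  have h4 : ‖((‖u / 2‖ : ℝ) : ℂ) ^ (2 * ν)‖ = ‖u / 2‖ ^ (2 * ν.re) := by
    rw [Complex.norm_cpow_eq_rpow_re_of_pos (norm_pos_iff.2 (div_ne_zero hu two_ne_zero))]
    simp
  simp only [besselJKernel, besselJStar_eq_clifford, Int.cast_natCast]
  rw [mul_assoc, norm_mul, norm_mul, h3, h4, mul_one, norm_mul]
  refine mul_le_mul_of_nonneg_left ?_ (by positivity)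
  refine (mul_le_mul h1 h2 (norm_nonneg _) (by positivity)).trans_eq ?_
  rw [two_mul, Real.exp_add]
  ring

/-- The half with `-ν, -p` is brought to index `p` by conjugating `u`. In both halves `|sin πν|`
cancels, leaving only the Gamma quotients. -/
theorem norm_besselK_le {ν : ℂ} (h : FarFromInt ν) {p : ℕ} {R : ℝ}
    (h1 : ‖Complex.Gamma (p - ν)‖ * ‖(Complex.Gamma (p + ν))⁻¹‖ ≤ R)
    (h2 : ‖Complex.Gamma (p + ν)‖ * ‖(Complex.Gamma (p - ν))⁻¹‖ ≤ R) {u : ℂ} (hu : u ≠ 0) :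
    ‖besselK ν p u‖ ≤ (‖u / 2‖ ^ (2 * ν.re) + ‖u / 2‖ ^ (-(2 * ν.re))) * (4 / Real.pi) * R *
      Real.exp (2 * ‖u‖ ^ 2) := by
  have hc : (starRingEnd ℂ) u ≠ 0 := by simpa using hu
  have k1 := norm_besselJKernel_le h p hu
  have k2 := norm_besselJKernel_le h.neg p hc
  rw [besselJKernel_conj _ _ hu, mul_neg, Complex.sin_neg, norm_neg, sub_neg_eq_add,
    ← sub_eq_add_neg, Complex.norm_conj, Complex.neg_re, mul_neg,
    show ‖(starRingEnd ℂ) u / 2‖ = ‖u / 2‖ by simp] at k2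
  have hS : 0 < ‖Complex.sin (Real.pi * ν)‖ := norm_pos_iff.2 h.sin_ne_zero
  rw [besselK_of_sin_ne_zero h.sin_ne_zero, besselKQuotient, norm_div, div_le_iff₀ hS]
  refine (norm_sub_le _ _).trans ?_
  have hpi := Real.pi_pos
  have m1 : ‖besselJKernel ν p u‖ ≤ ‖u / 2‖ ^ (2 * ν.re) * (‖Complex.sin (Real.pi * ν)‖ *
      (4 / Real.pi) * R * Real.exp (2 * ‖u‖ ^ 2)) := k1.trans (by gcongr)
  have m2 : ‖besselJKernel (-ν) (-p) u‖ ≤ ‖u / 2‖ ^ (-(2 * ν.re)) *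
      (‖Complex.sin (Real.pi * ν)‖ * (4 / Real.pi) * R * Real.exp (2 * ‖u‖ ^ 2)) :=
    k2.trans (by gcongr)
  refine (add_le_add m2 m1).trans_eq ?_
  ring

/-- Passing from `p + 1` to `p + 2` multiplies the quotient by at most `(p + 3/2)/(p + 1/2)`, and
these factors telescope to `2p + 1`. Compactness of the circle handles the initial value; `p = 0` is
compared with `p = 1`. -/
theorem exists_norm_Gamma_ratio_le : ∃ A : ℝ, 0 ≤ A ∧ ∀ ν : ℂ, ‖ν‖ = 1 / 2 → ∀ p : ℕ,
    ‖Complex.Gamma (p - ν)‖ * ‖(Complex.Gamma (p + ν))⁻¹‖ ≤ A * (1 + p) := by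
  obtain ⟨A, hA⟩ := (isCompact_sphere (0 : ℂ) (1 / 2)).exists_bound_of_continuousOn
    (f := fun ν => Complex.Gamma (1 - ν) * (Complex.Gamma (1 + ν))⁻¹) (by
      refine ContinuousOn.mul (fun ν hν => ContinuousAt.continuousWithinAt ?_)
        (Complex.differentiable_one_div_Gamma.continuous.comp (by fun_prop :
          Continuous fun ν : ℂ => 1 + ν)).continuousOn
      have hre : 0 < (1 - ν).re := by
        have h1 := (abs_le.1 (Complex.abs_re_le_norm ν)).2
        have h2 : ‖ν‖ = 1 / 2 := by simpa using hν
        rw [Complex.sub_re, Complex.one_re]; linarith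
      refine ContinuousAt.comp (g := Complex.Gamma) (f := fun ν : ℂ => 1 - ν) ?_ (by fun_prop)
      refine (Complex.differentiableAt_Gamma _ fun m hm => ?_).continuousAt
      have := congrArg Complex.re hm
      rw [Complex.neg_re, Complex.natCast_re] at this
      have hm0 : (0 : ℝ) ≤ m := m.cast_nonneg
      linarith)
  have key : ∀ ν : ℂ, ‖ν‖ = 1 / 2 → ∀ p : ℕ,
      ‖Complex.Gamma ((p + 1 : ℕ) - ν)‖ * ‖(Complex.Gamma ((p + 1 : ℕ) + ν))⁻¹‖ ≤
        A * (2 * p + 1) := by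
    intro ν hν p
    induction p with
    | zero =>
      have := hA ν (by simpa using hν)
      rw [norm_mul] at this
      simpa using this
    | succ p ih =>
      have hf := (farFromInt_of_norm_eq hν).neg ((p + 1 : ℕ) : ℤ)
      push_cast at hf ih ⊢
      have hne : (p : ℂ) + 1 - ν ≠ 0 := by
        intro h0
        rw [← sub_eq_add_neg, h0, norm_zero] at hf
        norm_num at hf
      rw [show (p : ℂ) + 1 + 1 - ν = p + 1 - ν + 1 by ring, Complex.Gamma_add_one _ hne, norm_mul]
      rw [Complex.one_div_Gamma_eq_self_mul_one_div_Gamma_add_one (p + 1 + ν), norm_mul] at ih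
      rw [show (p : ℂ) + 1 + 1 + ν = p + 1 + ν + 1 by ring]
      have hp1 : ‖(p : ℂ) + 1‖ = p + 1 := by
        have := Complex.norm_natCast (p + 1)
        push_cast at this
        exact this
      have b1 : ‖(p : ℂ) + 1 - ν‖ ≤ p + 3 / 2 := by
        have := norm_sub_le ((p : ℂ) + 1) ν
        linarith
      have b2 : (p : ℝ) + 1 / 2 ≤ ‖(p : ℂ) + 1 + ν‖ := by
        have := norm_sub_le ((p : ℂ) + 1 + ν) ν
        rw [add_sub_cancel_right] at this
        linarith
      set X := ‖Complex.Gamma ((p : ℂ) + 1 - ν)‖ * ‖(Complex.Gamma ((p : ℂ) + 1 + ν + 1))⁻¹‖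
      have hX : 0 ≤ X := by positivity
      have i1 : X * (p + 1 / 2) ≤ A * (2 * p + 1) := by
        calc X * (p + 1 / 2) ≤ X * ‖(p : ℂ) + 1 + ν‖ := by gcongr
          _ ≤ _ := by simp only [X]; linarith
      have i2 : X ≤ 2 * A := by
        have : (X - 2 * A) * ((p : ℝ) + 1 / 2) ≤ 0 := by linarith
        have hp : (0 : ℝ) < p + 1 / 2 := by positivity
        nlinarith
      calc ‖(p : ℂ) + 1 - ν‖ * ‖Complex.Gamma ((p : ℂ) + 1 - ν)‖ *
            ‖(Complex.Gamma ((p : ℂ) + 1 + ν + 1))⁻¹‖ = ‖(p : ℂ) + 1 - ν‖ * X := by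
              simp only [X]; ring
        _ ≤ (p + 3 / 2) * X := by gcongr
        _ ≤ (p + 3 / 2) * (2 * A) := by gcongr
        _ = _ := by ring
  have hA0 : 0 ≤ A := by
    have := hA (1 / 2 : ℂ) (by simp)
    exact (norm_nonneg _).trans this
  refine ⟨2 * A, by positivity, fun ν hν p => ?_⟩
  rcases p with _ | p
  · have := key ν hν 0
    have hne : -ν ≠ 0 := by
      intro h0; rw [neg_eq_zero] at h0; rw [h0] at hν; norm_num at hν
    push_cast at this ⊢
    rw [show (1 : ℂ) - ν = -ν + 1 by ring, Complex.Gamma_add_one _ hne, norm_mul,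
      norm_neg, add_comm 1 ν] at this
    rw [zero_sub, zero_add, Complex.one_div_Gamma_eq_self_mul_one_div_Gamma_add_one ν, norm_mul]
    nlinarith
  · refine (key ν hν p).trans ?_
    push_cast
    nlinarith

/-- The growth function dominating the Bessel kernels. -/
def growth (u : ℂ) : ℝ := (‖u‖ + ‖u‖⁻¹) * Real.exp (2 * ‖u‖ ^ 2)

theorem rpow_le_add_inv {x s : ℝ} (hx : 0 < x) (h1 : -1 ≤ s) (h2 : s ≤ 1) :
    x ^ s ≤ x + x⁻¹ := by
  rcases le_total 1 x with h | h
  · have := Real.rpow_le_rpow_of_exponent_le h h2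
    rw [Real.rpow_one] at this
    have : 0 < x⁻¹ := inv_pos.2 hx
    linarith
  · have := Real.rpow_le_rpow_of_exponent_ge hx h h1
    rw [Real.rpow_neg_one] at this
    linarith

/-- For `|t| ≥ 1/4` the numbers `Γ(p - it)` and `Γ(p + it)` are conjugate, so the Gamma quotients
equal `1`. For `|t| ≤ 1/4` the maximum principle on the circle of radius `1/2` about `0` applies,
where the quotients are linear in `p`. On that circle `|2 Re ν| ≤ 1`, which is why `growth` carries
`‖u‖ + ‖u‖⁻¹`. -/
theorem exists_norm_besselK_le : ∃ C : ℝ, 0 ≤ C ∧ ∀ (t : ℝ) (p : ℤ) (u : ℂ), u ≠ 0 →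
    ‖besselK (t * Complex.I) p u‖ ≤ C * (1 + |(p : ℝ)|) * growth u := by
  obtain ⟨A, hA0, hA⟩ := exists_norm_Gamma_ratio_le
  have hpi := Real.pi_pos
  have main : ∀ (t : ℝ) (p : ℕ) (u : ℂ), u ≠ 0 → ‖besselK (t * Complex.I) p u‖ ≤
      16 / Real.pi * (A + 1) * (1 + |(p : ℝ)|) * growth u := by
    intro t p u hu
    have hu0 : 0 < ‖u‖ := norm_pos_iff.2 hu
    have hhalf : ∀ s : ℝ, -1 ≤ s → s ≤ 1 → ‖u / 2‖ ^ s ≤ 2 * (‖u‖ + ‖u‖⁻¹) := by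
      intro s h1 h2
      have := rpow_le_add_inv (norm_pos_iff.2 (div_ne_zero hu two_ne_zero)) h1 h2
      rw [norm_div, Complex.norm_ofNat] at this ⊢
      refine this.trans ?_
      rw [inv_div, div_eq_mul_inv 2]
      linarith
    have general : ∀ (ν : ℂ), FarFromInt ν → |2 * ν.re| ≤ 1 → ∀ R : ℝ, 0 ≤ R →
        ‖Complex.Gamma (p - ν)‖ * ‖(Complex.Gamma (p + ν))⁻¹‖ ≤ R →
        ‖Complex.Gamma (p + ν)‖ * ‖(Complex.Gamma (p - ν))⁻¹‖ ≤ R →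
        ‖besselK ν p u‖ ≤ 16 / Real.pi * R * growth u := by
      intro ν hν hre R hR h1 h2
      refine (norm_besselK_le hν h1 h2 hu).trans ?_
      have a1 := hhalf (2 * ν.re) (abs_le.1 hre).1 (abs_le.1 hre).2
      have a2 := hhalf (-(2 * ν.re)) (by linarith [(abs_le.1 hre).2]) (by linarith [(abs_le.1 hre).1])
      calc _ ≤ (2 * (‖u‖ + ‖u‖⁻¹) + 2 * (‖u‖ + ‖u‖⁻¹)) * (4 / Real.pi) * R *
            Real.exp (2 * ‖u‖ ^ 2) := by gcongr
        _ = _ := by rw [growth]; ring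
    have hg : 0 ≤ growth u := by rw [growth]; positivity
    have hp0 : (0 : ℝ) ≤ p := p.cast_nonneg
    rw [abs_of_nonneg hp0]
    rcases le_total (1 / 4) |t| with ht | ht
    · have hf := farFromInt_mul_I ht
      have hne : Complex.Gamma (p + t * Complex.I) ≠ 0 := by
        refine Complex.Gamma_ne_zero fun m hm => ?_
        have := congrArg Complex.im hm
        simp at this
        rw [this, abs_zero] at ht
        norm_num at ht
      have hconj : ‖Complex.Gamma (p - t * Complex.I)‖ = ‖Complex.Gamma (p + t * Complex.I)‖ := by
        rw [← Complex.norm_conj, ← Complex.Gamma_conj]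
        simp
      refine (general (t * Complex.I) hf (by simp) 1 zero_le_one ?_ ?_).trans ?_
      · rw [hconj, norm_inv, mul_inv_cancel₀ (norm_ne_zero_iff.2 hne)]
      · rw [norm_inv, hconj, mul_inv_cancel₀ (norm_ne_zero_iff.2 hne)]
      · rw [mul_assoc (16 / Real.pi) (A + 1)]
        gcongr
        nlinarith
    · refine norm_besselK_le_of_sphere p hu (c := 0) (r := 1 / 2) (by norm_num) (fun z hz => ?_) ?_
      · have hz' : ‖z‖ = 1 / 2 := by simpa using hz
        have hre : |2 * z.re| ≤ 1 := by
          have := Complex.abs_re_le_norm z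
          rw [abs_mul, abs_two]; linarith
        have h2 := hA (-z) (by rwa [norm_neg]) p
        rw [sub_neg_eq_add, ← sub_eq_add_neg] at h2
        refine (general z (farFromInt_of_norm_eq hz') hre (A * (1 + p)) (by positivity)
          (hA z hz' p) h2).trans ?_
        rw [mul_assoc (16 / Real.pi) (A + 1)]
        gcongr
        linarith
      · simp only [mem_closedBall_zero_iff, norm_mul, Complex.norm_real, Complex.norm_I, mul_one,
          Real.norm_eq_abs]
        linarith
  refine ⟨16 / Real.pi * (A + 1), by positivity, fun t p u hu => ?_⟩
  obtain ⟨k, rfl | rfl⟩ := p.eq_nat_or_neg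
  · simpa using main t k u hu
  · have := main t k ((starRingEnd ℂ) u) (by simpa using hu)
    rw [besselK_conj _ _ hu] at this
    simpa [growth] using this

end

/-! ### The Macdonald function and the ladder equations -/

noncomputable section

open MeasureTheory Filter Topology

/-- The integrand `exp (2 μ x - y cosh 2x)`. -/
def macdonaldKernel (μ y : ℂ) (x : ℝ) : ℂ :=
  Complex.exp (2 * μ * x - y * Complex.cosh (2 * x))

/-- The Macdonald function `K_μ(y) = ∫ exp (2 μ x - y cosh 2x) dx`, for `Re y > 0`. -/
def macdonald (μ y : ℂ) : ℂ := ∫ x : ℝ, macdonaldKernel μ y x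

theorem continuous_macdonaldKernel (μ y : ℂ) : Continuous (macdonaldKernel μ y) := by
  unfold macdonaldKernel; fun_prop

theorem norm_macdonaldKernel (μ y : ℂ) (x : ℝ) :
    ‖macdonaldKernel μ y x‖ = Real.exp (2 * μ.re * x - y.re * Real.cosh (2 * x)) := by
  rw [macdonaldKernel, Complex.norm_exp]
  have : Complex.cosh (2 * x) = (Real.cosh (2 * x) : ℝ) := by push_cast; rfl
  rw [this, Complex.sub_re, Complex.re_mul_ofReal, Complex.re_mul_ofReal]
  simp

theorem one_add_sq_le_cosh (x : ℝ) : 1 + 2 * x ^ 2 ≤ Real.cosh (2 * x) := by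
  rw [Real.cosh_two_mul, Real.cosh_sq]
  have : x ^ 2 ≤ Real.sinh x ^ 2 := by
    rcases le_total 0 x with h | h
    · exact pow_le_pow_left₀ h (Real.self_le_sinh_iff.2 h) 2
    · have := pow_le_pow_left₀ (neg_nonneg.2 h) (Real.self_le_sinh_iff.2 (neg_nonneg.2 h)) 2
      rwa [Real.sinh_neg, neg_sq, neg_sq] at this
  linarith

/-- The bound `cosh 2x ≥ 1 + 2x²` leaves a Gaussian after completing the square. -/
theorem exp_sub_cosh_le {c : ℝ} (hc : 0 < c) (σ x : ℝ) :
    Real.exp (2 * σ * x - c * Real.cosh (2 * x)) ≤ Real.exp (σ ^ 2 / c) * Real.exp (-c * x ^ 2) := by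
  rw [← Real.exp_add, Real.exp_le_exp]
  have h1 := mul_le_mul_of_nonneg_left (one_add_sq_le_cosh x) hc.le
  have h2 : 2 * σ * x ≤ σ ^ 2 / c + c * x ^ 2 := by
    rw [div_add' _ _ _ hc.ne', le_div_iff₀ hc]
    nlinarith [sq_nonneg (σ - c * x)]
  nlinarith

theorem integrable_exp_sub_cosh {c : ℝ} (hc : 0 < c) (σ : ℝ) :
    Integrable fun x : ℝ => Real.exp (2 * σ * x - c * Real.cosh (2 * x)) := by
  refine ((integrable_exp_neg_mul_sq hc).const_mul (Real.exp (σ ^ 2 / c))).mono'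
    (by have : Continuous Real.cosh := Real.continuous_cosh
        exact (by fun_prop : Continuous _).aestronglyMeasurable)
    (Eventually.of_forall fun x => ?_)
  rw [Real.norm_of_nonneg (Real.exp_nonneg _)]
  exact exp_sub_cosh_le hc σ x

theorem integrable_macdonaldKernel (μ : ℂ) {y : ℂ} (hy : 0 < y.re) :
    Integrable (macdonaldKernel μ y) := by
  rw [← integrable_norm_iff (continuous_macdonaldKernel μ y).aestronglyMeasurable]
  simpa only [norm_macdonaldKernel] using integrable_exp_sub_cosh hy μ.re

theorem cosh_mul_macdonaldKernel (μ y : ℂ) (x : ℝ) :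
    Complex.cosh (2 * x) * macdonaldKernel μ y x =
      (macdonaldKernel (μ + 1) y x + macdonaldKernel (μ - 1) y x) / 2 := by
  simp only [macdonaldKernel]
  rw [show 2 * (μ + 1) * x - y * Complex.cosh (2 * x) =
    2 * (x : ℂ) + (2 * μ * x - y * Complex.cosh (2 * x)) by ring,
    show 2 * (μ - 1) * x - y * Complex.cosh (2 * x) =
    -(2 * (x : ℂ)) + (2 * μ * x - y * Complex.cosh (2 * x)) by ring, Complex.exp_add,
    Complex.exp_add]
  generalize Complex.exp (2 * μ * x - y * Complex.cosh (2 * x)) = e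
  rw [Complex.cosh]
  ring

theorem sinh_mul_macdonaldKernel (μ y : ℂ) (x : ℝ) :
    Complex.sinh (2 * x) * macdonaldKernel μ y x =
      (macdonaldKernel (μ + 1) y x - macdonaldKernel (μ - 1) y x) / 2 := by
  simp only [macdonaldKernel]
  rw [show 2 * (μ + 1) * x - y * Complex.cosh (2 * x) =
    2 * (x : ℂ) + (2 * μ * x - y * Complex.cosh (2 * x)) by ring,
    show 2 * (μ - 1) * x - y * Complex.cosh (2 * x) =
    -(2 * (x : ℂ)) + (2 * μ * x - y * Complex.cosh (2 * x)) by ring, Complex.exp_add,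
    Complex.exp_add]
  generalize Complex.exp (2 * μ * x - y * Complex.cosh (2 * x)) = e
  rw [Complex.sinh]
  ring

theorem hasDerivAt_macdonaldKernel (μ y : ℂ) (x : ℝ) :
    HasDerivAt (macdonaldKernel μ y) (2 * μ * macdonaldKernel μ y x -
      y * (macdonaldKernel (μ + 1) y x - macdonaldKernel (μ - 1) y x)) x := by
  have h : HasDerivAt (fun z : ℂ => Complex.exp (2 * μ * z - y * Complex.cosh (2 * z)))
      (Complex.exp (2 * μ * x - y * Complex.cosh (2 * x)) *
        (2 * μ * 1 - y * (Complex.sinh (2 * x) * (2 * 1)))) (x : ℂ) :=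
    (((hasDerivAt_id (x : ℂ)).const_mul (2 * μ)).sub
      (((hasDerivAt_id (x : ℂ)).const_mul 2).ccosh.const_mul y)).cexp
  refine h.comp_ofReal.congr_deriv ?_
  have := sinh_mul_macdonaldKernel μ y x
  simp only [macdonaldKernel] at this ⊢
  linear_combination -2 * y * this

/-- The derivative of the integrand has integral zero over the line. -/
theorem macdonald_recurrence (μ : ℂ) {y : ℂ} (hy : 0 < y.re) :
    2 * μ * macdonald μ y = y * (macdonald (μ + 1) y - macdonald (μ - 1) y) := by
  have i0 := integrable_macdonaldKernel μ hy
  have i1 := integrable_macdonaldKernel (μ + 1) hy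
  have i2 := integrable_macdonaldKernel (μ - 1) hy
  have i3 : Integrable fun x => y * (macdonaldKernel (μ + 1) y x - macdonaldKernel (μ - 1) y x) :=
    (i1.sub i2).const_mul y
  have h := integral_eq_zero_of_hasDerivAt_of_integrable (hasDerivAt_macdonaldKernel μ y)
    ((i0.const_mul (2 * μ)).sub i3) i0
  have e1 : ∫ x, (2 * μ * macdonaldKernel μ y x -
      y * (macdonaldKernel (μ + 1) y x - macdonaldKernel (μ - 1) y x)) =
      2 * μ * macdonald μ y - y * (macdonald (μ + 1) y - macdonald (μ - 1) y) := by
    rw [integral_sub (i0.const_mul (2 * μ)) i3, integral_const_mul,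
      integral_const_mul, integral_sub i1 i2]
    rfl
  rw [e1] at h
  exact sub_eq_zero.1 h

theorem macdonald_neg (μ y : ℂ) : macdonald (-μ) y = macdonald μ y := by
  unfold macdonald
  rw [← integral_neg_eq_self]
  refine integral_congr_ae (Eventually.of_forall fun x => ?_)
  simp only [macdonaldKernel]
  push_cast
  rw [mul_neg (2 : ℂ) (x : ℂ), Complex.cosh_neg]
  ring_nf

theorem hasDerivAt_macdonald (μ : ℂ) {y : ℂ} (hy : 0 < y.re) :
    HasDerivAt (macdonald μ) (-((macdonald (μ + 1) y + macdonald (μ - 1) y) / 2)) y := by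
  have hball : ∀ z ∈ Metric.ball y (y.re / 2), y.re / 2 ≤ z.re := by
    intro z hz
    have h1 := (abs_le.1 (Complex.abs_re_le_norm (z - y))).1
    rw [Metric.mem_ball, dist_eq_norm] at hz
    rw [Complex.sub_re] at h1
    linarith
  have i1 := integrable_macdonaldKernel (μ + 1) hy
  have i2 := integrable_macdonaldKernel (μ - 1) hy
  have key := (hasDerivAt_integral_of_dominated_loc_of_deriv_le (μ := volume) (𝕜 := ℂ)
    (F := fun y x => macdonaldKernel μ y x)
    (F' := fun y x => -((macdonaldKernel (μ + 1) y x + macdonaldKernel (μ - 1) y x) / 2))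
    (x₀ := y) (s := Metric.ball y (y.re / 2))
    (bound := fun x => Real.exp (2 * (μ + 1).re * x - y.re / 2 * Real.cosh (2 * x)) +
      Real.exp (2 * (μ - 1).re * x - y.re / 2 * Real.cosh (2 * x)))
    (Metric.ball_mem_nhds y (by positivity))
    (Eventually.of_forall fun z => (continuous_macdonaldKernel μ z).aestronglyMeasurable)
    (integrable_macdonaldKernel μ hy)
    ((((continuous_macdonaldKernel _ _).add (continuous_macdonaldKernel _ _)).div_const
      2).neg.aestronglyMeasurable)
    (Eventually.of_forall fun x z hz => ?_)
    ((integrable_exp_sub_cosh (by positivity) _).add (integrable_exp_sub_cosh (by positivity) _))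
    (Eventually.of_forall fun x z hz => ?_)).2
  · refine key.congr_deriv ?_
    rw [integral_neg, integral_div, integral_add i1 i2]
    rfl
  · have hz' := hball z hz
    have hmono : ∀ σ : ℝ, Real.exp (2 * σ * x - z.re * Real.cosh (2 * x)) ≤
        Real.exp (2 * σ * x - y.re / 2 * Real.cosh (2 * x)) := by
      intro σ
      rw [Real.exp_le_exp]
      have := mul_le_mul_of_nonneg_right hz' (Real.cosh_pos (2 * x)).le
      linarith
    rw [norm_neg, norm_div, Complex.norm_ofNat]
    have h1 := norm_add_le (macdonaldKernel (μ + 1) z x) (macdonaldKernel (μ - 1) z x)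
    rw [norm_macdonaldKernel, norm_macdonaldKernel] at h1
    have h2 := hmono (μ + 1).re
    have h3 := hmono (μ - 1).re
    have h4 := norm_nonneg (macdonaldKernel (μ + 1) z x + macdonaldKernel (μ - 1) z x)
    linarith
  · have h : HasDerivAt (fun w : ℂ => Complex.exp (2 * μ * x - w * Complex.cosh (2 * x)))
        (Complex.exp (2 * μ * x - z * Complex.cosh (2 * x)) *
          -(1 * Complex.cosh (2 * x))) z :=
      (((hasDerivAt_id z).mul_const (Complex.cosh (2 * x))).const_sub (2 * μ * x)).cexp
    refine h.congr_deriv ?_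
    have := cosh_mul_macdonaldKernel μ z x
    simp only [macdonaldKernel] at this ⊢
    linear_combination -this

theorem norm_macdonald_le (μ y : ℂ) :
    ‖macdonald μ y‖ ≤ ∫ x : ℝ, Real.exp (2 * μ.re * x - y.re * Real.cosh (2 * x)) := by
  unfold macdonald
  refine (norm_integral_le_integral_norm _).trans_eq ?_
  simp only [norm_macdonaldKernel]

/-- The recurrence bounds `|t| |K_{it+σ}|` by Macdonald functions at `σ ± 1`. Iteration trades
powers of `t` for shifts of `σ`, hence the quantification over all `σ` inside the induction. -/
theorem exists_pow_mul_norm_macdonald_le {y : ℂ} (hy : 0 < y.re) (n : ℕ) : ∀ σ : ℝ,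
    ∃ C : ℝ, ∀ t : ℝ, |t| ^ n * ‖macdonald (t * Complex.I + σ) y‖ ≤ C := by
  induction n with
  | zero =>
    intro σ
    refine ⟨∫ x : ℝ, Real.exp (2 * σ * x - y.re * Real.cosh (2 * x)), fun t => ?_⟩
    rw [pow_zero, one_mul]
    simpa using norm_macdonald_le (t * Complex.I + σ) y
  | succ n ih =>
    intro σ
    obtain ⟨C1, h1⟩ := ih (σ + 1)
    obtain ⟨C2, h2⟩ := ih (σ - 1)
    refine ⟨‖y‖ / 2 * (C1 + C2), fun t => ?_⟩
    have hr := congrArg norm (macdonald_recurrence (t * Complex.I + σ) hy)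
    rw [norm_mul, norm_mul, norm_mul, Complex.norm_ofNat] at hr
    have ht : |t| ≤ ‖t * Complex.I + σ‖ := by
      simpa using Complex.abs_im_le_norm (t * Complex.I + σ)
    have h3 := norm_sub_le (macdonald (t * Complex.I + σ + 1) y) (macdonald (t * Complex.I + σ - 1) y)
    have h1' := h1 t
    have h2' := h2 t
    push_cast at h1' h2'
    rw [show t * Complex.I + ((σ : ℂ) + 1) = t * Complex.I + σ + 1 by ring] at h1'
    rw [show t * Complex.I + ((σ : ℂ) - 1) = t * Complex.I + σ - 1 by ring] at h2'
    have htn : 0 ≤ |t| ^ n := by positivity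
    have hM : |t| * ‖macdonald (t * Complex.I + σ) y‖ ≤ ‖y‖ / 2 *
        (‖macdonald (t * Complex.I + σ + 1) y‖ + ‖macdonald (t * Complex.I + σ - 1) y‖) := by
      have a1 := mul_le_mul_of_nonneg_right ht (norm_nonneg (macdonald (t * Complex.I + σ) y))
      have a2 := mul_le_mul_of_nonneg_left h3 (norm_nonneg y)
      linarith
    calc |t| ^ (n + 1) * ‖macdonald (t * Complex.I + σ) y‖
        = |t| ^ n * (|t| * ‖macdonald (t * Complex.I + σ) y‖) := by ring
      _ ≤ |t| ^ n * (‖y‖ / 2 *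
        (‖macdonald (t * Complex.I + σ + 1) y‖ + ‖macdonald (t * Complex.I + σ - 1) y‖)) := by
          gcongr
      _ = ‖y‖ / 2 * (|t| ^ n * ‖macdonald (t * Complex.I + σ + 1) y‖ +
          |t| ^ n * ‖macdonald (t * Complex.I + σ - 1) y‖) := by ring
      _ ≤ _ := by gcongr

theorem image_exp_two_mul : (fun x : ℝ => Real.exp (2 * x)) '' Set.univ = Set.Ioi 0 := by
  rw [Set.image_univ]
  ext y
  constructor
  · rintro ⟨x, rfl⟩; exact Real.exp_pos _
  · intro hy
    exact ⟨Real.log y / 2, by simp only; rw [mul_div_cancel₀ _ two_ne_zero, Real.exp_log hy]⟩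

/-- Euler's integral after substituting `exp(2x)`, a form that can be compared with the integral of
`macdonald` by dominated convergence. -/
theorem Gamma_eq_integral_exp {s : ℂ} (hs : 0 < s.re) :
    Complex.Gamma s = 2 * ∫ x : ℝ, Complex.exp (2 * s * x - Real.exp (2 * x)) := by
  rw [Complex.Gamma_eq_integral hs, Complex.GammaIntegral]
  have himg := image_exp_two_mul
  have hder : ∀ x ∈ Set.univ, HasDerivWithinAt (fun x : ℝ => Real.exp (2 * x))
      (Real.exp (2 * x) * (2 * 1)) Set.univ x := fun x _ =>
    (((hasDerivAt_id x).const_mul 2).exp).hasDerivWithinAt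
  have hinj : Set.InjOn (fun x : ℝ => Real.exp (2 * x)) Set.univ := fun a _ b _ h => by
    have := Real.exp_injective h
    linarith
  rw [← himg, integral_image_eq_integral_abs_deriv_smul MeasurableSet.univ hder hinj,
    setIntegral_univ, ← integral_const_mul]
  refine integral_congr_ae (Eventually.of_forall fun x => ?_)
  simp only
  rw [abs_of_pos (by positivity), Complex.real_smul,
    Complex.cpow_def_of_ne_zero (by exact_mod_cast (Real.exp_pos _).ne'),
    ← Complex.ofReal_log (Real.exp_pos _).le, Real.log_exp]
  push_cast
  rw [show 2 * s * x - Complex.exp (2 * x) =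
    2 * (x : ℂ) + (-Complex.exp (2 * x) + 2 * x * (s - 1)) by ring, Complex.exp_add,
    Complex.exp_add]
  ring

theorem integrable_exp_sub_exp {σ : ℝ} (hσ : 0 < σ) :
    Integrable fun x : ℝ => Real.exp (2 * σ * x - Real.exp (2 * x)) := by
  have h := Real.GammaIntegral_convergent hσ
  have himg : (fun x : ℝ => Real.exp (2 * x)) '' Set.univ = Set.Ioi 0 := image_exp_two_mul
  have hder : ∀ x ∈ Set.univ, HasDerivWithinAt (fun x : ℝ => Real.exp (2 * x))
      (Real.exp (2 * x) * (2 * 1)) Set.univ x := fun x _ =>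
    (((hasDerivAt_id x).const_mul 2).exp).hasDerivWithinAt
  have hinj : Set.InjOn (fun x : ℝ => Real.exp (2 * x)) Set.univ := fun a _ b _ h => by
    have := Real.exp_injective h
    linarith
  rw [← himg, integrableOn_image_iff_integrableOn_abs_deriv_smul MeasurableSet.univ hder hinj,
    integrableOn_univ] at h
  refine (h.const_mul (1 / 2)).congr (Eventually.of_forall fun x => ?_)
  simp only
  rw [abs_of_pos (by positivity), smul_eq_mul, Real.rpow_def_of_pos (Real.exp_pos _), Real.log_exp,
    show 2 * σ * x - Real.exp (2 * x) = 2 * x + (-Real.exp (2 * x) + 2 * x * (σ - 1)) by ring,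
    Real.exp_add, Real.exp_add (-Real.exp (2 * x))]
  ring

/-- The ladder system shared by `(K_ν, K_{ν+1})` and `(I_ν, -I_{ν+1})`. -/
def IsLadder (ν : ℂ) (a b : ℂ → ℂ) : Prop := ∀ y : ℂ, 0 < y.re →
  HasDerivAt a (ν / y * a y - b y) y ∧ HasDerivAt b (-((ν + 1) / y) * b y - a y) y

theorem ne_zero_of_re_pos {y : ℂ} (hy : 0 < y.re) : y ≠ 0 := by
  rintro rfl; simp at hy

theorem isLadder_macdonald (ν : ℂ) : IsLadder ν (macdonald ν) (macdonald (ν + 1)) := by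
  intro y hy
  have hy0 := ne_zero_of_re_pos hy
  have r1 := macdonald_recurrence ν hy
  have r2 := macdonald_recurrence (ν + 1) hy
  rw [add_sub_cancel_right] at r2
  constructor
  · refine (hasDerivAt_macdonald ν hy).congr_deriv ?_
    field_simp
    linear_combination (-1) * r1
  · refine (hasDerivAt_macdonald (ν + 1) hy).congr_deriv ?_
    rw [add_sub_cancel_right]
    field_simp
    linear_combination r2

theorem IsLadder.linear {ν : ℂ} {a b a' b' : ℂ → ℂ} (h : IsLadder ν a b) (h' : IsLadder ν a' b')
    (c c' : ℂ) : IsLadder ν (fun y => c * a y + c' * a' y) (fun y => c * b y + c' * b' y) := by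
  intro y hy
  constructor
  · refine (((h y hy).1.const_mul c).add ((h' y hy).1.const_mul c')).congr_deriv ?_
    ring
  · refine (((h y hy).2.const_mul c).add ((h' y hy).2.const_mul c')).congr_deriv ?_
    ring

/-- The Wronskian of two ladder solutions is determined by its limit at `0+`. -/
theorem IsLadder.wronskian_eq {ν : ℂ} {a b a' b' : ℂ → ℂ} (h : IsLadder ν a b)
    (h' : IsLadder ν a' b') {L : ℂ}
    (hL : Tendsto (fun s : ℝ => (s : ℂ) * (a s * b' s - a' s * b s)) (𝓝[>] 0) (𝓝 L)) {y : ℂ}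
    (hy : 0 < y.re) : y * (a y * b' y - a' y * b y) = L := by
  set U : Set ℂ := {y | 0 < y.re} with hU
  have hopen : IsOpen U := isOpen_lt continuous_const Complex.continuous_re
  have hconn : IsPreconnected U := (convex_halfSpace_re_gt 0).isPreconnected
  -- The trace of the ladder system is `-1/y`, so `y` times the Wronskian is constant on the
  -- half-plane.
  have hd : ∀ y ∈ U, HasDerivAt (fun y => y * (a y * b' y - a' y * b y)) 0 y := by
    intro y hy
    have hy0 := ne_zero_of_re_pos hy
    refine ((hasDerivAt_id y).mul (((h y hy).1.mul (h' y hy).2).sub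
      ((h' y hy).1.mul (h y hy).2))).congr_deriv ?_
    simp only [id, Pi.sub_apply, Pi.mul_apply]
    field_simp
    ring
  have hconst : ∀ s : ℝ, 0 < s →
      (s : ℂ) * (a s * b' s - a' s * b s) = y * (a y * b' y - a' y * b y) := by
    intro s hs
    exact hopen.is_const_of_deriv_eq_zero hconn
      (f := fun y => y * (a y * b' y - a' y * b y))
      (fun z hz => (hd z hz).differentiableAt.differentiableWithinAt)
      (fun z hz => (hd z hz).deriv) (by simpa [hU] using hs) hy
  refine tendsto_nhds_unique (tendsto_const_nhds.congr' ?_) hL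
  filter_upwards [self_mem_nhdsWithin] with s hs
  exact (hconst s hs).symm

/-- The modified Bessel function of the first kind. -/
def besselI (μ y : ℂ) : ℂ := (y / 2) ^ μ * clifford μ ((y / 2) ^ 2)

theorem besselI_recurrence (μ : ℂ) {y : ℂ} (hy : y ≠ 0) :
    2 * μ * besselI μ y = y * (besselI (μ - 1) y - besselI (μ + 1) y) := by
  have hy2 : y / 2 ≠ 0 := div_ne_zero hy two_ne_zero
  unfold besselI
  rw [clifford_recurrence, Complex.cpow_sub _ _ hy2, Complex.cpow_add _ _ hy2, Complex.cpow_one]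
  field_simp
  ring

theorem hasDerivAt_besselI (μ : ℂ) {y : ℂ} (hy : 0 < y.re) :
    HasDerivAt (besselI μ) (μ / y * besselI μ y + besselI (μ + 1) y) y := by
  have hy0 := ne_zero_of_re_pos hy
  have hy2 : y / 2 ≠ 0 := div_ne_zero hy0 two_ne_zero
  have hslit : y / 2 ∈ Complex.slitPlane := by
    left
    have : (y / 2).re = y.re / 2 := by simp
    rw [this]; positivity
  have h1 := ((hasDerivAt_id y).div_const 2).cpow_const (c := μ) hslit
  have h2 := (hasDerivAt_clifford μ ((y / 2) ^ 2)).comp y (((hasDerivAt_id y).div_const 2).pow 2)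
  refine (h1.mul h2).congr_deriv ?_
  unfold besselI
  simp only [id, Function.comp, Pi.pow_apply]
  rw [Complex.cpow_sub _ _ hy2, Complex.cpow_add _ _ hy2, Complex.cpow_one]
  field_simp
  ring

theorem isLadder_besselI (ν : ℂ) : IsLadder ν (besselI ν) (fun y => -besselI (ν + 1) y) := by
  intro y hy
  have hy0 := ne_zero_of_re_pos hy
  have r2 := besselI_recurrence (ν + 1) hy0
  rw [add_sub_cancel_right] at r2
  constructor
  · exact (hasDerivAt_besselI ν hy).congr_deriv (by ring)
  · refine (hasDerivAt_besselI (ν + 1) hy).neg.congr_deriv ?_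
    field_simp
    linear_combination (-1) * r2

/-- With `isLadder_besselI` this gives two solutions of one two-dimensional system; they are
independent when `ν` is not an integer. -/
theorem isLadder_besselI_neg (ν : ℂ) :
    IsLadder ν (besselI (-ν)) (fun y => -besselI (-ν - 1) y) := by
  intro y hy
  have hy0 := ne_zero_of_re_pos hy
  have r2 := besselI_recurrence (-ν) hy0
  have h2 := hasDerivAt_besselI (-ν - 1) hy
  rw [sub_add_cancel] at h2
  constructor
  · refine (hasDerivAt_besselI (-ν) hy).congr_deriv ?_
    field_simp
    linear_combination r2
  · refine h2.neg.congr_deriv ?_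
    field_simp
    ring

/-- The translation by `c = -log(s/2)/2` turns `s cosh 2x` into `exp(2x) + (s/2)² exp(-2x)`. As `s →
0` the last term disappears and the Gamma integral remains as limit and majorant. -/
theorem tendsto_macdonald {ν : ℂ} (hν : -1 < ν.re) :
    Tendsto (fun s : ℝ => (s : ℂ) * macdonald (ν + 1) s * ((s : ℂ) / 2) ^ ν) (𝓝[>] 0)
      (𝓝 (Complex.Gamma (ν + 1))) := by
  have hre : 0 < (ν + 1).re := by rw [Complex.add_re, Complex.one_re]; linarith
  have heq : ∀ s : ℝ, 0 < s → (s : ℂ) * macdonald (ν + 1) s * ((s : ℂ) / 2) ^ ν =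
      2 * ∫ x : ℝ, Complex.exp (2 * (ν + 1) * x - Real.exp (2 * x) -
        (s / 2) ^ 2 * Real.exp (-(2 * x))) := by
    intro s hs
    set c : ℝ := -(Real.log (s / 2) / 2) with hc
    have hs2 : 0 < s / 2 := by positivity
    have hsne : (s : ℂ) ≠ 0 := by exact_mod_cast hs.ne'
    have e2c : Real.exp (2 * c) = (s / 2)⁻¹ := by
      rw [hc, show 2 * -(Real.log (s / 2) / 2) = -Real.log (s / 2) by ring, Real.exp_neg,
        Real.exp_log hs2]
    have hpow : ((s : ℂ) / 2) ^ ν = Complex.exp (-(2 * c * ν)) := by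
      rw [Complex.cpow_def_of_ne_zero (by simpa using hsne),
        show (s : ℂ) / 2 = ((s / 2 : ℝ) : ℂ) by push_cast; rfl, ← Complex.ofReal_log hs2.le, hc]
      push_cast; ring_nf
    have hexp : Complex.exp (2 * c) = ((s : ℂ) / 2)⁻¹ := by
      have := congrArg Complex.ofReal e2c
      push_cast at this
      exact this
    unfold macdonald
    rw [← integral_add_right_eq_self _ c, mul_right_comm, ← integral_const_mul,
      ← integral_const_mul]
    refine integral_congr_ae (Eventually.of_forall fun x => ?_)
    simp only [macdonaldKernel]
    rw [hpow]
    have hcosh : (s : ℂ) * Complex.cosh (2 * ((x + c : ℝ) : ℂ)) =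
        Real.exp (2 * x) + (s / 2) ^ 2 * Real.exp (-(2 * x)) := by
      push_cast
      rw [Complex.cosh, show 2 * ((x : ℂ) + c) = 2 * x + 2 * c by ring, Complex.exp_add,
        show -(2 * (x : ℂ) + 2 * c) = -(2 * x) + -(2 * c) by ring, Complex.exp_add,
        Complex.exp_neg (2 * (c : ℂ)), hexp]
      field_simp
    rw [hcosh]
    have hE : Complex.exp (2 * (ν + 1) * ((x + c : ℝ) : ℂ) -
        (Real.exp (2 * x) + (s / 2) ^ 2 * Real.exp (-(2 * x)))) =
        Complex.exp (2 * (ν + 1) * x - Real.exp (2 * x) - (s / 2) ^ 2 * Real.exp (-(2 * x))) *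
        (Complex.exp (2 * c) * Complex.exp (2 * c * ν)) := by
      rw [← Complex.exp_add, ← Complex.exp_add]
      congr 1
      push_cast
      ring
    rw [hE, hexp, Complex.exp_neg]
    have := Complex.exp_ne_zero (2 * c * ν)
    field_simp
  rw [Gamma_eq_integral_exp hre]
  have hlim : Tendsto (fun s : ℝ => ∫ x : ℝ, Complex.exp (2 * (ν + 1) * x - Real.exp (2 * x) -
        (s / 2) ^ 2 * Real.exp (-(2 * x)))) (𝓝[>] 0)
      (𝓝 (∫ x : ℝ, Complex.exp (2 * (ν + 1) * x - Real.exp (2 * x)))) := by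
    refine tendsto_integral_filter_of_dominated_convergence
      (fun x => Real.exp (2 * (ν + 1).re * x - Real.exp (2 * x)))
      (Eventually.of_forall fun s => (by fun_prop : Continuous _).aestronglyMeasurable)
      (Eventually.of_forall fun s => Eventually.of_forall fun x => ?_)
      (integrable_exp_sub_exp hre) (Eventually.of_forall fun x => ?_)
    · rw [Complex.norm_exp, Real.exp_le_exp]
      have h1 : (2 * (ν + 1) * x - Real.exp (2 * x) - (s / 2) ^ 2 * Real.exp (-(2 * x)) : ℂ).re =
          2 * (ν + 1).re * x - Real.exp (2 * x) - (s / 2) ^ 2 * Real.exp (-(2 * x)) := by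
        rw [show ((s : ℂ) / 2) ^ 2 * (Real.exp (-(2 * x)) : ℂ) =
          (((s / 2) ^ 2 * Real.exp (-(2 * x)) : ℝ) : ℂ) by push_cast; rfl, Complex.sub_re,
          Complex.sub_re, Complex.ofReal_re, Complex.ofReal_re, Complex.re_mul_ofReal]
        simp
      rw [h1]
      have : 0 ≤ (s / 2) ^ 2 * Real.exp (-(2 * x)) := by positivity
      linarith
    · have hcont : Continuous fun s : ℝ => Complex.exp (2 * (ν + 1) * x - Real.exp (2 * x) -
        (s / 2) ^ 2 * Real.exp (-(2 * x))) := by fun_prop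
      have := hcont.tendsto 0
      simp only [Complex.ofReal_zero, zero_div, ne_eq, OfNat.ofNat_ne_zero, not_false_eq_true,
        zero_pow, zero_mul, sub_zero] at this
      exact this.mono_left nhdsWithin_le_nhds
  refine (hlim.const_mul 2).congr' ?_
  filter_upwards [self_mem_nhdsWithin] with s hs
  exact (heq s hs).symm

end

/-! ### The connection formula between `K` and `I` -/

noncomputable section

open MeasureTheory Filter Topology

theorem clifford_zero_right (μ : ℂ) : clifford μ 0 = (Complex.Gamma (μ + 1))⁻¹ := by
  unfold clifford
  rw [tsum_eq_single 0 fun m hm => by rw [zero_pow hm]; simp]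
  simp

theorem tendsto_clifford_sq (μ : ℂ) :
    Tendsto (fun s : ℝ => clifford μ (((s : ℂ) / 2) ^ 2)) (𝓝[>] 0)
      (𝓝 (Complex.Gamma (μ + 1))⁻¹) := by
  have hc : Continuous fun s : ℝ => clifford μ (((s : ℂ) / 2) ^ 2) :=
    continuous_clifford.comp (by fun_prop : Continuous fun s : ℝ => (μ, ((s : ℂ) / 2) ^ 2))
  have := hc.tendsto 0
  simp only [Complex.ofReal_zero, zero_div, ne_eq, OfNat.ofNat_ne_zero, not_false_eq_true,
    zero_pow, clifford_zero_right] at this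
  exact this.mono_left nhdsWithin_le_nhds

/-- The difference of the two sides solves the ladder system. Its Wronskians with the solutions
built from `I_ν` and `I_{-ν}` tend to `0` at the origin, while the Wronskian of these two solutions
is a nonzero constant; so the difference vanishes. The second equation comes along because the
system couples `ν` and `ν + 1`. -/
theorem macdonald_pair_eq {ν : ℂ} (hre : ν.re = 0) (hν : ν ≠ 0) {y : ℂ} (hy : 0 < y.re) :
    macdonald ν y = Real.pi / (2 * Complex.sin (Real.pi * ν)) * (besselI (-ν) y - besselI ν y) ∧
    macdonald (ν + 1) y =
      -(Real.pi / (2 * Complex.sin (Real.pi * ν))) *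
        (besselI (-ν - 1) y - besselI (ν + 1) y) := by
  set S := Complex.sin (Real.pi * ν) with hS
  have hpi : (Real.pi : ℂ) ≠ 0 := by exact_mod_cast Real.pi_ne_zero
  have hSne : S ≠ 0 := by
    intro h0
    obtain ⟨n, rfl⟩ := (sin_pi_mul_eq_zero_iff ν).1 h0
    have : (n : ℝ) = 0 := by simpa using hre
    exact hν (by exact_mod_cast congrArg Complex.ofReal this)
  have hG1 : Complex.Gamma (1 + ν) * Complex.Gamma (-ν) = -(Real.pi / S) := by
    have := Complex.Gamma_mul_Gamma_one_sub (-ν)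
    rw [mul_neg, Complex.sin_neg, ← hS, sub_neg_eq_add, div_neg] at this
    rw [mul_comm, this]
  have hG1' : Complex.Gamma (-ν) ≠ 0 := by
    intro h0; rw [h0, mul_zero] at hG1
    exact neg_ne_zero.2 (div_ne_zero hpi hSne) hG1.symm
  have hG1'' : Complex.Gamma (1 + ν) ≠ 0 := by
    intro h0; rw [h0, zero_mul] at hG1
    exact neg_ne_zero.2 (div_ne_zero hpi hSne) hG1.symm
  have hG2 : Complex.Gamma (1 - ν) = -ν * Complex.Gamma (-ν) := by
    rw [← Complex.Gamma_add_one _ (neg_ne_zero.2 hν)]; ring_nf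
  have hG2' : Complex.Gamma (1 - ν) ≠ 0 := by
    rw [hG2]; exact mul_ne_zero (neg_ne_zero.2 hν) hG1'
  set κ := Real.pi / (2 * S) with hκ
  -- As `Re ν = 0`, this factor is unimodular and oscillates without a limit. The estimates
  -- involving it are therefore made for norms, where it drops out.
  set w : ℝ → ℂ := fun s => ((s : ℂ) / 2) ^ ν with hw
  have hw1 : ∀ s : ℝ, 0 < s → ‖w s‖ = 1 := by
    intro s hs
    have : (s : ℂ) / 2 = ((s / 2 : ℝ) : ℂ) := by push_cast; rfl
    rw [hw]; simp only
    rw [this, Complex.norm_cpow_eq_rpow_re_of_pos (by positivity), hre, Real.rpow_zero]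
  have hwne : ∀ s : ℝ, 0 < s → w s ≠ 0 := fun s hs h0 => by
    have := hw1 s hs; rw [h0, norm_zero] at this; exact zero_ne_one this
  set c0 : ℝ → ℂ := fun s => clifford ν (((s : ℂ) / 2) ^ 2) with hc0
  set c1 : ℝ → ℂ := fun s => clifford (ν + 1) (((s : ℂ) / 2) ^ 2) with hc1
  set d0 : ℝ → ℂ := fun s => clifford (-ν) (((s : ℂ) / 2) ^ 2) with hd0
  set d1 : ℝ → ℂ := fun s => clifford (-ν - 1) (((s : ℂ) / 2) ^ 2) with hd1
  have tc0 : Tendsto c0 (𝓝[>] 0) (𝓝 (Complex.Gamma (1 + ν))⁻¹) := by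
    rw [add_comm]; exact tendsto_clifford_sq ν
  have tc1 : Tendsto c1 (𝓝[>] 0) (𝓝 (Complex.Gamma (ν + 1 + 1))⁻¹) := tendsto_clifford_sq (ν + 1)
  have td0 : Tendsto d0 (𝓝[>] 0) (𝓝 (Complex.Gamma (1 - ν))⁻¹) := by
    rw [show 1 - ν = -ν + 1 by ring]; exact tendsto_clifford_sq (-ν)
  have td1 : Tendsto d1 (𝓝[>] 0) (𝓝 (Complex.Gamma (-ν))⁻¹) := by
    rw [show -ν = -ν - 1 + 1 by ring]; exact tendsto_clifford_sq (-ν - 1)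
  have ts : Tendsto (fun s : ℝ => (s : ℂ)) (𝓝[>] 0) (𝓝 0) := by
    have := Complex.continuous_ofReal.tendsto 0
    rw [Complex.ofReal_zero] at this
    exact this.mono_left nhdsWithin_le_nhds
  have I0 : ∀ s : ℝ, besselI ν s = w s * c0 s := fun s => rfl
  have hs2 : ∀ s : ℝ, 0 < s → (s : ℂ) / 2 ≠ 0 := fun s hs =>
    div_ne_zero (by exact_mod_cast hs.ne') two_ne_zero
  have I1 : ∀ s : ℝ, 0 < s → besselI (ν + 1) s = w s * (s / 2) * c1 s := fun s hs => by
    rw [besselI, Complex.cpow_add _ _ (hs2 s hs), Complex.cpow_one]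
  have J0 : ∀ s : ℝ, besselI (-ν) s = (w s)⁻¹ * d0 s := fun s => by
    rw [besselI, Complex.cpow_neg]
  have J1 : ∀ s : ℝ, 0 < s → s * besselI (-ν - 1) s = 2 * (w s)⁻¹ * d1 s := fun s hs => by
    have := hs2 s hs
    have hs0 : (s : ℂ) ≠ 0 := by exact_mod_cast hs.ne'
    rw [besselI, Complex.cpow_sub _ _ this, Complex.cpow_one, Complex.cpow_neg]
    change (s : ℂ) * ((w s)⁻¹ / (s / 2) * d1 s) = _
    field_simp
  set Ya : ℂ → ℂ := fun y => 1 * macdonald ν y + (-1) * (κ * besselI (-ν) y + -κ * besselI ν y)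
    with hYa
  set Yb : ℂ → ℂ := fun y => 1 * macdonald (ν + 1) y +
    (-1) * (κ * -besselI (-ν - 1) y + -κ * -besselI (ν + 1) y) with hYb
  have LA := isLadder_besselI ν
  have LB := isLadder_besselI_neg ν
  have LY : IsLadder ν Ya Yb := (isLadder_macdonald ν).linear (LB.linear LA κ (-κ)) 1 (-1)
  have X1 := tendsto_macdonald (ν := ν) (by rw [hre]; norm_num)
  have X2 := tendsto_macdonald (ν := -ν) (by rw [Complex.neg_re, hre]; norm_num)
  rw [add_comm ν 1] at X1
  rw [show -ν + 1 = 1 - ν by ring] at X2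
  have tYb : Tendsto (fun s : ℝ => ‖(s : ℂ) * Yb s‖) (𝓝[>] 0) (𝓝 0) := by
    have h1 : Tendsto (fun s : ℝ => ‖(s : ℂ) * macdonald (1 + ν) s * ((s : ℂ) / 2) ^ ν +
        κ * (2 * d1 s)‖ + ‖κ * (s * (s / 2)) * c1 s‖) (𝓝[>] 0) (𝓝 0) := by
      have a1 := (X1.add ((td1.const_mul 2).const_mul κ)).norm
      have a2 := ((((ts.mul (ts.div_const 2)).const_mul κ).mul tc1)).norm
      have := a1.add a2
      -- The leading terms cancel for exactly this `κ`, by the reflection formula `hG1`.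
      have e : Complex.Gamma (1 + ν) + κ * (2 * (Complex.Gamma (-ν))⁻¹) = 0 := by
        rw [hκ]
        field_simp at hG1 ⊢
        linear_combination hG1
      rw [e] at this
      simpa using this
    refine squeeze_zero' (Eventually.of_forall fun s => norm_nonneg _) ?_ h1
    filter_upwards [self_mem_nhdsWithin] with s hs
    have hs : 0 < s := hs
    have hwne := hwne s hs
    have e : (s : ℂ) * Yb s = (w s)⁻¹ * ((s : ℂ) * macdonald (1 + ν) s * w s + κ * (2 * d1 s)) -
        w s * (κ * (s * (s / 2)) * c1 s) := by
      have := J1 s hs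
      rw [hYb]; simp only
      rw [I1 s hs, add_comm 1 ν]
      field_simp
      field_simp at this
      linear_combination (2 * κ) * this
    rw [e]
    refine (norm_sub_le _ _).trans_eq ?_
    rw [norm_mul (w s)⁻¹, norm_mul (w s), norm_inv, hw1 s hs, inv_one, one_mul, one_mul]
  have tYa : Tendsto (fun s : ℝ => ‖Ya s‖) (𝓝[>] 0) (𝓝 0) := by
    have h1 : Tendsto (fun s : ℝ => ‖1 / (2 * ν)‖ *
        (‖(s : ℂ) * macdonald (1 + ν) s * ((s : ℂ) / 2) ^ ν - 2 * ν * κ * d0 s‖ +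
        ‖(s : ℂ) * macdonald (1 - ν) s * ((s : ℂ) / 2) ^ (-ν) - 2 * ν * κ * c0 s‖))
        (𝓝[>] 0) (𝓝 0) := by
      have a1 := (X1.sub (td0.const_mul (2 * ν * κ))).norm
      have a2 := (X2.sub (tc0.const_mul (2 * ν * κ))).norm
      have := (a1.add a2).const_mul ‖1 / (2 * ν)‖
      have e1 : Complex.Gamma (1 + ν) - 2 * ν * κ * (Complex.Gamma (1 - ν))⁻¹ = 0 := by
        rw [hκ, hG2]
        field_simp at hG1 ⊢
        linear_combination hG1
      have e2 : Complex.Gamma (1 - ν) - 2 * ν * κ * (Complex.Gamma (1 + ν))⁻¹ = 0 := by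
        rw [hκ, hG2]
        field_simp at hG1 ⊢
        linear_combination -ν * hG1
      rw [e1, e2] at this
      simpa using this
    refine squeeze_zero' (Eventually.of_forall fun s => norm_nonneg _) ?_ h1
    filter_upwards [self_mem_nhdsWithin] with s hs
    have hs : 0 < s := hs
    have hwne := hwne s hs
    have e : Ya s = 1 / (2 * ν) *
        ((w s)⁻¹ * ((s : ℂ) * macdonald (1 + ν) s * w s - 2 * ν * κ * d0 s) -
        w s * ((s : ℂ) * macdonald (1 - ν) s * (w s)⁻¹ - 2 * ν * κ * c0 s)) := by
      -- Near `0` the behaviour of `K_ν` itself is not covered by `tendsto_macdonald`; the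
      -- recurrence expresses it through `K_{1+ν}` and `K_{1-ν}`, whose limits are `X1` and `X2`.
      have hr := macdonald_recurrence ν (y := s) (by simpa using hs)
      rw [← macdonald_neg (ν - 1), neg_sub, add_comm ν 1] at hr
      rw [hYa]; simp only
      rw [I0, J0]
      field_simp
      linear_combination (w s) * hr
    rw [e, norm_mul]
    refine mul_le_mul_of_nonneg_left ?_ (norm_nonneg _)
    refine (norm_sub_le _ _).trans_eq ?_
    rw [norm_mul (w s)⁻¹, norm_mul (w s), norm_inv, hw1 s hs, inv_one, one_mul, one_mul,
      Complex.cpow_neg]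
  have W1 := LY.wronskian_eq LA (L := 0) (by
    have h1 : Tendsto (fun s : ℝ => ‖Ya s‖ * ‖(s : ℂ) * (s / 2) * c1 s‖ + ‖c0 s‖ * ‖(s : ℂ) * Yb s‖)
        (𝓝[>] 0) (𝓝 0) := by
      have := (tYa.mul ((ts.mul (ts.div_const 2)).mul tc1).norm).add (tc0.norm.mul tYb)
      simpa using this
    refine squeeze_zero_norm' ?_ h1
    filter_upwards [self_mem_nhdsWithin] with s hs
    have hs : 0 < s := hs
    have e : (s : ℂ) * (Ya s * -besselI (ν + 1) s - besselI ν s * Yb s) =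
        -(w s * (Ya s * ((s : ℂ) * (s / 2) * c1 s))) - w s * (c0 s * ((s : ℂ) * Yb s)) := by
      rw [I1 s hs, I0]; ring
    rw [e]
    refine (norm_sub_le _ _).trans_eq ?_
    rw [norm_neg, norm_mul (w s), norm_mul (w s), hw1 s hs, one_mul, one_mul, norm_mul (Ya s),
      norm_mul (c0 s)]) hy
  have W2 := LY.wronskian_eq LB (L := 0) (by
    have h1 : Tendsto (fun s : ℝ => ‖Ya s‖ * ‖2 * d1 s‖ + ‖d0 s‖ * ‖(s : ℂ) * Yb s‖)
        (𝓝[>] 0) (𝓝 0) := by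
      have := (tYa.mul (td1.const_mul 2).norm).add (td0.norm.mul tYb)
      simpa using this
    refine squeeze_zero_norm' ?_ h1
    filter_upwards [self_mem_nhdsWithin] with s hs
    have hs : 0 < s := hs
    have e : (s : ℂ) * (Ya s * -besselI (-ν - 1) s - besselI (-ν) s * Yb s) =
        -((w s)⁻¹ * (Ya s * (2 * d1 s))) - (w s)⁻¹ * (d0 s * ((s : ℂ) * Yb s)) := by
      have := J1 s hs
      rw [J0]; linear_combination (-(Ya s)) * this
    rw [e]
    refine (norm_sub_le _ _).trans_eq ?_
    rw [norm_neg, norm_mul (w s)⁻¹, norm_mul (w s)⁻¹, norm_inv, hw1 s hs, inv_one, one_mul,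
      one_mul, norm_mul (Ya s), norm_mul (d0 s)]) hy
  have W3 := LA.wronskian_eq LB
    (L := -2 * ((Complex.Gamma (1 + ν))⁻¹ * (Complex.Gamma (-ν))⁻¹)) (by
    have h1 : Tendsto (fun s : ℝ => -2 * (c0 s * d1 s) + d0 s * ((s : ℂ) * (s / 2) * c1 s)) (𝓝[>] 0)
        (𝓝 (-2 * ((Complex.Gamma (1 + ν))⁻¹ * (Complex.Gamma (-ν))⁻¹))) := by
      have := ((tc0.mul td1).const_mul (-2)).add (td0.mul ((ts.mul (ts.div_const 2)).mul tc1))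
      simpa using this
    refine h1.congr' ?_
    filter_upwards [self_mem_nhdsWithin] with s hs
    have hs : 0 < s := hs
    have hwne := hwne s hs
    have := J1 s hs
    rw [I1 s hs, I0, J0]
    field_simp at this ⊢
    linear_combination 2 * c0 s * this) hy
  have hL : -2 * ((Complex.Gamma (1 + ν))⁻¹ * (Complex.Gamma (-ν))⁻¹) ≠ 0 :=
    mul_ne_zero (by norm_num) (mul_ne_zero (inv_ne_zero hG1'') (inv_ne_zero hG1'))
  -- Cramer's rule for the two linear equations `W1` and `W2` in `(Ya y, Yb y)`, with determinant
  -- `W3`.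
  have za : Ya y = 0 := by
    have : Ya y * (-2 * ((Complex.Gamma (1 + ν))⁻¹ * (Complex.Gamma (-ν))⁻¹)) = 0 := by
      rw [← W3]; linear_combination besselI ν y * W2 - besselI (-ν) y * W1
    exact (mul_eq_zero.1 this).resolve_right hL
  have zb : Yb y = 0 := by
    have : Yb y * (-2 * ((Complex.Gamma (1 + ν))⁻¹ * (Complex.Gamma (-ν))⁻¹)) = 0 := by
      rw [← W3]; linear_combination -besselI (ν + 1) y * W2 + besselI (-ν - 1) y * W1
    exact (mul_eq_zero.1 this).resolve_right hL
  constructor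
  · linear_combination za
  · linear_combination zb

/-- Both sides satisfy the same three-term recurrence in `k`, the sign `(-1)^k` adapting that of `I`
to that of `K`. Agreement at `0` and `1` propagates in both directions because `y ≠ 0`. -/
theorem macdonald_eq_besselI {ν : ℂ} (hre : ν.re = 0) (hν : ν ≠ 0) {y : ℂ} (hy : 0 < y.re)
    (k : ℤ) : macdonald (ν + k) y = (-1) ^ k * (Real.pi / (2 * Complex.sin (Real.pi * ν))) *
      (besselI (-(ν + k)) y - besselI (ν + k) y) := by
  set κ := Real.pi / (2 * Complex.sin (Real.pi * ν))
  have hy0 := ne_zero_of_re_pos hy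
  set D : ℤ → ℂ := fun k => macdonald (ν + k) y - (-1) ^ k * κ *
      (besselI (-(ν + k)) y - besselI (ν + k) y) with hD
  have hrec : ∀ k : ℤ, 2 * (ν + k) * D k = y * (D (k + 1) - D (k - 1)) := by
    intro k
    have h1 := macdonald_recurrence (ν + k) hy
    have h2 := besselI_recurrence (ν + k) hy0
    have h3 := besselI_recurrence (-(ν + k)) hy0
    simp only [hD]
    rw [zpow_add_one₀ (by norm_num), zpow_sub_one₀ (by norm_num)]
    push_cast
    rw [show -(ν + ((k : ℂ) + 1)) = -(ν + k) - 1 by ring,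
      show -(ν + ((k : ℂ) - 1)) = -(ν + k) + 1 by ring, show ν + ((k : ℂ) + 1) = ν + k + 1 by ring,
      show ν + ((k : ℂ) - 1) = ν + k - 1 by ring,
      show ((-1 : ℂ))⁻¹ = -1 by norm_num]
    linear_combination h1 + (-1) ^ k * κ * (h3 + h2)
  have h01 := macdonald_pair_eq hre hν hy
  have h0 : D 0 = 0 := by
    simp only [hD]; rw [Int.cast_zero, add_zero, h01.1]; simp [κ]
  have h1 : D 1 = 0 := by
    simp only [hD]; rw [Int.cast_one, h01.2, zpow_one, show -(ν + 1) = -ν - 1 by ring]; ring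
  have hpair : ∀ n : ℕ, D n = 0 ∧ D (n + 1) = 0 := by
    intro n
    induction n with
    | zero => exact ⟨h0, h1⟩
    | succ n ih =>
      refine ⟨by exact_mod_cast ih.2, ?_⟩
      have := hrec (n + 1)
      rw [ih.2, add_sub_cancel_right, ih.1, sub_zero, mul_zero] at this
      push_cast
      exact (mul_eq_zero.1 this.symm).resolve_left hy0
  have hpair' : ∀ n : ℕ, D (-n) = 0 ∧ D (-n + 1) = 0 := by
    intro n
    induction n with
    | zero => simpa using ⟨h0, h1⟩
    | succ n ih =>
      have e : -((n + 1 : ℕ) : ℤ) + 1 = -n := by push_cast; ring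
      refine ⟨?_, by rw [e]; exact ih.1⟩
      have := hrec (-n)
      rw [ih.2, ih.1, zero_sub, mul_zero] at this
      rw [show -((n + 1 : ℕ) : ℤ) = -n - 1 by push_cast; ring]
      exact neg_eq_zero.1 ((mul_eq_zero.1 this.symm).resolve_left hy0)
  have : D k = 0 := by
    obtain ⟨n, rfl | rfl⟩ := k.eq_nat_or_neg
    · exact (hpair n).1
    · exact (hpair' n).1
  exact sub_eq_zero.1 this

end

/-! ### Gaussian moments in the plane -/

noncomputable section
open MeasureTheory Filter Topology

/-- Angular characters integrate to zero over the circle. -/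
theorem integral_exp_intCast_mul_I (l : ℤ) :
    ∫ θ in Set.Ioo (-Real.pi) Real.pi, Complex.exp (l * (θ * Complex.I)) =
      if l = 0 then ((2 * Real.pi : ℝ) : ℂ) else 0 := by
  rw [← integral_Ioc_eq_integral_Ioo,
    ← intervalIntegral.integral_of_le (by linarith [Real.pi_pos])]
  split_ifs with h
  · subst h
    simp
    ring
  · have hl : (l : ℂ) ≠ 0 := by exact_mod_cast h
    have := integral_exp_mul_complex (a := -Real.pi) (b := Real.pi)
      (c := l * Complex.I) (mul_ne_zero hl Complex.I_ne_zero)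
    have e : ∀ θ : ℝ, Complex.exp (l * (θ * Complex.I)) = Complex.exp (l * Complex.I * θ) := by
      intro θ; congr 1; ring
    simp only [e]
    rw [this, div_eq_zero_iff]
    left
    rw [sub_eq_zero, Complex.exp_eq_exp_iff_exists_int]
    exact ⟨l, by push_cast; ring⟩

/-- Both sides are holomorphic in `τ` on the right half-plane and agree at the real points `1 +
1/(n+1)`, which accumulate at `1`; the identity theorem does the rest. -/
theorem integral_cpow_mul_exp_neg_mul {s τ : ℂ} (hs : 0 < s.re) (hτ : 0 < τ.re) :
    ∫ t in Set.Ioi (0 : ℝ), (t : ℂ) ^ (s - 1) * Complex.exp (-(τ * t)) =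
      (1 / τ) ^ s * Complex.Gamma s := by
  set U : Set ℂ := {z | 0 < z.re} with hU
  have hUo : IsOpen U := isOpen_lt continuous_const Complex.continuous_re
  have hUc : IsPreconnected U := (convex_halfSpace_re_gt 0).isPreconnected
  have hint : ∀ {r b : ℝ}, -1 < r → 0 < b →
      IntegrableOn (fun t : ℝ => t ^ r * Real.exp (-b * t)) (Set.Ioi 0) := by
    intro r b hr hb
    simpa using integrableOn_rpow_mul_exp_neg_mul_rpow (p := 1) hr one_pos hb
  have hmeas : ∀ z : ℂ, AEStronglyMeasurable
      (fun t : ℝ => (t : ℂ) ^ (s - 1) * Complex.exp (-(z * t)))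
      (volume.restrict (Set.Ioi 0)) := fun z =>
    (ContinuousOn.mul (fun t (ht : 0 < t) =>
      (Complex.continuousAt_ofReal_cpow_const _ _ (Or.inr ht.ne')).continuousWithinAt)
      (by fun_prop)).aestronglyMeasurable measurableSet_Ioi
  have hnorm : ∀ (z : ℂ) (t : ℝ), 0 < t →
      ‖(t : ℂ) ^ (s - 1) * Complex.exp (-(z * t))‖ = t ^ (s.re - 1) * Real.exp (-z.re * t) := by
    intro z t ht
    rw [norm_mul, Complex.norm_cpow_eq_rpow_re_of_pos ht, Complex.norm_exp]
    simp
  have hF : DifferentiableOn ℂ (fun z : ℂ => ∫ t in Set.Ioi (0 : ℝ),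
      (t : ℂ) ^ (s - 1) * Complex.exp (-(z * t))) U := by
    intro z (hz : 0 < z.re)
    have := hasDerivAt_integral_of_dominated_loc_of_deriv_le (𝕜 := ℂ)
      (μ := volume.restrict (Set.Ioi (0 : ℝ)))
      (F := fun (z : ℂ) (t : ℝ) => (t : ℂ) ^ (s - 1) * Complex.exp (-(z * t)))
      (F' := fun (z : ℂ) (t : ℝ) => (t : ℂ) ^ (s - 1) * (Complex.exp (-(z * t)) * (-t)))
      (x₀ := z) (s := Metric.ball z (z.re / 2))
      (bound := fun t => t ^ s.re * Real.exp (-(z.re / 2) * t))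
      (Metric.ball_mem_nhds z (by positivity)) (Eventually.of_forall hmeas)
      (by
        refine (hint (r := s.re - 1) (b := z.re) (by linarith) hz).mono' (hmeas z) ?_
        filter_upwards [ae_restrict_mem measurableSet_Ioi] with t (ht : 0 < t)
        rw [hnorm z t ht])
      (by
        have := (hmeas z).mul (g := fun t : ℝ => (-t : ℂ)) (by fun_prop)
        refine this.congr (Eventually.of_forall fun t => ?_)
        simp only [Pi.mul_apply, mul_assoc])
      (by
        filter_upwards [ae_restrict_mem measurableSet_Ioi] with t (ht : 0 < t) w hw
        have hre : z.re / 2 ≤ w.re := by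
          have h1 := (Complex.abs_re_le_norm (w - z)).trans (mem_ball_iff_norm.1 hw).le
          rw [Complex.sub_re] at h1
          linarith [(abs_le.1 h1).1]
        rw [← mul_assoc, norm_mul, hnorm w t ht, norm_neg, Complex.norm_real,
          Real.norm_of_nonneg ht.le,
          show t ^ s.re = t ^ (s.re - 1) * t by
            rw [Real.rpow_sub ht, Real.rpow_one, div_mul_cancel₀ _ ht.ne'],
          mul_right_comm]
        gcongr)
      (hint (by linarith) (by positivity))
      (by
        refine Eventually.of_forall fun t w _ => ?_
        have := (((hasDerivAt_id w).mul_const (t : ℂ)).neg.cexp).const_mul ((t : ℂ) ^ (s - 1))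
        exact this.congr_deriv (by simp))
    exact this.2.differentiableAt.differentiableWithinAt
  have hG : DifferentiableOn ℂ (fun z : ℂ => (1 / z) ^ s * Complex.Gamma s) U := by
    intro z (hz : 0 < z.re)
    have hz0 : z ≠ 0 := by rintro rfl; simp at hz
    refine DifferentiableAt.differentiableWithinAt ?_
    refine DifferentiableAt.mul_const (DifferentiableAt.cpow_const ?_ ?_) _
    · exact (differentiableAt_const 1).div differentiableAt_id hz0
    · left
      rw [one_div, Complex.inv_re]
      exact div_pos hz (Complex.normSq_pos.2 hz0)
  have key := (hF.analyticOnNhd hUo).eqOn_of_preconnected_of_frequently_eq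
    (hG.analyticOnNhd hUo) hUc (z₀ := 1) (by simp [hU]) ?_
  · exact key hτ
  · have hT : Tendsto (fun n : ℕ => ((1 + 1 / ((n : ℝ) + 1) : ℝ) : ℂ)) atTop (𝓝[≠] 1) := by
      refine tendsto_nhdsWithin_iff.2 ⟨?_, Eventually.of_forall fun n => ?_⟩
      · have := (tendsto_const_nhds (x := (1 : ℝ))).add tendsto_one_div_add_atTop_nhds_zero_nat
        simpa [Function.comp_def] using (Complex.continuous_ofReal.tendsto _).comp this
      · have : (0 : ℝ) < 1 / ((n : ℝ) + 1) := by positivity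
        simp only [Set.mem_compl_iff, Set.mem_singleton_iff]
        intro h
        have : (1 + 1 / ((n : ℝ) + 1) : ℝ) = 1 := by exact_mod_cast h
        linarith
    refine hT.frequently (Eventually.frequently (Eventually.of_forall fun n => ?_))
    exact Complex.integral_cpow_mul_exp_neg_mul_Ioi hs (by positivity)

theorem integral_cpow_mul_exp_neg_mul_sq {s τ : ℂ} (hs : 0 < s.re) (hτ : 0 < τ.re) :
    ∫ r in Set.Ioi (0 : ℝ), (r : ℂ) ^ (2 * s - 1) * Complex.exp (-τ * (r : ℂ) ^ 2) =
      (1 / 2) * ((1 / τ) ^ s * Complex.Gamma s) := by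
  have h := integral_comp_rpow_Ioi_of_pos
    (g := fun t : ℝ => (t : ℂ) ^ (s - 1) * Complex.exp (-(τ * t))) (p := 2) two_pos
  rw [integral_cpow_mul_exp_neg_mul hs hτ] at h
  rw [← h, ← integral_const_mul]
  refine setIntegral_congr_fun measurableSet_Ioi fun r (hr : 0 < r) => ?_
  have hr' : (r : ℂ) ≠ 0 := by exact_mod_cast hr.ne'
  have e1 : ((r ^ (2 : ℝ) : ℝ) : ℂ) ^ (s - 1) = (r : ℂ) ^ (2 * s - 2) := by
    rw [Complex.ofReal_cpow hr.le, ← Complex.ofReal_cpow hr.le,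
      Complex.ofReal_cpow hr.le, show ((r : ℂ) ^ ((2 : ℝ) : ℂ)) ^ (s - 1)
        = (r : ℂ) ^ (((2 : ℝ) : ℂ) * (s - 1)) by
        rw [Complex.cpow_mul_ofReal_nonneg hr.le]; norm_num]
    congr 1; push_cast; ring
  have e2 : (r : ℂ) ^ (2 * s - 1) = (r : ℂ) ^ (2 * s - 2) * r := by
    rw [show (2 * s - 1 : ℂ) = (2 * s - 2) + 1 by ring, Complex.cpow_add _ _ hr',
      Complex.cpow_one]
  simp only [Real.rpow_two] at e1 ⊢
  rw [Complex.real_smul, e1, e2, show (2 : ℝ) - 1 = 1 by norm_num, Real.rpow_one]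
  push_cast
  ring_nf

/-- The moments of a Gaussian on the plane. -/
theorem integral_norm_cpow_mul_zpow_mul_gaussian {s τ : ℂ} (hs : -1 < s.re) (hτ : 0 < τ.re)
    (l : ℤ) :
    ∫ u : ℂ, ((‖u‖ : ℝ) : ℂ) ^ (2 * s) * (u / ((‖u‖ : ℝ) : ℂ)) ^ l *
        Complex.exp (-τ * ((‖u‖ : ℝ) : ℂ) ^ 2) =
      if l = 0 then Real.pi * ((1 / τ) ^ (s + 1) * Complex.Gamma (s + 1)) else 0 := by
  rw [← Complex.integral_comp_polarCoord_symm, polarCoord_target]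
  have e : ∀ p ∈ Set.Ioi (0 : ℝ) ×ˢ Set.Ioo (-Real.pi) Real.pi,
      p.1 • (((‖Complex.polarCoord.symm p‖ : ℝ) : ℂ) ^ (2 * s) *
        (Complex.polarCoord.symm p / ((‖Complex.polarCoord.symm p‖ : ℝ) : ℂ)) ^ l *
        Complex.exp (-τ * ((‖Complex.polarCoord.symm p‖ : ℝ) : ℂ) ^ 2)) =
      ((p.1 : ℂ) ^ (2 * (s + 1) - 1) * Complex.exp (-τ * (p.1 : ℂ) ^ 2)) *
        Complex.exp (l * (p.2 * Complex.I)) := by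
    rintro ⟨r, θ⟩ ⟨hr, -⟩
    have hr : 0 < r := hr
    have hr' : (r : ℂ) ≠ 0 := by exact_mod_cast hr.ne'
    have hn : ‖Complex.polarCoord.symm (r, θ)‖ = r := by
      rw [Complex.norm_polarCoord_symm, abs_of_pos hr]
    rw [hn, Complex.polarCoord_symm_apply, Complex.ofReal_cos, Complex.ofReal_sin,
      ← Complex.exp_mul_I, mul_div_cancel_left₀ _ hr', ← Complex.exp_int_mul, Complex.real_smul,
      show (2 * (s + 1) - 1 : ℂ) = 2 * s + 1 by ring, Complex.cpow_add _ _ hr', Complex.cpow_one]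
    ring
  rw [setIntegral_congr_fun (measurableSet_Ioi.prod measurableSet_Ioo) e,
    Measure.volume_eq_prod, setIntegral_prod_mul
      (fun r : ℝ => (r : ℂ) ^ (2 * (s + 1) - 1) * Complex.exp (-τ * (r : ℂ) ^ 2))
      (fun θ : ℝ => Complex.exp (l * (θ * Complex.I))),
    integral_exp_intCast_mul_I, integral_cpow_mul_exp_neg_mul_sq (by simpa using by linarith) hτ]
  split_ifs
  · push_cast; ring
  · simp

/-- The integral has a positive closed form, whereas a non-integrable function has integral `0` by
convention. -/
theorem integrable_norm_rpow_mul_gaussian {r c : ℝ} (hr : -2 < r) (hc : 0 < c) :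
    Integrable fun u : ℂ => ‖u‖ ^ r * Real.exp (-c * ‖u‖ ^ (2 : ℝ)) := by
  by_contra h
  have := integral_undef h
  rw [Complex.integral_rpow_mul_exp_neg_mul_rpow (by norm_num) hr hc] at this
  have hG : 0 < Real.Gamma ((r + 2) / 2) := Real.Gamma_pos_of_pos (by linarith)
  have : 0 < 2 * Real.pi / 2 * c ^ (-(r + 2) / 2) * Real.Gamma ((r + 2) / 2) := by positivity
  linarith

theorem growth_nonneg (u : ℂ) : 0 ≤ growth u := by rw [growth]; positivity

/-- The growth of the Bessel kernels is absorbed by Gaussians. -/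
theorem integrable_growth_mul_pow_mul_gaussian (k : ℕ) {c : ℝ} (hc : 2 < c) :
    Integrable fun u : ℂ => growth u * (‖u‖ ^ k * Real.exp (-c * ‖u‖ ^ 2)) := by
  have h1 := integrable_norm_rpow_mul_gaussian (r := k + 1) (c := c - 2)
    (by have : (0 : ℝ) ≤ k := k.cast_nonneg
        linarith) (by linarith)
  have h2 := integrable_norm_rpow_mul_gaussian (r := (k : ℝ) - 1) (c := c - 2)
    (by have : (0 : ℝ) ≤ k := k.cast_nonneg
        linarith) (by linarith)
  refine (h1.add h2).congr ?_
  filter_upwards [compl_mem_ae_iff.2 (measure_singleton (0 : ℂ))] with u hu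
  have hu : u ≠ 0 := hu
  have hn : 0 < ‖u‖ := norm_pos_iff.2 hu
  simp only [Pi.add_apply, growth]
  rw [Real.rpow_add hn, Real.rpow_sub hn, Real.rpow_natCast, Real.rpow_one, Real.rpow_two,
    show -(c - 2) * ‖u‖ ^ 2 = 2 * ‖u‖ ^ 2 + -c * ‖u‖ ^ 2 by ring, Real.exp_add]
  field_simp

end

/-! ### Term-by-term integration of the kernel against Gaussians -/

noncomputable section
open MeasureTheory Filter Topology

/-- The even monomials times a Gaussian, used as test functions. -/
def gaussMonomial (q : ℕ) (τ u : ℂ) : ℂ := u ^ (2 * q) * Complex.exp (-τ * ((‖u‖ : ℝ) : ℂ) ^ 2)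

theorem norm_gaussMonomial (q : ℕ) (τ u : ℂ) :
    ‖gaussMonomial q τ u‖ = ‖u‖ ^ (2 * q) * Real.exp (-τ.re * ‖u‖ ^ 2) := by
  rw [gaussMonomial, norm_mul, norm_pow, Complex.norm_exp]
  congr 2
  rw [← Complex.ofReal_pow, Complex.re_mul_ofReal, Complex.neg_re]

theorem continuous_gaussMonomial (q : ℕ) (τ : ℂ) : Continuous (gaussMonomial q τ) := by
  unfold gaussMonomial
  fun_prop

theorem aestronglyMeasurable_of_continuousOn_compl_zero {g : ℂ → ℂ} (hg : ContinuousOn g {0}ᶜ) :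
    AEStronglyMeasurable g volume := by
  have := hg.aestronglyMeasurable (μ := volume) (measurableSet_singleton (0 : ℂ)).compl
  rwa [Measure.restrict_eq_self_of_ae_mem] at this
  exact compl_mem_ae_iff.2 (by simp)

theorem ae_ne_zero : ∀ᵐ u : ℂ, u ≠ 0 := compl_mem_ae_iff.2 (measure_singleton (0 : ℂ))

/-- The coefficient of the `(m,n)`-term of `𝒥_{ν,p}`. -/
def kernelCoeff (ν : ℂ) (p : ℤ) (x : ℕ × ℕ) : ℂ :=
  (4 : ℂ) ^ (-ν) * ((-1 / 4) ^ x.1 / (x.1.factorial : ℂ) * (Complex.Gamma (ν - p + x.1 + 1))⁻¹ *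
    ((-1 / 4) ^ x.2 / (x.2.factorial : ℂ) * (Complex.Gamma (ν + p + x.2 + 1))⁻¹))

theorem norm_half_cpow (ν : ℂ) {u : ℂ} (hu : u ≠ 0) :
    ((‖u / 2‖ : ℝ) : ℂ) ^ (2 * ν) = (4 : ℂ) ^ (-ν) * ((‖u‖ : ℝ) : ℂ) ^ (2 * ν) := by
  have hn : 0 < ‖u‖ := norm_pos_iff.2 hu
  rw [norm_div, Complex.norm_ofNat, div_eq_mul_inv, Complex.ofReal_mul,
    Complex.mul_cpow_ofReal_nonneg hn.le (by norm_num), Complex.ofReal_inv, mul_comm]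
  congr 1
  rw [Complex.inv_cpow _ _ (by
      rw [Complex.arg_ofReal_of_nonneg (by norm_num)]; exact Real.pi_pos.ne), ← Complex.cpow_neg]
  have : (4 : ℂ) = ((2 : ℝ) : ℂ) * ((2 : ℝ) : ℂ) := by norm_num
  rw [this, Complex.mul_cpow_ofReal_nonneg (by norm_num) (by norm_num),
    ← Complex.cpow_add _ _ (by norm_num)]
  congr 1; ring

theorem conj_eq_norm_mul_inv {u : ℂ} (hu : u ≠ 0) :
    (starRingEnd ℂ) u = ((‖u‖ : ℝ) : ℂ) * (u / ((‖u‖ : ℝ) : ℂ))⁻¹ := by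
  have h1 : u * (starRingEnd ℂ) u = ((‖u‖ : ℝ) : ℂ) ^ 2 := by
    rw [Complex.mul_conj, Complex.normSq_eq_norm_sq]; push_cast; rfl
  have h2 : (starRingEnd ℂ) u = ((‖u‖ : ℝ) : ℂ) ^ 2 / u := by
    rw [← h1, mul_div_cancel_left₀ _ hu]
  rw [h2, inv_div]; ring

/-- Bookkeeping for `u = r w` with `r = |u|` and `w = u/|u|`: it separates the radial from the
angular dependence of a term of the double series. -/
theorem kernelTerm_eq (ν : ℂ) (p : ℤ) (q m n : ℕ) {r w : ℂ} (hr : r ≠ 0) (hw : w ≠ 0) :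
    r ^ (2 * (ν + q + m + n)) * w ^ (2 * ((m : ℤ) + q - p - n)) * ((-1 / 4) ^ m * (-1 / 4) ^ n) =
      r ^ (2 * ν) * w ^ (-2 * p) * (r * w) ^ (2 * q) *
        ((-(r * w / 2) ^ 2) ^ m * (-(r * w⁻¹ / 2) ^ 2) ^ n) := by
  have h3 : r ^ (2 * (ν + q + m + n)) = r ^ (2 * ν) * r ^ (2 * q) * r ^ (2 * m) * r ^ (2 * n) := by
    rw [show (2 * (ν + q + m + n) : ℂ) = 2 * ν + ((2 * q + 2 * m + 2 * n : ℕ) : ℂ) by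
      push_cast; ring, Complex.cpow_add _ _ hr, Complex.cpow_natCast, pow_add, pow_add]
    ring
  have h4 : w ^ (2 * ((m : ℤ) + q - p - n)) =
      w ^ (-2 * p) * w ^ (2 * q) * w ^ (2 * m) * (w⁻¹) ^ (2 * n) := by
    rw [show (2 * ((m : ℤ) + q - p - n)) = -2 * p + ((2 * q : ℕ) : ℤ) + ((2 * m : ℕ) : ℤ)
      - ((2 * n : ℕ) : ℤ) by push_cast; ring, zpow_sub₀ hw, zpow_add₀ hw, zpow_add₀ hw,
      zpow_natCast, zpow_natCast, zpow_natCast, inv_pow]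
    rfl
  have h5 : (-(r * w / 2) ^ 2) ^ m = (-1 / 4) ^ m * (r ^ (2 * m) * w ^ (2 * m)) := by
    rw [pow_mul, pow_mul, ← mul_pow, ← mul_pow]; congr 1; ring
  have h6 : (-(r * w⁻¹ / 2) ^ 2) ^ n = (-1 / 4) ^ n * (r ^ (2 * n) * (w⁻¹) ^ (2 * n)) := by
    rw [pow_mul, pow_mul, ← mul_pow, ← mul_pow]; congr 1; ring
  rw [h3, h4, h5, h6, mul_pow]
  generalize (-1 / 4 : ℂ) ^ m = A
  generalize (-1 / 4 : ℂ) ^ n = B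
  generalize (w⁻¹) ^ (2 * n) = D
  ring

theorem hasSum_clifford_mul_clifford (α β y z : ℂ) : HasSum (fun x : ℕ × ℕ =>
      (y ^ x.1 / (x.1.factorial : ℂ) * (Complex.Gamma (α + x.1 + 1))⁻¹) *
      (z ^ x.2 / (x.2.factorial : ℂ) * (Complex.Gamma (β + x.2 + 1))⁻¹))
      (clifford α y * clifford β z) := by
  have hA := summable_norm_clifford α y
  have hB := summable_norm_clifford β z
  have h : Summable (fun x : ℕ × ℕ =>
      (y ^ x.1 / (x.1.factorial : ℂ) * (Complex.Gamma (α + x.1 + 1))⁻¹) *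
      (z ^ x.2 / (x.2.factorial : ℂ) * (Complex.Gamma (β + x.2 + 1))⁻¹)) :=
    summable_mul_of_summable_norm
    (f := fun m : ℕ => y ^ m / (m.factorial : ℂ) * (Complex.Gamma (α + m + 1))⁻¹)
    (g := fun m : ℕ => z ^ m / (m.factorial : ℂ) * (Complex.Gamma (β + m + 1))⁻¹) hA hB
  have := (summable_clifford α y).hasSum.mul (summable_clifford β z).hasSum h
  exact this

theorem hasSum_besselJKernel_mul_gaussMonomial (ν τ : ℂ) (p : ℤ) (q : ℕ) {u : ℂ} (hu : u ≠ 0) :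
    HasSum (fun x : ℕ × ℕ => kernelCoeff ν p x *
      (((‖u‖ : ℝ) : ℂ) ^ (2 * (ν + q + x.1 + x.2)) *
        (u / ((‖u‖ : ℝ) : ℂ)) ^ (2 * ((x.1 : ℤ) + q - p - x.2)) *
        Complex.exp (-τ * ((‖u‖ : ℝ) : ℂ) ^ 2)))
      (besselJKernel ν p u * gaussMonomial q τ u) := by
  have hn : 0 < ‖u‖ := norm_pos_iff.2 hu
  have hn' : ((‖u‖ : ℝ) : ℂ) ≠ 0 := by exact_mod_cast hn.ne'
  have hAB := hasSum_clifford_mul_clifford (ν - p) (ν + p) (-(u / 2) ^ 2)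
    (-((starRingEnd ℂ) u / 2) ^ 2)
  have := hAB.mul_left (((‖u / 2‖ : ℝ) : ℂ) ^ (2 * ν) * (u / ((‖u‖ : ℝ) : ℂ)) ^ (-2 * p) *
    gaussMonomial q τ u)
  have e : besselJKernel ν p u * gaussMonomial q τ u =
      ((‖u / 2‖ : ℝ) : ℂ) ^ (2 * ν) * (u / ((‖u‖ : ℝ) : ℂ)) ^ (-2 * p) * gaussMonomial q τ u *
        (clifford (ν - p) (-(u / 2) ^ 2) * clifford (ν + p) (-((starRingEnd ℂ) u / 2) ^ 2)) := by
    rw [besselJKernel, besselJStar_eq_clifford, besselJStar_eq_clifford]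
    ring
  rw [e]
  refine this.of_forall_eq ?_
  rintro ⟨m, n⟩
  have ht := kernelTerm_eq ν p q m n hn' (div_ne_zero hu hn')
  rw [mul_div_cancel₀ u hn', ← conj_eq_norm_mul_inv hu] at ht
  simp only [kernelCoeff, gaussMonomial]
  rw [norm_half_cpow ν hu]
  linear_combination (4 ^ (-ν) / (m.factorial : ℂ) * (Complex.Gamma (ν - p + m + 1))⁻¹ *
    ((Complex.Gamma (ν + p + n + 1))⁻¹ / (n.factorial : ℂ)) *
    Complex.exp (-τ * ((‖u‖ : ℝ) : ℂ) ^ 2)) * ht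

/-- Each of the two series is dominated by a multiple of `exp(|u|²/4)`, so a Gaussian with `Re τ >
1/2` permits termwise integration. The angular integral annihilates all terms off one diagonal. -/
theorem hasSum_integral_besselJKernel_mul_gaussMonomial {ν τ : ℂ} (hν : ν.re = 0)
    (hτ : 1 / 2 < τ.re) (p : ℤ) (q : ℕ) :
    HasSum (fun x : ℕ × ℕ => kernelCoeff ν p x *
      if (x.1 : ℤ) + q - p - x.2 = 0 then
        Real.pi * ((1 / τ) ^ (ν + q + x.1 + x.2 + 1) * Complex.Gamma (ν + q + x.1 + x.2 + 1))
      else 0)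
      (∫ u, besselJKernel ν p u * gaussMonomial q τ u) := by
  obtain ⟨C, hC0, hC⟩ := exists_norm_inv_Gamma_le (max ‖ν - p‖ ‖ν + p‖)
  set F : ℕ × ℕ → ℂ → ℂ := fun x u => kernelCoeff ν p x *
      (((‖u‖ : ℝ) : ℂ) ^ (2 * (ν + q + x.1 + x.2)) *
        (u / ((‖u‖ : ℝ) : ℂ)) ^ (2 * ((x.1 : ℤ) + q - p - x.2)) *
        Complex.exp (-τ * ((‖u‖ : ℝ) : ℂ) ^ 2)) with hF
  set B : ℕ × ℕ → ℂ → ℝ := fun x u =>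
    (C * ((‖u‖ ^ 2 / 4) ^ x.1 / x.1.factorial)) * ((‖u‖ ^ 2 / 4) ^ x.2 / x.2.factorial) *
      (C * (‖u‖ ^ (2 * q) * Real.exp (-τ.re * ‖u‖ ^ 2))) with hB
  have hBsum : ∀ u, HasSum (fun x => B x u) ((C * Real.exp (‖u‖ ^ 2 / 4)) * Real.exp (‖u‖ ^ 2 / 4) *
      (C * (‖u‖ ^ (2 * q) * Real.exp (-τ.re * ‖u‖ ^ 2)))) := by
    intro u
    have h1 : HasSum (fun m : ℕ => (‖u‖ ^ 2 / 4) ^ m / (m.factorial : ℝ))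
        (Real.exp (‖u‖ ^ 2 / 4)) := by
      rw [Real.exp_eq_exp_ℝ]
      exact NormedSpace.expSeries_div_hasSum_exp (‖u‖ ^ 2 / 4)
    refine (((h1.mul_left C).mul h1 ?_)).mul_right _
    exact (h1.summable.mul_left C).mul_of_nonneg h1.summable (fun n => by positivity)
      (fun n => by positivity)
  have key := hasSum_integral_of_dominated_convergence (μ := volume) (F := F)
    (f := fun u => besselJKernel ν p u * gaussMonomial q τ u) B ?_ ?_ ?_ ?_ ?_
  · refine key.of_forall_eq fun x => ?_
    simp only [hF]
    rw [integral_const_mul, integral_norm_cpow_mul_zpow_mul_gaussian _ (by linarith)]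
    · simp only [mul_eq_zero, OfNat.ofNat_ne_zero, false_or]
    · simp only [Complex.add_re, hν, Complex.natCast_re]
      have h1 : (0 : ℝ) ≤ q := q.cast_nonneg
      have h2 : (0 : ℝ) ≤ x.1 := x.1.cast_nonneg
      have h3 : (0 : ℝ) ≤ x.2 := x.2.cast_nonneg
      linarith
  · intro x
    refine aestronglyMeasurable_of_continuousOn_compl_zero fun u hu => ?_
    have hu : u ≠ 0 := hu
    have hn : 0 < ‖u‖ := norm_pos_iff.2 hu
    have hn' : ((‖u‖ : ℝ) : ℂ) ≠ 0 := by exact_mod_cast hn.ne'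
    refine ContinuousAt.continuousWithinAt ?_
    refine continuousAt_const.mul ((ContinuousAt.mul ?_ ?_).mul (by fun_prop))
    · exact ContinuousAt.cpow (by fun_prop) continuousAt_const (Or.inl (by simpa using hn))
    · exact ContinuousAt.zpow₀ (ContinuousAt.div (f := fun u : ℂ => u)
        (g := fun u : ℂ => ((‖u‖ : ℝ) : ℂ)) (by fun_prop) (by fun_prop) hn') _
        (Or.inl (div_ne_zero hu hn'))
  · intro x
    filter_upwards [ae_ne_zero] with u hu
    have hn : 0 < ‖u‖ := norm_pos_iff.2 hu
    simp only [hF, hB, kernelCoeff]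
    have e1 : ‖(((‖u‖ : ℝ) : ℂ) ^ (2 * (ν + q + x.1 + x.2)))‖ =
        ‖u‖ ^ (2 * q) * (‖u‖ ^ (2 * x.1) * ‖u‖ ^ (2 * x.2)) := by
      rw [Complex.norm_cpow_eq_rpow_re_of_pos hn, ← pow_add, ← pow_add, ← Real.rpow_natCast]
      congr 1
      simp [hν]
      ring
    have e2 : ‖(u / ((‖u‖ : ℝ) : ℂ)) ^ (2 * ((x.1 : ℤ) + q - p - x.2))‖ = 1 := by
      rw [norm_zpow, norm_div, Complex.norm_real, norm_norm, div_self hn.ne', one_zpow]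
    have e3 : ‖Complex.exp (-τ * ((‖u‖ : ℝ) : ℂ) ^ 2)‖ = Real.exp (-τ.re * ‖u‖ ^ 2) := by
      rw [Complex.norm_exp, ← Complex.ofReal_pow, Complex.re_mul_ofReal, Complex.neg_re]
    have e4 : ‖(4 : ℂ) ^ (-ν)‖ = 1 := by
      have := Complex.norm_cpow_eq_rpow_re_of_pos (show (0 : ℝ) < 4 by norm_num) (-ν)
      simpa [hν] using this
    have g1 := hC (ν - p) (le_max_left _ _) x.1
    have g2 := hC (ν + p) (le_max_right _ _) x.2
    have e5 : ‖(-1 / 4 : ℂ)‖ = 1 / 4 := by simp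
    rw [norm_mul, norm_mul (_ * _) (Complex.exp _), norm_mul (_ ^ (_ : ℂ)) (_ ^ (_ : ℤ)), e1, e2, e3,
      norm_mul, e4, norm_mul, norm_mul, norm_mul,
      norm_div, norm_div, norm_pow, norm_pow, e5, Complex.norm_natCast, Complex.norm_natCast]
    calc _ ≤ 1 * ((1 / 4 : ℝ) ^ x.1 / x.1.factorial * C * ((1 / 4) ^ x.2 / x.2.factorial * C)) *
          (‖u‖ ^ (2 * q) * (‖u‖ ^ (2 * x.1) * ‖u‖ ^ (2 * x.2)) * 1 *
            Real.exp (-τ.re * ‖u‖ ^ 2)) := by gcongr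
      _ = _ := by
        rw [div_pow, div_pow, pow_mul ‖u‖ 2 x.1, pow_mul ‖u‖ 2 x.2, div_pow, div_pow]
        ring
  · exact Eventually.of_forall fun u => (hBsum u).summable
  · have := integrable_norm_rpow_mul_gaussian (r := (2 * q : ℕ)) (c := τ.re - 1 / 2)
      (by have : (0 : ℝ) ≤ (2 * q : ℕ) := Nat.cast_nonneg _
          linarith) (by linarith)
    refine (this.const_mul (C ^ 2)).congr (Eventually.of_forall fun u => ?_)
    simp only
    rw [(hBsum u).tsum_eq, Real.rpow_natCast, Real.rpow_two,
      show -(τ.re - 1 / 2) * ‖u‖ ^ 2 = ‖u‖ ^ 2 / 4 + ‖u‖ ^ 2 / 4 + -τ.re * ‖u‖ ^ 2 by ring,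
      Real.exp_add, Real.exp_add]
    ring
  · filter_upwards [ae_ne_zero] with u hu
    exact hasSum_besselJKernel_mul_gaussMonomial ν τ p q hu

/-- A double sum supported on a diagonal is a single sum. -/
theorem HasSum.of_diagonal {F : ℕ × ℕ → ℂ} {a : ℂ} (h : HasSum F a) (k : ℤ)
    (h0 : ∀ x : ℕ × ℕ, (x.2 : ℤ) ≠ x.1 + k → F x = 0) {g : ℕ → ℂ}
    (hg : ∀ m n : ℕ, (n : ℤ) = m + k → g m = F (m, n)) (hg0 : ∀ m : ℕ, (m : ℤ) + k < 0 → g m = 0) :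
    HasSum g a := by
  refine h.prod_fiberwise fun m => ?_
  by_cases hm : 0 ≤ (m : ℤ) + k
  · obtain ⟨n, hn⟩ := Int.eq_ofNat_of_zero_le hm
    rw [hg m n hn.symm]
    exact hasSum_single n fun n' hn' => h0 _ fun h => hn' (by simp only at h; omega)
  · rw [hg0 m (by omega)]
    have : (fun c : ℕ => F (m, c)) = fun _ => 0 := by
      funext n
      exact h0 _ fun h => by simp only at h; omega
    rw [this]
    exact hasSum_zero

end

/-! ### Closed form of the Gaussian transforms -/

noncomputable section
open MeasureTheory Filter Topology

/-- The coefficient of `z^N` in `exp (-a (z + z⁻¹))`. -/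
def laurentCoeff (N : ℤ) (a : ℂ) : ℂ := (-a) ^ N * clifford N (a ^ 2)

theorem laurentCoeff_neg (N : ℤ) {a : ℂ} (ha : a ≠ 0) : laurentCoeff (-N) a = laurentCoeff N a := by
  have ha' : -a ≠ 0 := neg_ne_zero.2 ha
  rw [laurentCoeff, laurentCoeff, Int.cast_neg, clifford_neg_intCast N (pow_ne_zero 2 ha),
    ← mul_assoc, ← neg_sq a, ← zpow_natCast (-a) 2, ← zpow_mul, ← zpow_add₀ ha']
  congr 2
  push_cast
  ring

theorem ascPochhammer_eval_mul_Gamma {s : ℂ} (hs : s.im ≠ 0) (n : ℕ) :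
    (ascPochhammer ℂ n).eval s * Complex.Gamma s = Complex.Gamma (s + n) := by
  induction n with
  | zero => simp
  | succ n ih =>
    have hne : s + n ≠ 0 := fun h => hs (by simpa using congrArg Complex.im h)
    rw [ascPochhammer_succ_eval, mul_right_comm, ih, Nat.cast_succ, ← add_assoc,
      Complex.Gamma_add_one _ hne, mul_comm]

theorem Gamma_ne_zero_of_im_ne_zero {s : ℂ} (hs : s.im ≠ 0) : Complex.Gamma s ≠ 0 :=
  Complex.Gamma_ne_zero fun m h => hs (by simp [h])

theorem besselI_two_mul (μ a : ℂ) : besselI μ (2 * a) = a ^ μ * clifford μ (a ^ 2) := by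
  rw [besselI, mul_div_cancel_left₀ _ two_ne_zero]

theorem inv_four_mul_cpow {τ : ℂ} (hτ : τ ≠ 0) (ν : ℂ) :
    (1 / (4 * τ)) ^ ν = (4 : ℂ) ^ (-ν) * (1 / τ) ^ ν := by
  have h1 : (1 / τ : ℂ) ≠ 0 := one_div_ne_zero hτ
  have e : 1 / (4 * τ) = (((1 / 4 : ℝ) : ℝ) : ℂ) * (1 / τ) := by
    push_cast; field_simp
  rw [e, Complex.cpow_def_of_ne_zero (mul_ne_zero (by norm_num) h1),
    Complex.log_ofReal_mul (by norm_num) h1, add_mul, Complex.exp_add,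
    Complex.cpow_def_of_ne_zero h1, Complex.cpow_def_of_ne_zero (by norm_num)]
  congr 2
  have h4 : Complex.log 4 = ((Real.log 4 : ℝ) : ℂ) := by
    rw [Complex.ofReal_log (by norm_num)]; norm_num
  rw [one_div, Real.log_inv, h4]
  push_cast
  ring

/-- On the surviving diagonal `n = m + q - p` the terms form the series of
`hasSum_sum_choose_clifford_mul` with `N = 2q`, `α = ν + q`, `β = -p - q`, at the point `(1/(4τ))²`.
The hypothesis on `ν` makes `Im ν ≠ 0`, so the Gamma values to be cancelled are nonzero. -/
theorem integral_besselJKernel_mul_gaussMonomial_eq_clifford {ν τ : ℂ} (hre : ν.re = 0)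
    (hν : ν ≠ 0) (hτ : 1 / 2 < τ.re) (p : ℤ) (q : ℕ) :
    ∫ u, besselJKernel ν p u * gaussMonomial q τ u =
      (4 : ℂ) ^ (-ν) * (-1 / 4) ^ ((q : ℤ) - p) * (Real.pi * (1 / τ) ^ (ν + 2 * q - p + 1)) *
        ∑ j ∈ Finset.range (2 * q + 1), ((2 * q).choose j : ℂ) *
          (clifford (ν + q - j) ((1 / (4 * τ)) ^ 2) *
            clifford (-p - q + j) ((1 / (4 * τ)) ^ 2)) := by
  have hτ0 : τ ≠ 0 := ne_zero_of_re_pos (by linarith)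
  have him : ν.im ≠ 0 := fun h => hν (Complex.ext hre h)
  have h1 := (hasSum_sum_choose_clifford_mul (2 * q) (ν + q) (-p - q)
    ((1 / (4 * τ)) ^ 2)).mul_left
    ((4 : ℂ) ^ (-ν) * (-1 / 4) ^ ((q : ℤ) - p) * (Real.pi * (1 / τ) ^ (ν + 2 * q - p + 1)))
  refine HasSum.unique ((hasSum_integral_besselJKernel_mul_gaussMonomial hre hτ p q).of_diagonal
    ((q : ℤ) - p) ?_ ?_ ?_) h1
  · rintro ⟨m, n⟩ h
    rw [if_neg (by simp only at h ⊢; omega), mul_zero]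
  · intro m n hmn
    have hn : (n : ℂ) = m + q - p := by
      have : (n : ℤ) = m + q - p := by omega
      exact_mod_cast congrArg (Int.cast : ℤ → ℂ) this
    simp only [kernelCoeff]
    rw [if_pos (by omega)]
    have g1 : Complex.Gamma (-(p : ℂ) - q + (2 * q : ℕ) + m + 1) = n.factorial := by
      rw [← Complex.Gamma_nat_eq_factorial, hn]; congr 1; push_cast; ring
    -- The Gamma value from the radial integral, divided by the one in the kernel coefficient, is
    -- the Pochhammer factor of the product series.
    have g2 : (ascPochhammer ℂ (m + 2 * q)).eval (ν + q + (-p - q) + m + 1) *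
        Complex.Gamma (ν - p + m + 1) = Complex.Gamma (ν + q + m + n + 1) := by
      have := ascPochhammer_eval_mul_Gamma (s := ν - p + m + 1) (by simpa using him) (m + 2 * q)
      rw [show ν + q + (-p - q) + m + 1 = ν - p + m + 1 by ring, this, hn]
      congr 1; push_cast; ring
    have g3 : Complex.Gamma (ν - p + m + 1) ≠ 0 :=
      Gamma_ne_zero_of_im_ne_zero (by simpa using him)
    have g4 : ν + p + n + 1 = ν + q + m + 1 := by rw [hn]; ring
    have g5 : (1 / τ) ^ (ν + q + m + n + 1) = (1 / τ) ^ (ν + 2 * q - p + 1) * (1 / τ) ^ (2 * m) := by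
      rw [← Complex.cpow_natCast, ← Complex.cpow_add _ _ (one_div_ne_zero hτ0), hn]
      congr 1; push_cast; ring
    have g6 : (-1 / 4 : ℂ) ^ m * (-1 / 4 : ℂ) ^ n =
        (-1 / 4 : ℂ) ^ ((q : ℤ) - p) * (1 / 4) ^ (2 * m) := by
      rw [← pow_add, ← zpow_natCast, show ((m + n : ℕ) : ℤ) = ((q : ℤ) - p) + ((2 * m : ℕ) : ℤ) by
        push_cast; omega, zpow_add₀ (by norm_num), zpow_natCast, pow_mul, pow_mul (1 / 4 : ℂ)]
      norm_num
    have g7 : ((1 / (4 * τ)) ^ 2) ^ m = (1 / 4) ^ (2 * m) * (1 / τ) ^ (2 * m) := by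
      rw [← pow_mul, ← mul_pow]; congr 1; field_simp
    rw [g1, g4, g5, g7, ← g2]
    have hf1 : (m.factorial : ℂ) ≠ 0 := by exact_mod_cast m.factorial_ne_zero
    have hf2 : (n.factorial : ℂ) ≠ 0 := by exact_mod_cast n.factorial_ne_zero
    generalize (ascPochhammer ℂ (m + 2 * q)).eval (ν + q + (-p - q) + m + 1) = A
    generalize hG : Complex.Gamma (ν - p + m + 1) = G at g3 ⊢
    generalize (Complex.Gamma (ν + q + m + 1))⁻¹ = H
    generalize (4 : ℂ) ^ (-ν) = E
    generalize (1 / τ) ^ (ν + 2 * q - p + 1) = T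
    generalize (1 / τ) ^ (2 * m) = S
    have : G⁻¹ * G = 1 := inv_mul_cancel₀ g3
    linear_combination (-1) * (E * Real.pi * A * H * S * T * (1 / 4) ^ (2 * m) *
      (-1 / 4 : ℂ) ^ ((q : ℤ) - p) * (m.factorial : ℂ)⁻¹ * (n.factorial : ℂ)⁻¹) * this +
      (E * Real.pi * A * H * S * T * (m.factorial : ℂ)⁻¹ * (n.factorial : ℂ)⁻¹) * g6 * (-1) *
        (G⁻¹ * G)
  · intro m hm
    -- For these `m` the diagonal has no `n ≥ 0`. The product series agrees because its reciprocal
    -- Gamma factor sits at a pole, where Mathlib's value `0` has inverse `0`.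
    have : Complex.Gamma (-(p : ℂ) - q + (2 * q : ℕ) + m + 1) = 0 := by
      rw [Complex.Gamma_eq_zero_iff]
      refine ⟨(-((m : ℤ) + (q - p) + 1)).toNat, ?_⟩
      have h : (((-((m : ℤ) + (q - p) + 1)).toNat : ℤ) : ℂ) = ((-((m : ℤ) + (q - p) + 1) : ℤ) : ℂ) := by
        rw [Int.toNat_of_nonneg (by omega)]
      rw [Int.cast_natCast] at h
      rw [h]
      push_cast
      ring
    rw [this]
    simp

theorem clifford_prefactor {a : ℂ} (ha : a ≠ 0) (q p j : ℤ) :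
    (-1 / 4 : ℂ) ^ (q - p) * (4 * a) ^ (2 * q - p + 1) * (a ^ 2) ^ (p + q - j) =
      (4 : ℂ) ^ (-q) * (4 * a) ^ (2 * q + 1) * (-1) ^ j * a ^ (q - j) * (-a) ^ (p + q - j) := by
  have e1 : (-1 / 4 : ℂ) = (-1) * (4 : ℂ)⁻¹ := by norm_num
  have e2 : (-a) = (-1) * a := by ring
  have e3 : (-1 : ℂ) ^ (q - p) = (-1) ^ j * (-1) ^ (p + q - j) := by
    rw [← zpow_add₀ (by norm_num), show q - p = (j + (p + q - j)) - 2 * p by ring,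
      zpow_sub₀ (by norm_num), zpow_mul]
    norm_num
  rw [e2, e1, mul_zpow, mul_zpow, mul_zpow, mul_zpow, e3, inv_zpow', ← zpow_natCast a 2,
    ← zpow_mul]
  have h4 : (4 : ℂ) ≠ 0 := by norm_num
  have e4 : (4 : ℂ) ^ (-(q - p)) * 4 ^ (2 * q - p + 1) = 4 ^ (-q) * 4 ^ (2 * q + 1) := by
    rw [← zpow_add₀ h4, ← zpow_add₀ h4]; congr 1; ring
  have e5 : a ^ (2 * q - p + 1) * a ^ (((2 : ℕ) : ℤ) * (p + q - j)) =
      a ^ (2 * q + 1) * a ^ (q - j) * a ^ (p + q - j) := by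
    rw [← zpow_add₀ ha, ← zpow_add₀ ha, ← zpow_add₀ ha]; congr 1; push_cast; ring
  linear_combination ((-1) ^ j * (-1) ^ (p + q - j) * a ^ (2 * q - p + 1) *
    a ^ (((2 : ℕ) : ℤ) * (p + q - j))) * e4 +
    ((-1) ^ j * (-1) ^ (p + q - j) * (4 : ℂ) ^ (-q) * 4 ^ (2 * q + 1)) * e5

/-- The Clifford factor of integral index is reflected to `p + q - j`, and the prefactors are
distributed by `clifford_prefactor`: one factor becomes `I_{ν+q-j}(2a)`, the other a Laurent
coefficient at `a`, with `a = 1/(4τ)`. -/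
theorem integral_besselJKernel_mul_gaussMonomial {ν τ : ℂ} (hre : ν.re = 0)
    (hν : ν ≠ 0) (hτ : 1 / 2 < τ.re) (p : ℤ) (q : ℕ) :
    ∫ u, besselJKernel ν p u * gaussMonomial q τ u =
      Real.pi * ((4 : ℂ) ^ (-q : ℤ) * (1 / τ) ^ (2 * q + 1)) *
        ∑ j ∈ Finset.range (2 * q + 1), ((2 * q).choose j : ℂ) * ((-1) ^ j *
          (besselI (ν + q - j) (1 / (2 * τ)) * laurentCoeff (p + q - j) (1 / (4 * τ)))) := by
  have hτ0 : τ ≠ 0 := ne_zero_of_re_pos (by linarith)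
  rw [integral_besselJKernel_mul_gaussMonomial_eq_clifford hre hν hτ, Finset.mul_sum,
    Finset.mul_sum]
  refine Finset.sum_congr rfl fun j _ => ?_
  set a := 1 / (4 * τ) with ha
  have ha0 : a ≠ 0 := one_div_ne_zero (mul_ne_zero (by norm_num) hτ0)
  have e4 : 1 / τ = 4 * a := by rw [ha]; field_simp
  have h0 := inv_four_mul_cpow hτ0 ν
  rw [← ha] at h0
  have h1 : 1 / (2 * τ) = 2 * a := by rw [ha]; field_simp; norm_num
  have h2 : clifford (-p - q + j) (a ^ 2) =
      (a ^ 2) ^ ((p : ℤ) + q - j) * clifford ((p + q - j : ℤ) : ℂ) (a ^ 2) := by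
    rw [← clifford_neg_intCast _ (pow_ne_zero 2 ha0)]; congr 1; push_cast; ring
  have h3 : a ^ (ν + q - j) = a ^ ν * a ^ ((q : ℤ) - j) := by
    rw [show ν + q - j = ν + (((q : ℤ) - j : ℤ) : ℂ) by push_cast; ring,
      Complex.cpow_add _ _ ha0, Complex.cpow_intCast]
  have h5 : (1 / τ) ^ (ν + 2 * q - p + 1) = (1 / τ) ^ ν * (1 / τ) ^ (2 * (q : ℤ) - p + 1) := by
    rw [show ν + 2 * q - p + 1 = ν + ((2 * (q : ℤ) - p + 1 : ℤ) : ℂ) by push_cast; ring,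
      Complex.cpow_add _ _ (one_div_ne_zero hτ0), Complex.cpow_intCast]
  have key := clifford_prefactor ha0 q p j
  have h6 : (4 * a : ℂ) ^ (2 * q + 1) = (4 * a) ^ (2 * (q : ℤ) + 1) := by
    rw [← zpow_natCast]; push_cast; rfl
  rw [h1, besselI_two_mul, h2, h3, h5, laurentCoeff, h0, e4, h6]
  rw [zpow_natCast (-1 : ℂ) j] at key
  linear_combination ((4 : ℂ) ^ (-ν) * (4 * a) ^ ν * Real.pi * ((2 * q).choose j : ℂ) *
    clifford (ν + q - j) (a ^ 2) * clifford ((p + q - j : ℤ) : ℂ) (a ^ 2)) * key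

theorem integrable_besselJKernel_mul_gaussMonomial {ν τ : ℂ} (hre : ν.re = 0)
    (hτ : 1 / 2 < τ.re) (p : ℤ) (q : ℕ) :
    Integrable fun u => besselJKernel ν p u * gaussMonomial q τ u := by
  obtain ⟨C, hC0, hC⟩ := exists_norm_inv_Gamma_le (max ‖ν - p‖ ‖ν + p‖)
  have hint := integrable_norm_rpow_mul_gaussian (r := (2 * q : ℕ)) (c := τ.re - 1 / 2)
      (by have : (0 : ℝ) ≤ (2 * q : ℕ) := Nat.cast_nonneg _
          linarith) (by linarith)
  refine (hint.const_mul (C ^ 2)).mono' (aestronglyMeasurable_of_continuousOn_compl_zero ?_) ?_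
  · refine ContinuousOn.mul ?_ (continuous_gaussMonomial q τ).continuousOn
    exact (continuousOn_besselJKernel p).comp (f := fun u : ℂ => (ν, u)) (by fun_prop)
      fun u hu => hu
  · filter_upwards [ae_ne_zero] with u hu
    have hn : 0 < ‖u‖ := norm_pos_iff.2 hu
    have g1 := norm_clifford_le hC (le_max_left ‖ν - p‖ ‖ν + p‖) (-(u / 2) ^ 2)
    have g2 := norm_clifford_le hC (le_max_right ‖ν - p‖ ‖ν + p‖) (-((starRingEnd ℂ) u / 2) ^ 2)
    have e1 : ‖((‖u / 2‖ : ℝ) : ℂ) ^ (2 * ν)‖ = 1 := by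
      rw [Complex.norm_cpow_eq_rpow_re_of_pos (by rw [norm_div]; exact div_pos hn (by norm_num))]
      simp [hre]
    have e2 : ‖(u / ((‖u‖ : ℝ) : ℂ)) ^ (-2 * p)‖ = 1 := by
      rw [norm_zpow, norm_div, Complex.norm_real, norm_norm, div_self hn.ne', one_zpow]
    have e3 : ‖-(u / 2) ^ 2‖ = ‖u‖ ^ 2 / 4 := by
      rw [norm_neg, norm_pow, norm_div, Complex.norm_ofNat]; ring
    have e4 : ‖-((starRingEnd ℂ) u / 2) ^ 2‖ = ‖u‖ ^ 2 / 4 := by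
      rw [norm_neg, norm_pow, norm_div, Complex.norm_ofNat, RCLike.norm_conj]; ring
    rw [e3] at g1
    rw [e4] at g2
    rw [norm_mul, norm_gaussMonomial, besselJKernel, besselJStar_eq_clifford,
      besselJStar_eq_clifford, norm_mul, norm_mul, norm_mul, e1, e2]
    calc _ ≤ 1 * 1 * (Real.exp (‖u‖ ^ 2 / 4) * C) * (Real.exp (‖u‖ ^ 2 / 4) * C) *
          (‖u‖ ^ (2 * q) * Real.exp (-τ.re * ‖u‖ ^ 2)) := by gcongr
      _ = _ := by
        rw [Real.rpow_natCast, Real.rpow_two, show -(τ.re - 1 / 2) * ‖u‖ ^ 2 =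
          ‖u‖ ^ 2 / 4 + ‖u‖ ^ 2 / 4 + -τ.re * ‖u‖ ^ 2 by ring, Real.exp_add, Real.exp_add]
        ring

/-- The Bessel transform of an even monomial times a Gaussian. -/
theorem integral_besselK_mul_gaussMonomial {ν τ : ℂ} (hre : ν.re = 0)
    (hν : ν ≠ 0) (hτ : 1 / 2 < τ.re) (p : ℤ) (q : ℕ) :
    ∫ u, besselK ν p u * gaussMonomial q τ u =
      2 * (-1) ^ q * ((4 : ℂ) ^ (-q : ℤ) * (1 / τ) ^ (2 * q + 1)) *
        ∑ j ∈ Finset.range (2 * q + 1), ((2 * q).choose j : ℂ) *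
          (macdonald (ν + (q - j : ℤ)) (1 / (2 * τ)) *
            laurentCoeff (p + (q - j : ℤ)) (1 / (4 * τ))) := by
  have hτ0 : τ ≠ 0 := ne_zero_of_re_pos (by linarith)
  have hsin : Complex.sin (Real.pi * ν) ≠ 0 := fun h => by
    obtain ⟨n, rfl⟩ := (sin_pi_mul_eq_zero_iff ν).1 h
    simp only [Complex.intCast_re] at hre
    exact hν (by exact_mod_cast hre)
  have hy : 0 < (1 / (2 * τ)).re := by
    rw [one_div, Complex.inv_re]
    refine div_pos ?_ (Complex.normSq_pos.2 (mul_ne_zero two_ne_zero hτ0))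
    simpa using by linarith
  have ha0 : 1 / (4 * τ) ≠ 0 := one_div_ne_zero (mul_ne_zero (by norm_num) hτ0)
  have e : ∀ u, besselK ν p u * gaussMonomial q τ u = (Complex.sin (Real.pi * ν))⁻¹ *
      (besselJKernel (-ν) (-p) u * gaussMonomial q τ u -
        besselJKernel ν p u * gaussMonomial q τ u) := by
    intro u
    rw [besselK_of_sin_ne_zero hsin, besselKQuotient]
    ring
  have hre' : (-ν).re = 0 := by simp [hre]
  simp only [e]
  -- In the sum for `(-ν, -p)` the index is reflected to `2q - j`. Its `I`-index is then `-(ν + q -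
  -- j)`, its Laurent coefficient is the common one by evenness, and the difference of `I`'s is a
  -- Macdonald function.
  rw [integral_const_mul, integral_sub (integrable_besselJKernel_mul_gaussMonomial hre' hτ _ _)
    (integrable_besselJKernel_mul_gaussMonomial hre hτ _ _),
    integral_besselJKernel_mul_gaussMonomial hre hν hτ,
    integral_besselJKernel_mul_gaussMonomial hre' (neg_ne_zero.2 hν) hτ,
    ← Finset.sum_range_reflect (n := 2 * q + 1), ← mul_sub, ← Finset.sum_sub_distrib,
    Finset.mul_sum, Finset.mul_sum, Finset.mul_sum]
  refine Finset.sum_congr rfl fun j hj => ?_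
  have hj : j ≤ 2 * q := Nat.lt_succ_iff.1 (Finset.mem_range.1 hj)
  rw [show 2 * q + 1 - 1 - j = 2 * q - j by omega, Nat.choose_symm hj,
    macdonald_eq_besselI hre hν hy]
  have hc : ((2 * q - j : ℕ) : ℂ) = 2 * q - j := by push_cast [Nat.cast_sub hj]; ring
  have hz : ((2 * q - j : ℕ) : ℤ) = 2 * q - j := by push_cast [Nat.cast_sub hj]; ring
  have s1 : (-1 : ℂ) ^ (2 * q - j) = (-1) ^ j := by
    have h : (-1 : ℂ) ^ (2 * q - j) * (-1) ^ j = 1 := by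
      rw [← pow_add, Nat.sub_add_cancel hj, pow_mul]; norm_num
    have h' : (-1 : ℂ) ^ j * (-1) ^ j = 1 := by rw [← mul_pow]; norm_num
    exact mul_right_cancel₀ (pow_ne_zero j (by norm_num)) (h.trans h'.symm)
  have s2 : (-1 : ℂ) ^ ((q : ℤ) - j) = (-1) ^ q * (-1) ^ j := by
    have h' : (-1 : ℂ) ^ j * (-1) ^ j = 1 := by rw [← mul_pow]; norm_num
    rw [zpow_sub₀ (by norm_num), zpow_natCast, zpow_natCast, div_eq_iff (pow_ne_zero j (by norm_num)),
      mul_assoc, h', mul_one]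
  have s3 : (-1 : ℂ) ^ q * (-1) ^ q = 1 := by rw [← mul_pow]; norm_num
  have b1 : -ν + q - ((2 * q - j : ℕ) : ℂ) = -(ν + ((q - j : ℤ) : ℂ)) := by
    rw [hc]; push_cast; ring
  have b2 : ν + q - (j : ℂ) = ν + ((q - j : ℤ) : ℂ) := by push_cast; ring
  have b3 : laurentCoeff (-p + q - ((2 * q - j : ℕ) : ℤ)) (1 / (4 * τ)) =
      laurentCoeff (p + (q - j)) (1 / (4 * τ)) := by
    rw [hz, ← laurentCoeff_neg _ ha0]; congr 1; ring
  have b4 : p + q - (j : ℤ) = p + (q - j) := by ring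
  rw [b1, b2, b3, b4, s1, s2]
  generalize besselI (-(ν + ((q - j : ℤ) : ℂ))) (1 / (2 * τ)) = A
  generalize besselI ((ν + ((q - j : ℤ) : ℂ))) (1 / (2 * τ)) = B
  generalize laurentCoeff (p + (q - j)) (1 / (4 * τ)) = D
  have hk : (Real.pi : ℂ) / (2 * Complex.sin (Real.pi * ν)) =
      Real.pi * (Complex.sin (Real.pi * ν))⁻¹ / 2 := by field_simp
  rw [hk]
  linear_combination (-1) * (Real.pi * ((4 : ℂ) ^ (-q : ℤ) * (1 / τ) ^ (2 * q + 1)) *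
    ((2 * q).choose j : ℂ) * (-1) ^ j * (Complex.sin (Real.pi * ν))⁻¹ * (A - B) * D) * s3

end

/-! ### Laurent coefficients of `exp(-a(z + 1/z))` -/

noncomputable section
open MeasureTheory Filter Topology

/-- The product of the series of `exp(-az)` and `exp(-a/z)`, with the terms collected by the
difference `N` of the exponents. For negative `N` the index `n` must be at least `-N`; the missing
terms match the poles of `Γ`. -/
theorem hasSum_laurentCoeff {a z : ℂ} (ha : a ≠ 0) (hz : z ≠ 0) :
    HasSum (fun N : ℤ => laurentCoeff N a * z ^ N) (Complex.exp (-a * (z + z⁻¹))) := by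
  have hexp : ∀ w : ℂ, HasSum (fun m : ℕ => w ^ m / (m.factorial : ℂ)) (Complex.exp w) := fun w => by
    rw [Complex.exp_eq_exp_ℂ]; exact NormedSpace.expSeries_div_hasSum_exp w
  have hexpn : ∀ w : ℂ, Summable fun m : ℕ => ‖w ^ m / (m.factorial : ℂ)‖ := fun w =>
    NormedSpace.norm_expSeries_div_summable w
  set F : ℕ × ℕ → ℂ := fun x =>
    (-a * z) ^ x.1 / (x.1.factorial : ℂ) * ((-a * z⁻¹) ^ x.2 / (x.2.factorial : ℂ)) with hF
  have hS : Summable F := summable_mul_of_summable_norm (f := fun m : ℕ =>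
    (-a * z) ^ m / (m.factorial : ℂ)) (g := fun m : ℕ => (-a * z⁻¹) ^ m / (m.factorial : ℂ))
    (hexpn _) (hexpn _)
  have hFs : HasSum F (Complex.exp (-a * (z + z⁻¹))) := by
    have := (hexp (-a * z)).mul (hexp (-a * z⁻¹)) hS
    rw [← Complex.exp_add, ← mul_add] at this
    exact this
  refine (hFs.tsum_fiberwise fun x : ℕ × ℕ => (x.1 : ℤ) - x.2).of_forall_eq fun N => ?_
  rw [tsum_subtype]
  have hI := (hS.indicator ((fun x : ℕ × ℕ => (x.1 : ℤ) - x.2) ⁻¹' {N})).hasSum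
  suffices h1 : HasSum (fun n : ℕ => (-a) ^ N * z ^ N * ((a ^ 2) ^ n / (n.factorial : ℂ) *
      (Complex.Gamma (N + n + 1))⁻¹)) (∑' x, ((fun x : ℕ × ℕ => (x.1 : ℤ) - x.2) ⁻¹' {N}).indicator
        F x) by
    refine HasSum.unique ?_ h1
    have := ((summable_clifford N (a ^ 2)).hasSum.mul_left ((-a) ^ N * z ^ N))
    rw [laurentCoeff, mul_right_comm]
    exact this
  · refine ((Equiv.prodComm ℕ ℕ).hasSum_iff.2 hI).of_diagonal N ?_ ?_ ?_
    · rintro ⟨n, m⟩ h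
      refine Set.indicator_of_notMem ?_ _
      simp only [Equiv.prodComm_apply, Prod.swap_prod_mk, Set.mem_preimage, Set.mem_singleton_iff]
      simp only at h
      omega
    · intro n m h
      have hmem : ((m, n) : ℕ × ℕ) ∈ (fun x : ℕ × ℕ => (x.1 : ℤ) - x.2) ⁻¹' {N} := by
        simp only [Set.mem_preimage, Set.mem_singleton_iff]; omega
      simp only [Function.comp, Equiv.prodComm_apply, Prod.swap_prod_mk]
      rw [Set.indicator_of_mem hmem]
      have g1 : Complex.Gamma (N + n + 1) = m.factorial := by
        rw [← Complex.Gamma_nat_eq_factorial]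
        congr 2
        have : N + n = (m : ℤ) := by omega
        exact_mod_cast congrArg (Int.cast : ℤ → ℂ) this
      have g2 : (-a) ^ m = (-a) ^ N * (-a) ^ n := by
        rw [← zpow_natCast, ← zpow_natCast, ← zpow_add₀ (neg_ne_zero.2 ha)]; congr 1; omega
      have g3 : z ^ m * (z⁻¹) ^ n = z ^ N := by
        rw [inv_pow, ← zpow_natCast, ← zpow_natCast, ← zpow_neg, ← zpow_add₀ hz]; congr 1
      have g4 : (a ^ 2) ^ n = (-a) ^ n * (-a) ^ n := by rw [← mul_pow]; congr 1; ring
      simp only [hF]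
      rw [g1, mul_pow, mul_pow, g2, ← g3, g4]
      ring
    · intro n h
      have : Complex.Gamma (N + n + 1) = 0 := by
        rw [Complex.Gamma_eq_zero_iff]
        refine ⟨(-(N + n + 1)).toNat, ?_⟩
        have h : (((-(N + n + 1)).toNat : ℤ) : ℂ) = ((-(N + n + 1) : ℤ) : ℂ) := by
          rw [Int.toNat_of_nonneg (by omega)]
        rw [Int.cast_natCast] at h
        rw [h]; push_cast; ring
      rw [this]; simp

theorem summable_norm_laurentCoeff {a : ℂ} (ha : a ≠ 0) : Summable fun N : ℤ => ‖laurentCoeff N a‖ := by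
  simpa using (hasSum_laurentCoeff ha one_ne_zero).summable.norm

/-- The Laurent coefficients decay rapidly. -/
theorem exists_norm_laurentCoeff_le {a : ℂ} (ha : a ≠ 0) (m : ℤ) (k : ℕ) :
    ∃ C : ℝ, 0 ≤ C ∧ ∀ p : ℤ, (1 + |(p : ℝ)|) ^ k * ‖laurentCoeff (p + m) a‖ ≤ C := by
  -- Convergence of the Laurent series at `z = 2` gives exponential decay, which beats every power
  -- of `p`.
  obtain ⟨A, hA⟩ : ∃ A : ℝ, ∀ N : ℕ, ‖laurentCoeff (N : ℤ) a‖ * 2 ^ N ≤ A := by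
    have := (hasSum_laurentCoeff ha (two_ne_zero (α := ℂ))).summable.norm
    refine ⟨∑' N : ℤ, ‖laurentCoeff N a * 2 ^ N‖, fun N => ?_⟩
    have h := this.le_tsum (N : ℤ) fun _ _ => norm_nonneg _
    simpa using h
  obtain ⟨B, hB⟩ : ∃ B : ℝ, ∀ N : ℕ, (2 + |(m : ℝ)| + N) ^ k / 2 ^ N ≤ B := by
    have h1 : Tendsto (fun N : ℕ => ((N : ℝ) ^ k / 2 ^ N)) atTop (𝓝 0) :=
      tendsto_pow_const_div_const_pow_of_one_lt k one_lt_two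
    obtain ⟨B, hB⟩ := h1.bddAbove_range
    refine ⟨(3 + |(m : ℝ)|) ^ k * max B 1, fun N => ?_⟩
    have hB' : (N : ℝ) ^ k / 2 ^ N ≤ B := hB ⟨N, rfl⟩
    rcases Nat.eq_zero_or_pos N with rfl | hN
    · simp only [Nat.cast_zero, add_zero, pow_zero, div_one]
      calc (2 + |(m : ℝ)|) ^ k ≤ (3 + |(m : ℝ)|) ^ k * 1 := by
            rw [mul_one]; gcongr; norm_num
        _ ≤ _ := by gcongr; exact le_max_right _ _
    · have hN1 : (1 : ℝ) ≤ N := by exact_mod_cast hN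
      calc (2 + |(m : ℝ)| + N) ^ k / 2 ^ N ≤ ((3 + |(m : ℝ)|) * N) ^ k / 2 ^ N := by
            gcongr
            nlinarith [abs_nonneg (m : ℝ)]
        _ = (3 + |(m : ℝ)|) ^ k * ((N : ℝ) ^ k / 2 ^ N) := by rw [mul_pow]; ring
        _ ≤ _ := by gcongr; exact hB'.trans (le_max_left _ _)
  have hA0 : 0 ≤ A := le_trans (by positivity) (hA 0)
  have hB0 : 0 ≤ B := le_trans (by positivity) (hB 0)
  refine ⟨B * A, by positivity, fun p => ?_⟩
  obtain ⟨N, hN⟩ : ∃ N : ℕ, |p + m| = N := ⟨(p + m).natAbs, Int.abs_eq_natAbs _⟩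
  have hlc : ‖laurentCoeff (p + m) a‖ = ‖laurentCoeff (N : ℤ) a‖ := by
    rw [← hN]
    rcases abs_choice (p + m) with h | h <;> rw [h]
    rw [laurentCoeff_neg _ ha]
  have hp : |(p : ℝ)| ≤ |(m : ℝ)| + N := by
    have h1 : |(p : ℝ) + m| = N := by exact_mod_cast congrArg (Int.cast : ℤ → ℝ) hN
    calc |(p : ℝ)| = |((p : ℝ) + m) - m| := by ring_nf
      _ ≤ |(p : ℝ) + m| + |(m : ℝ)| := abs_sub _ _
      _ = _ := by rw [h1]; ring
  rw [hlc]
  calc (1 + |(p : ℝ)|) ^ k * ‖laurentCoeff (N : ℤ) a‖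
      ≤ (2 + |(m : ℝ)| + N) ^ k * ‖laurentCoeff (N : ℤ) a‖ :=
        mul_le_mul_of_nonneg_right (pow_le_pow_left₀ (by positivity) (by linarith) _)
          (norm_nonneg _)
    _ = ((2 + |(m : ℝ)| + N) ^ k / 2 ^ N) * (‖laurentCoeff (N : ℤ) a‖ * 2 ^ N) := by field_simp
    _ ≤ B * A := by gcongr; exacts [hB N, hA N]

theorem integral_exp_two_mul_I (k : ℤ) :
    ∫ φ in Set.Ioo (0 : ℝ) Real.pi, Complex.exp (2 * k * φ * Complex.I) =
      if k = 0 then (Real.pi : ℂ) else 0 := by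
  rw [← integral_Ioc_eq_integral_Ioo, ← intervalIntegral.integral_of_le Real.pi_pos.le]
  split_ifs with h
  · subst h
    simp
  · have hl : (k : ℂ) ≠ 0 := by exact_mod_cast h
    have := integral_exp_mul_complex (a := 0) (b := Real.pi)
      (c := 2 * k * Complex.I) (mul_ne_zero (mul_ne_zero two_ne_zero hl) Complex.I_ne_zero)
    have e : ∀ θ : ℝ, Complex.exp (2 * k * θ * Complex.I) = Complex.exp (2 * k * Complex.I * θ) := by
      intro θ; congr 1; ring
    simp only [e]
    rw [this, div_eq_zero_iff]
    left
    rw [sub_eq_zero, Complex.exp_eq_exp_iff_exists_int]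
    exact ⟨k, by push_cast; ring⟩

theorem norm_exp_int_mul_I (k : ℤ) (φ : ℝ) : ‖Complex.exp (2 * k * φ * Complex.I)‖ = 1 := by
  rw [show (2 * k * φ * Complex.I : ℂ) = ((2 * k * φ : ℝ) : ℂ) * Complex.I by push_cast; ring,
    Complex.norm_exp_ofReal_mul_I]

theorem hasSum_laurentCoeff_mul_exp {a : ℂ} (ha : a ≠ 0) (m : ℤ) (φ : ℝ) :
    HasSum (fun p : ℤ => laurentCoeff (p + m) a * Complex.exp (2 * p * φ * Complex.I))
      (Complex.exp (2 * (-m : ℤ) * φ * Complex.I) * Complex.exp (-(2 * a) * Complex.cos (2 * φ))) := by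
  have h := hasSum_laurentCoeff ha (Complex.exp_ne_zero (2 * φ * Complex.I))
  rw [← (Equiv.addRight m).hasSum_iff] at h
  have h2 := h.mul_left (Complex.exp (2 * (-m : ℤ) * φ * Complex.I))
  have e : -a * (Complex.exp (2 * φ * Complex.I) + (Complex.exp (2 * φ * Complex.I))⁻¹) =
      -(2 * a) * Complex.cos (2 * φ) := by
    rw [Complex.cos, ← Complex.exp_neg, neg_mul]; ring_nf
  rw [e] at h2
  refine h2.of_forall_eq fun p => ?_
  simp only [Function.comp, Equiv.coe_addRight]
  rw [← Complex.exp_int_mul, mul_left_comm, ← Complex.exp_add]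
  congr 2
  push_cast; ring

/-- The Laurent coefficients as Fourier coefficients. -/
theorem integral_exp_mul_exp_cos {a : ℂ} (ha : a ≠ 0) (N : ℤ) :
    ∫ φ in Set.Ioo (0 : ℝ) Real.pi, Complex.exp (2 * (-N : ℤ) * φ * Complex.I) *
      Complex.exp (-(2 * a) * Complex.cos (2 * φ)) = Real.pi * laurentCoeff N a := by
  have h := hasSum_integral_of_summable_integral_norm
    (μ := volume.restrict (Set.Ioo (0 : ℝ) Real.pi))
    (F := fun (p : ℤ) (φ : ℝ) => laurentCoeff (p + N) a * Complex.exp (2 * p * φ * Complex.I))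
    (fun p => (Continuous.integrableOn_Icc (by fun_prop)).mono_set Set.Ioo_subset_Icc_self) ?_
  · have e : ∀ φ : ℝ, ∑' p : ℤ, laurentCoeff (p + N) a * Complex.exp (2 * p * φ * Complex.I) =
        Complex.exp (2 * (-N : ℤ) * φ * Complex.I) *
          Complex.exp (-(2 * a) * Complex.cos (2 * φ)) := fun φ =>
      (hasSum_laurentCoeff_mul_exp ha N φ).tsum_eq
    simp only [e, integral_const_mul, integral_exp_two_mul_I] at h
    refine h.unique ?_
    have := hasSum_single (f := fun p : ℤ => laurentCoeff (p + N) a *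
      if p = 0 then (Real.pi : ℂ) else 0) 0 (fun p hp => by simp [hp])
    simpa [mul_comm] using this
  · simp only [norm_mul, norm_exp_int_mul_I, mul_one]
    simp only [integral_const, smul_eq_mul]
    exact ((Equiv.addRight N).summable_iff.2 (summable_norm_laurentCoeff ha)).mul_left _

/-- Parseval's formula for the Laurent coefficients. -/
theorem hasSum_laurentCoeff_mul_laurentCoeff {a b : ℂ} (ha : a ≠ 0) (hb : b ≠ 0)
    (hab : a + b ≠ 0) (m n : ℤ) :
    HasSum (fun p : ℤ => laurentCoeff (p + m) a * laurentCoeff (p + n) b)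
      (laurentCoeff (m - n) (a + b)) := by
  set E : ℝ → ℂ := fun φ => Complex.exp (2 * (n : ℤ) * φ * Complex.I) *
    Complex.exp (-(2 * b) * Complex.cos (2 * φ)) with hE
  have hEc : Continuous E := by fun_prop
  obtain ⟨K, hK⟩ := isCompact_Icc.exists_bound_of_continuousOn (s := Set.Icc 0 Real.pi)
    hEc.continuousOn
  -- Evenness of the coefficients in their index allows frequency `+p` here, so the bilinear pairing
  -- needs no reflection of `p`.
  have hEi : ∀ p : ℤ, ∫ φ in Set.Ioo (0 : ℝ) Real.pi, Complex.exp (2 * p * φ * Complex.I) * E φ =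
      Real.pi * laurentCoeff (p + n) b := by
    intro p
    rw [← laurentCoeff_neg _ hb, ← integral_exp_mul_exp_cos hb]
    refine integral_congr_ae (Eventually.of_forall fun φ => ?_)
    simp only [hE]
    rw [← mul_assoc, ← Complex.exp_add]
    congr 2
    push_cast; ring
  have h := hasSum_integral_of_summable_integral_norm
    (μ := volume.restrict (Set.Ioo (0 : ℝ) Real.pi))
    (F := fun (p : ℤ) (φ : ℝ) => laurentCoeff (p + m) a *
      (Complex.exp (2 * p * φ * Complex.I) * E φ))
    (fun p => (Continuous.integrableOn_Icc (by fun_prop)).mono_set Set.Ioo_subset_Icc_self) ?_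
  · simp only [integral_const_mul, hEi] at h
    have e : ∀ φ : ℝ, ∑' p : ℤ, laurentCoeff (p + m) a *
        (Complex.exp (2 * p * φ * Complex.I) * E φ) =
        Complex.exp (2 * (-(m - n) : ℤ) * φ * Complex.I) *
          Complex.exp (-(2 * (a + b)) * Complex.cos (2 * φ)) := fun φ => by
      simp only [← mul_assoc]
      rw [tsum_mul_right, (hasSum_laurentCoeff_mul_exp ha m φ).tsum_eq, hE]
      simp only
      rw [← Complex.exp_add, ← Complex.exp_add, ← Complex.exp_add, ← Complex.exp_add]
      congr 1
      push_cast; ring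
    simp only [e] at h
    rw [integral_exp_mul_exp_cos hab] at h
    have hpi : (Real.pi : ℂ) ≠ 0 := by exact_mod_cast Real.pi_ne_zero
    have h2 := h.mul_left ((Real.pi : ℂ)⁻¹)
    rw [inv_mul_cancel_left₀ hpi] at h2
    refine h2.of_forall_eq fun p => ?_
    field_simp
  · have hs := ((Equiv.addRight m).summable_iff.2 (summable_norm_laurentCoeff ha)).mul_right
      (∫ φ in Set.Ioo (0 : ℝ) Real.pi, ‖E φ‖)
    refine hs.congr fun p => ?_
    simp only [norm_mul (laurentCoeff _ _), norm_mul (Complex.exp (2 * _ * _ * _)),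
      norm_exp_int_mul_I, one_mul]
    rw [integral_const_mul]
    rfl

end

/-! ### Parseval's formula on the line and on the cylinder -/

noncomputable section
open MeasureTheory Filter Topology FourierTransform

/-- For `μ = it + k` the dependence on `t` is the character `exp(2itx)`. On vertical lines the
Macdonald function therefore inherits continuity and Parseval's formula from the Fourier transform.
-/
theorem fourier_macdonaldKernel (k : ℤ) (y : ℂ) (t : ℝ) :
    macdonald (t * Complex.I + k) y = 𝓕 (macdonaldKernel k y) (-t / Real.pi) := by
  rw [Real.fourier_real_eq_integral_exp_smul, macdonald]
  refine integral_congr_ae (Eventually.of_forall fun x => ?_)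
  simp only [macdonaldKernel, smul_eq_mul]
  rw [← Complex.exp_add]
  congr 1
  have hpi : (Real.pi : ℂ) ≠ 0 := by exact_mod_cast Real.pi_ne_zero
  push_cast
  field_simp
  ring

theorem continuous_macdonald_line (k : ℤ) {y : ℂ} (hy : 0 < y.re) :
    Continuous fun t : ℝ => macdonald (t * Complex.I + k) y := by
  simp only [fourier_macdonaldKernel]
  have : Continuous (𝓕 (macdonaldKernel k y)) :=
    VectorFourier.fourierIntegral_continuous Real.continuous_fourierChar continuous_inner
      (integrable_macdonaldKernel k hy)
  exact this.comp (by fun_prop)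

/-- `macdonald` decays rapidly on vertical lines. -/
theorem exists_norm_macdonald_line_le (k : ℤ) {y : ℂ} (hy : 0 < y.re) (n : ℕ) :
    ∃ C : ℝ, 0 ≤ C ∧ ∀ t : ℝ, (1 + t ^ 2) ^ n * ‖macdonald (t * Complex.I + k) y‖ ≤ C := by
  obtain ⟨A, hA⟩ := exists_pow_mul_norm_macdonald_le hy 0 k
  obtain ⟨B, hB⟩ := exists_pow_mul_norm_macdonald_le hy (2 * n) k
  have hA0 := le_trans (by positivity) (hA 0)
  have hB0 := le_trans (by positivity) (hB 0)
  refine ⟨2 ^ n * (A + B), by positivity, fun t => ?_⟩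
  have hA := hA t
  have hB := hB t
  rw [pow_zero, one_mul] at hA
  rw [pow_mul, sq_abs] at hB
  have hk : ((t : ℂ) * Complex.I + ((k : ℝ) : ℂ)) = t * Complex.I + k := by push_cast; rfl
  rw [hk] at hA hB
  have h2 : (1 + t ^ 2) ^ n ≤ 2 ^ n * (1 + (t ^ 2) ^ n) := by
    rcases le_total (t ^ 2) 1 with h | h
    · calc (1 + t ^ 2) ^ n ≤ 2 ^ n := pow_le_pow_left₀ (by positivity) (by linarith) n
        _ ≤ _ := le_mul_of_one_le_right (by positivity) (by linarith [pow_nonneg (sq_nonneg t) n])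
    · calc (1 + t ^ 2) ^ n ≤ (2 * t ^ 2) ^ n := pow_le_pow_left₀ (by positivity) (by linarith) n
        _ = 2 ^ n * (t ^ 2) ^ n := mul_pow _ _ _
        _ ≤ _ := by gcongr; linarith
  calc _ ≤ 2 ^ n * (1 + (t ^ 2) ^ n) * ‖macdonald (t * Complex.I + k) y‖ := by gcongr
    _ = 2 ^ n * (‖macdonald (t * Complex.I + k) y‖ +
        (t ^ 2) ^ n * ‖macdonald (t * Complex.I + k) y‖) := by ring
    _ ≤ _ := by gcongr

theorem integrable_macdonald_line (k : ℤ) {y : ℂ} (hy : 0 < y.re) :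
    Integrable fun t : ℝ => macdonald (t * Complex.I + k) y := by
  obtain ⟨C, hC0, hC⟩ := exists_norm_macdonald_line_le k hy 1
  refine (integrable_inv_one_add_sq.const_mul C).mono'
    (continuous_macdonald_line k hy).aestronglyMeasurable (Eventually.of_forall fun t => ?_)
  have := hC t
  rw [pow_one] at this
  rw [← div_eq_mul_inv, le_div_iff₀ (by positivity), mul_comm]
  exact this

/-- The multiplication formula moves one transform onto the other factor, and applying the transform
twice is reflection. -/
theorem integral_fourier_mul_fourier {g h : ℝ → ℂ} (hg : Integrable g) (hh : Integrable h)
    (hc : Continuous h) (hh' : Integrable (𝓕 h)) :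
    ∫ ξ, 𝓕 g ξ * 𝓕 h ξ = ∫ x, g x * h (-x) := by
  have := VectorFourier.integral_fourierIntegral_smul_eq_flip (L := innerₗ ℝ)
    Real.continuous_fourierChar continuous_inner (μ := volume) (ν := volume) hg hh'
  have e : ∀ x, 𝓕 (𝓕 h) x = h (-x) := fun x => by
    have := congrFun (hc.fourierInv_fourier_eq hh hh') (-x)
    rw [Real.fourierInv_eq_fourier_neg, neg_neg] at this
    exact this
  simp only [smul_eq_mul, flip_innerₗ] at this
  refine Eq.trans this (integral_congr_ae (Eventually.of_forall fun x => ?_))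
  simp only [← e]
  rfl

theorem integrable_macdonald_mul_macdonald (k l : ℤ) {y z : ℂ} (hy : 0 < y.re) (hz : 0 < z.re) :
    Integrable fun t : ℝ => macdonald (t * Complex.I + k) y * macdonald (t * Complex.I + l) z := by
  obtain ⟨C, hC0, hC⟩ := exists_norm_macdonald_line_le k hy 0
  refine (integrable_macdonald_line l hz).bdd_mul
    (continuous_macdonald_line k hy).aestronglyMeasurable (c := C) (Eventually.of_forall fun t => ?_)
  simpa using hC t

/-- Parseval's formula for the Macdonald functions. -/
theorem integral_macdonald_mul_macdonald (k l : ℤ) {y z : ℂ} (hy : 0 < y.re) (hz : 0 < z.re) :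
    ∫ t : ℝ, macdonald (t * Complex.I + k) y * macdonald (t * Complex.I + l) z =
      Real.pi * macdonald ((k - l : ℤ) : ℂ) (y + z) := by
  have hF : Integrable (𝓕 (macdonaldKernel l z)) := by
    have h := (integrable_macdonald_line l hz).comp_mul_left' (R := -Real.pi)
      (neg_ne_zero.2 Real.pi_ne_zero)
    refine h.congr (Eventually.of_forall fun t => ?_)
    simp only [fourier_macdonaldKernel]
    field_simp
  have h := integral_fourier_mul_fourier (integrable_macdonaldKernel k hy)
    (integrable_macdonaldKernel l hz) (continuous_macdonaldKernel _ _) hF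
  have h2 := Measure.integral_comp_mul_left
    (fun ξ : ℝ => 𝓕 (macdonaldKernel k y) ξ * 𝓕 (macdonaldKernel l z) ξ) (-(Real.pi)⁻¹)
  rw [h] at h2
  have e : ∀ t : ℝ, -(Real.pi)⁻¹ * t = -t / Real.pi := fun t => by ring
  simp only [e, ← fourier_macdonaldKernel] at h2
  rw [h2, inv_neg, inv_inv, abs_neg, abs_of_pos Real.pi_pos, Complex.real_smul, macdonald]
  congr 1
  refine integral_congr_ae (Eventually.of_forall fun x => ?_)
  simp only [macdonaldKernel]
  rw [← Complex.exp_add]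
  congr 1
  push_cast
  rw [show 2 * -(x : ℂ) = -(2 * x) by ring, Complex.cosh_neg]
  ring

/-- The strip `0 < Im ζ < π`. -/
def strip : Set ℂ := {ζ | ζ.im ∈ Set.Ioo 0 Real.pi}

theorem strip_eq_preimage :
    strip = Complex.measurableEquivRealProd ⁻¹' (Set.univ ×ˢ Set.Ioo 0 Real.pi) := by
  ext ζ
  simp [strip, Complex.measurableEquivRealProd_apply]

theorem isOpen_strip : IsOpen strip := isOpen_Ioo.preimage Complex.continuous_im

theorem setIntegral_strip_mul (g h : ℝ → ℂ) :
    ∫ ζ in strip, g ζ.re * h ζ.im = (∫ x, g x) * ∫ φ in Set.Ioo 0 Real.pi, h φ := by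
  have := Complex.volume_preserving_equiv_real_prod.setIntegral_preimage_emb
    Complex.measurableEquivRealProd.measurableEmbedding (fun x : ℝ × ℝ => g x.1 * h x.2)
    (Set.univ ×ˢ Set.Ioo 0 Real.pi)
  rw [← strip_eq_preimage, Measure.volume_eq_prod, setIntegral_prod_mul, setIntegral_univ] at this
  exact this

theorem integrableOn_strip_mul {g h : ℝ → ℂ} (hg : Integrable g)
    (hh : IntegrableOn h (Set.Ioo 0 Real.pi)) :
    IntegrableOn (fun ζ : ℂ => g ζ.re * h ζ.im) strip := by
  have hp : IntegrableOn (fun x : ℝ × ℝ => g x.1 * h x.2) (Set.univ ×ˢ Set.Ioo 0 Real.pi) := by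
    rw [IntegrableOn, Measure.volume_eq_prod, ← Measure.prod_restrict, Measure.restrict_univ]
    exact hg.mul_prod hh
  rw [strip_eq_preimage]
  exact (Complex.volume_preserving_equiv_real_prod.integrableOn_comp_preimage
    Complex.measurableEquivRealProd.measurableEmbedding).2 hp

/-- Two-dimensional trigonometric kernels paired with their Fourier transforms against the weight
`exp (-a |2 cosh ζ|²)`. -/
def trigSpan (a : ℂ) : Submodule ℂ ((ℝ → ℤ → ℂ) × (ℂ → ℂ)) :=
  Submodule.span ℂ (Set.range fun k : ℤ × ℤ =>
    ((fun (t : ℝ) (p : ℤ) => macdonald (t * Complex.I + k.1) (2 * a) * laurentCoeff (p + k.2) a,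
      fun ζ : ℂ => Complex.exp (2 * k.1 * ζ.re) * Complex.exp (2 * (-k.2 : ℤ) * ζ.im * Complex.I)) :
      (ℝ → ℤ → ℂ) × (ℂ → ℂ)))

/-- The weight `exp (-a |2 cosh ζ|²)`. -/
def coshWeight (a ζ : ℂ) : ℂ :=
  Complex.exp (-(2 * a) * Complex.cosh (2 * ζ.re)) * Complex.exp (-(2 * a) * Complex.cos (2 * ζ.im))

/-- Summing and integrating `G` over `ℤ × ℝ` gives the integral of `H` over the strip. -/
def SumIntegralEq (G : ℝ → ℤ → ℂ) (H : ℂ → ℂ) : Prop :=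
  (∀ p, Integrable fun t => G t p) ∧ IntegrableOn H strip ∧
    HasSum (fun p => ∫ t, G t p) (∫ ζ in strip, H ζ)

theorem SumIntegralEq.add {G G' : ℝ → ℤ → ℂ} {H H' : ℂ → ℂ} (h : SumIntegralEq G H)
    (h' : SumIntegralEq G' H') :
    SumIntegralEq (fun t p => G t p + G' t p) (fun ζ => H ζ + H' ζ) := by
  refine ⟨fun p => (h.1 p).add (h'.1 p), h.2.1.add h'.2.1, ?_⟩
  rw [integral_add h.2.1 h'.2.1]
  exact (h.2.2.add h'.2.2).of_forall_eq fun p => integral_add (h.1 p) (h'.1 p)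

theorem SumIntegralEq.const_mul {G : ℝ → ℤ → ℂ} {H : ℂ → ℂ} (h : SumIntegralEq G H) (c : ℂ) :
    SumIntegralEq (fun t p => c * G t p) (fun ζ => c * H ζ) := by
  refine ⟨fun p => (h.1 p).const_mul c, Integrable.const_mul h.2.1 c, ?_⟩
  rw [integral_const_mul]
  exact (h.2.2.mul_left c).of_forall_eq fun p => integral_const_mul c _

theorem SumIntegralEq.congr {G G' : ℝ → ℤ → ℂ} {H H' : ℂ → ℂ} (h : SumIntegralEq G H)
    (hG : ∀ t p, G' t p = G t p) (hH : ∀ ζ, H' ζ = H ζ) : SumIntegralEq G' H' := by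
  obtain rfl : G' = G := funext fun t => funext (hG t)
  obtain rfl : H' = H := funext hH
  exact h

theorem sumIntegralEq_zero : SumIntegralEq (fun _ _ => 0) (fun _ => 0) :=
  ⟨fun _ => integrable_zero _ _ _, integrableOn_zero, by simp⟩

/-- The pairing statement for two elements of `trigSpan`. -/
def IsParsevalPair (A : ℂ) (X Y : (ℝ → ℤ → ℂ) × (ℂ → ℂ)) : Prop :=
  SumIntegralEq (fun t p => X.1 t p * Y.1 t p) (fun ζ => X.2 ζ * Y.2 (-ζ) * coshWeight A ζ)

/-- Variables separate on both sides: the `t`-integral and the `p`-sum on the left, real and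
imaginary part of `ζ` on the right. Each gives the classical bilinear formula, with index
differences and argument sum. Index differences, rather than sums, are the reason for `-ζ` in the
second function. -/
theorem isParsevalPair_basis {a b : ℂ} (ha : 0 < a.re) (hb : 0 < b.re) (k l : ℤ × ℤ) :
    IsParsevalPair (a + b)
      (fun (t : ℝ) (p : ℤ) => macdonald (t * Complex.I + k.1) (2 * a) * laurentCoeff (p + k.2) a,
      fun ζ : ℂ => Complex.exp (2 * k.1 * ζ.re) * Complex.exp (2 * (-k.2 : ℤ) * ζ.im * Complex.I))
      (fun (t : ℝ) (p : ℤ) => macdonald (t * Complex.I + l.1) (2 * b) * laurentCoeff (p + l.2) b,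
      fun ζ : ℂ => Complex.exp (2 * l.1 * ζ.re) *
        Complex.exp (2 * (-l.2 : ℤ) * ζ.im * Complex.I)) := by
  have ha0 := ne_zero_of_re_pos ha
  have hb0 := ne_zero_of_re_pos hb
  have hab : 0 < (a + b).re := by rw [Complex.add_re]; linarith
  have hab0 := ne_zero_of_re_pos hab
  have h2 : ∀ {c : ℂ}, 0 < c.re → 0 < (2 * c).re := fun h => by simpa using h
  have e1 : ∀ (t : ℝ) (p : ℤ), (macdonald (t * Complex.I + k.1) (2 * a) * laurentCoeff (p + k.2) a) *
      (macdonald (t * Complex.I + l.1) (2 * b) * laurentCoeff (p + l.2) b) =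
      (macdonald (t * Complex.I + k.1) (2 * a) * macdonald (t * Complex.I + l.1) (2 * b)) *
      (laurentCoeff (p + k.2) a * laurentCoeff (p + l.2) b) := fun t p => by ring
  have e2 : ∀ ζ : ℂ, (Complex.exp (2 * k.1 * ζ.re) *
      Complex.exp (2 * (-k.2 : ℤ) * ζ.im * Complex.I)) *
      (Complex.exp (2 * l.1 * (-ζ).re) * Complex.exp (2 * (-l.2 : ℤ) * (-ζ).im * Complex.I)) *
        coshWeight (a + b) ζ =
      macdonaldKernel ((k.1 - l.1 : ℤ) : ℂ) (2 * (a + b)) ζ.re *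
      (fun φ : ℝ => Complex.exp (2 * (-(k.2 - l.2) : ℤ) * φ * Complex.I) *
        Complex.exp (-(2 * (a + b)) * Complex.cos (2 * φ))) ζ.im := by
    intro ζ
    simp only [coshWeight, macdonaldKernel]
    simp only [← Complex.exp_add]
    congr 1
    push_cast [Complex.neg_re, Complex.neg_im]
    ring
  refine ⟨fun p => ?_, ?_, ?_⟩
  · simp only [e1]
    exact (integrable_macdonald_mul_macdonald _ _ (h2 ha) (h2 hb)).mul_const _
  · simp only [e2]
    exact integrableOn_strip_mul (integrable_macdonaldKernel _ (h2 hab))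
      (h := fun φ : ℝ => Complex.exp (2 * (-(k.2 - l.2) : ℤ) * φ * Complex.I) *
        Complex.exp (-(2 * (a + b)) * Complex.cos (2 * φ))) ((Continuous.integrableOn_Icc (by fun_prop)).mono_set Set.Ioo_subset_Icc_self)
  · simp only [e1, e2]
    rw [setIntegral_strip_mul (macdonaldKernel ((k.1 - l.1 : ℤ) : ℂ) (2 * (a + b)))
      (fun φ : ℝ => Complex.exp (2 * (-(k.2 - l.2) : ℤ) * φ * Complex.I) *
        Complex.exp (-(2 * (a + b)) * Complex.cos (2 * φ))), integral_exp_mul_exp_cos hab0]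
    simp only [integral_mul_const, integral_macdonald_mul_macdonald _ _ (h2 ha) (h2 hb)]
    rw [← mul_add, ← macdonald, ← mul_assoc, mul_comm (macdonald _ _) (Real.pi : ℂ)]
    exact (hasSum_laurentCoeff_mul_laurentCoeff ha0 hb0 hab0 _ _).mul_left _

/-- Parseval's formula on the cylinder. -/
theorem isParsevalPair_of_mem_trigSpan {a b : ℂ} (ha : 0 < a.re) (hb : 0 < b.re)
    {X Y : (ℝ → ℤ → ℂ) × (ℂ → ℂ)} (hX : X ∈ trigSpan a) (hY : Y ∈ trigSpan b) :
    IsParsevalPair (a + b) X Y := by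
  induction hX using Submodule.span_induction with
  | mem X hX =>
    obtain ⟨k, rfl⟩ := hX
    induction hY using Submodule.span_induction with
    | mem Y hY =>
      obtain ⟨l, rfl⟩ := hY
      exact isParsevalPair_basis ha hb k l
    | zero => exact sumIntegralEq_zero.congr (fun t p => by simp) fun ζ => by simp
    | add Y Z _ _ hY hZ =>
      exact (SumIntegralEq.add hY hZ).congr (fun t p => by simp [mul_add])
        fun ζ => by simp [mul_add, add_mul]
    | smul c Y _ hY =>
      refine (SumIntegralEq.const_mul hY c).congr (fun t p => ?_) fun ζ => ?_
      · simp only [Prod.smul_fst, Pi.smul_apply, smul_eq_mul]; ring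
      · simp only [Prod.smul_snd, Pi.smul_apply, smul_eq_mul]; ring
  | zero => exact sumIntegralEq_zero.congr (fun t p => by simp) fun ζ => by simp
  | add X Z _ _ hX hZ =>
    exact (SumIntegralEq.add hX hZ).congr (fun t p => by simp [add_mul])
      fun ζ => by simp [add_mul]
  | smul c X _ hX =>
    refine (SumIntegralEq.const_mul hX c).congr (fun t p => ?_) fun ζ => ?_
    · simp only [Prod.smul_fst, Pi.smul_apply, smul_eq_mul]; ring
    · simp only [Prod.smul_snd, Pi.smul_apply, smul_eq_mul]; ring

end

/-! ### The substitution `w = 2 cosh ζ` -/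

noncomputable section
open MeasureTheory Filter Topology

theorem det_smul_one_complex (c : ℂ) : (c • (1 : ℂ →L[ℝ] ℂ)).det = Complex.normSq c := by
  rw [← Algebra.norm_complex_apply, Algebra.norm_apply, ContinuousLinearMap.det]
  congr 1

theorem cosh_eq_cosh_iff {x y : ℂ} : Complex.cosh x = Complex.cosh y ↔
    ∃ k : ℤ, y = x - 2 * k * Real.pi * Complex.I ∨ y = -x - 2 * k * Real.pi * Complex.I := by
  rw [← Complex.cos_mul_I, ← Complex.cos_mul_I, Complex.cos_eq_cos_iff]
  refine exists_congr fun k => or_congr ⟨fun h => ?_, fun h => ?_⟩ ⟨fun h => ?_, fun h => ?_⟩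
  · linear_combination (-Complex.I) * h + (y - x) * Complex.I_sq
  · linear_combination Complex.I * h - 2 * k * Real.pi * Complex.I_sq
  · linear_combination (-Complex.I) * h + (y + x) * Complex.I_sq
  · linear_combination Complex.I * h - 2 * k * Real.pi * Complex.I_sq

/-- Equal values of `cosh` force equality up to sign modulo `2πi`; a strip of height `π` starting at
`0` leaves only equality. -/
theorem injOn_two_mul_cosh_strip : Set.InjOn (fun ζ : ℂ => 2 * Complex.cosh ζ) strip := by
  intro x hx y hy h
  obtain ⟨k, h | h⟩ := cosh_eq_cosh_iff.1 (mul_left_cancel₀ two_ne_zero h)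
  · have him := congrArg Complex.im h
    simp at him
    have hk : k = 0 := by
      have h1 : (k : ℝ) < 1 := by
        by_contra h1
        nlinarith [hx.2, hy.1, Real.pi_pos]
      have h2 : (-1 : ℝ) < k := by
        by_contra h2
        nlinarith [hx.1, hy.2, Real.pi_pos]
      have h1 : k < 1 := by exact_mod_cast h1
      have h2 : -1 < k := by exact_mod_cast h2
      omega
    subst hk
    simpa using h.symm
  · exfalso
    have him := congrArg Complex.im h
    simp at him
    have h1 : (k : ℝ) < 0 := by
      by_contra h1
      nlinarith [hx.1, hy.1, Real.pi_pos]
    have h2 : (-1 : ℝ) < k := by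
      by_contra h2
      nlinarith [hx.2, hy.2, Real.pi_pos]
    have h1 : k < 0 := by exact_mod_cast h1
    have h2 : -1 < k := by exact_mod_cast h2
    omega

/-- A preimage can be chosen with imaginary part in `(-π, π]`; the endpoint and `0` give real
values, and evenness of `cosh` moves a negative imaginary part into the strip. Only the real axis, a
null set, may be missed. -/
theorem mem_image_two_mul_cosh_strip {w : ℂ} (hw : w.im ≠ 0) :
    w ∈ (fun ζ : ℂ => 2 * Complex.cosh ζ) '' strip := by
  obtain ⟨z, hz⟩ := Complex.cos_surjective (w / 2)
  set ζ := Complex.log (Complex.exp (z * Complex.I)) with hζ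
  have hexp : Complex.exp ζ = Complex.exp (z * Complex.I) :=
    Complex.exp_log (Complex.exp_ne_zero _)
  have hcosh : 2 * Complex.cosh ζ = w := by
    rw [Complex.cosh, Complex.exp_neg, hexp, ← Complex.exp_neg, ← Complex.cosh]
    have : Complex.cosh (z * Complex.I) = w / 2 := by rw [← hz, Complex.cosh_mul_I]
    rw [this]; ring
  have h1 : -Real.pi < ζ.im := Complex.neg_pi_lt_log_im _
  have h2 : ζ.im ≤ Real.pi := Complex.log_im_le_pi _
  have him : w.im = 2 * (Real.sinh ζ.re * Real.sin ζ.im) := by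
    rw [← hcosh]
    have : ζ = (ζ.re : ℂ) + (ζ.im : ℂ) * Complex.I := (Complex.re_add_im ζ).symm
    conv_lhs => rw [this, Complex.cosh_add, Complex.cosh_mul_I, Complex.sinh_mul_I]
    rw [← Complex.ofReal_cosh, ← Complex.ofReal_sinh, ← Complex.ofReal_cos, ← Complex.ofReal_sin]
    simp [Complex.sinh_ofReal_re, Complex.sin_ofReal_re]
  have h3 : ζ.im ≠ Real.pi := fun h => hw (by rw [him, h]; simp)
  rcases lt_trichotomy ζ.im 0 with h | h | h
  · exact ⟨-ζ, ⟨by simpa using h, by simpa using by linarith⟩, by simpa using hcosh⟩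
  · exact absurd (by rw [him, h]; simp) hw
  · exact ⟨ζ, ⟨h, lt_of_le_of_ne h2 h3⟩, hcosh⟩

theorem ae_im_ne_zero : ∀ᵐ w : ℂ, w.im ≠ 0 := by
  have h := Measure.addHaar_submodule (volume : Measure ℂ) (LinearMap.ker Complex.imLm) (by
    intro h
    have : Complex.I ∈ LinearMap.ker Complex.imLm := h ▸ Submodule.mem_top
    simp at this)
  refine ae_iff.2 (measure_mono_null ?_ h)
  intro w hw
  simpa using hw

/-- The Joukowski change of variables `w = 2 cosh ζ`. -/
theorem setIntegral_strip_cosh (H : ℂ → ℂ) :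
    ∫ ζ in strip, ((Complex.normSq (2 * Complex.sinh ζ) : ℝ) : ℂ) * H (2 * Complex.cosh ζ) =
      ∫ w, H w := by
  have hd : ∀ ζ ∈ strip, HasFDerivWithinAt (fun ζ : ℂ => 2 * Complex.cosh ζ)
      ((2 * Complex.sinh ζ) • (1 : ℂ →L[ℝ] ℂ)) strip ζ := fun ζ _ =>
    (((Complex.hasDerivAt_cosh ζ).const_mul 2).complexToReal_fderiv).hasFDerivWithinAt
  have h := integral_image_eq_integral_abs_det_fderiv_smul volume isOpen_strip.measurableSet hd
    injOn_two_mul_cosh_strip H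
  have huniv : ((fun ζ : ℂ => 2 * Complex.cosh ζ) '' strip : Set ℂ) =ᵐ[volume] Set.univ :=
    eventuallyEq_univ.2 (by
      filter_upwards [ae_im_ne_zero] with w hw using mem_image_two_mul_cosh_strip hw)
  rw [setIntegral_congr_set huniv, setIntegral_univ] at h
  rw [h]
  refine integral_congr_ae (Eventually.of_forall fun ζ => ?_)
  simp only
  rw [det_smul_one_complex, abs_of_nonneg (Complex.normSq_nonneg _), Complex.real_smul]

/-- The moments of a Gaussian on the plane, in terms of `w` and its conjugate. -/
theorem integral_conj_pow_mul_pow_mul_gaussian {A : ℂ} (hA : 0 < A.re) (m n : ℕ) :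
    ∫ w : ℂ, (starRingEnd ℂ) w ^ m * w ^ n * Complex.exp (-A * ((‖w‖ : ℝ) : ℂ) ^ 2) =
      if m = n then Real.pi * ((m.factorial : ℂ) / A ^ (m + 1)) else 0 := by
  have h := integral_norm_cpow_mul_zpow_mul_gaussian (s := (m + n) / 2) (τ := A) (by
    have h1 : (0 : ℝ) ≤ m := m.cast_nonneg
    have h2 : (0 : ℝ) ≤ n := n.cast_nonneg
    have : (((m : ℂ) + n) / 2).re = ((m : ℝ) + n) / 2 := by
      rw [show ((m : ℂ) + n) / 2 = (((m : ℝ) + n) / 2 : ℝ) by push_cast; rfl, Complex.ofReal_re]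
    rw [this]
    linarith) hA ((n : ℤ) - m)
  have e : (∫ w : ℂ, (starRingEnd ℂ) w ^ m * w ^ n * Complex.exp (-A * ((‖w‖ : ℝ) : ℂ) ^ 2)) =
      ∫ u : ℂ, ((‖u‖ : ℝ) : ℂ) ^ (2 * (((m : ℂ) + n) / 2)) *
        (u / ((‖u‖ : ℝ) : ℂ)) ^ ((n : ℤ) - m) * Complex.exp (-A * ((‖u‖ : ℝ) : ℂ) ^ 2) := by
    refine integral_congr_ae ?_
    filter_upwards [ae_ne_zero] with u hu
    have hn' : ((‖u‖ : ℝ) : ℂ) ≠ 0 := by simpa using hu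
    have hw0 := div_ne_zero hu hn'
    have hu' : u ^ n = ((‖u‖ : ℝ) : ℂ) ^ n * (u / ((‖u‖ : ℝ) : ℂ)) ^ n := by
      rw [← mul_pow, mul_div_cancel₀ _ hn']
    rw [conj_eq_norm_mul_inv hu, hu', mul_div_cancel₀ _ two_ne_zero, ← Nat.cast_add,
      Complex.cpow_natCast, zpow_sub₀ hw0, zpow_natCast, zpow_natCast, mul_pow, inv_pow, pow_add]
    field_simp
  rw [e, h]
  by_cases hmn : m = n
  · subst hmn
    rw [if_pos (by ring), if_pos rfl, show ((m : ℂ) + m) / 2 = m by ring,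
      Complex.Gamma_nat_eq_factorial, ← Nat.cast_succ, Complex.cpow_natCast, one_div, inv_pow, Nat.succ_eq_add_one]
    ring
  · rw [if_neg (by omega), if_neg hmn]

/-- Rests on `|2 cosh ζ|² = 2 cosh(2 Re ζ) + 2 cos(2 Im ζ)`: the product of the Macdonald weight and
the circle weight is a Gaussian in `w = 2 cosh ζ`. -/
theorem normSq_two_mul_cosh (ζ A : ℂ) :
    coshWeight A ζ = Complex.exp (-A * ((‖2 * Complex.cosh ζ‖ : ℝ) : ℂ) ^ 2) := by
  have h : ((‖2 * Complex.cosh ζ‖ : ℝ) : ℂ) ^ 2 =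
      2 * Complex.cosh (2 * ζ.re) + 2 * Complex.cos (2 * ζ.im) := by
    rw [← Complex.ofReal_pow, ← Complex.normSq_eq_norm_sq, ← Complex.mul_conj, map_mul,
      ← Complex.cosh_conj]
    have h1 : Complex.exp (2 * ζ.re) = Complex.exp ζ * Complex.exp ((starRingEnd ℂ) ζ) := by
      rw [← Complex.exp_add, Complex.add_conj]; push_cast; rfl
    have h2 : Complex.exp (2 * ζ.im * Complex.I) = Complex.exp ζ * (Complex.exp ((starRingEnd ℂ) ζ))⁻¹ := by
      rw [← Complex.exp_neg, ← Complex.exp_add, ← sub_eq_add_neg, Complex.sub_conj]; push_cast; rfl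
    rw [Complex.cosh, Complex.cosh, Complex.cosh, Complex.cos, neg_mul, Complex.exp_neg,
      Complex.exp_neg, Complex.exp_neg, Complex.exp_neg, h1, h2]
    have hc := Complex.exp_ne_zero ζ
    have hd := Complex.exp_ne_zero ((starRingEnd ℂ) ζ)
    simp only [map_ofNat]
    field_simp
    ring
  rw [coshWeight, ← Complex.exp_add, h]
  congr 1
  ring

end

/-! ### Multiplication by `p ∓ it` as differentiation on the cylinder -/

noncomputable section
open MeasureTheory Filter Topology

theorem laurentCoeff_recurrence (N : ℤ) {a : ℂ} (ha : a ≠ 0) :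
    N * laurentCoeff N a = -a * (laurentCoeff (N - 1) a - laurentCoeff (N + 1) a) := by
  have h := clifford_recurrence N (a ^ 2)
  have ha' : -a ≠ 0 := neg_ne_zero.2 ha
  simp only [laurentCoeff]
  push_cast
  rw [h, zpow_sub_one₀ ha', zpow_add_one₀ ha']
  field_simp
  ring

/-- The function of `(t, p)` giving the Bessel transforms of monomials times Gaussians. -/
def cylSum (q : ℕ) (a : ℂ) (t : ℝ) (p : ℤ) : ℂ :=
  ∑ j ∈ Finset.range (2 * q + 1), ((2 * q).choose j : ℂ) *
    (macdonald (t * Complex.I + (q - j : ℤ)) (2 * a) * laurentCoeff (p + (q - j : ℤ)) a)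

/-- The generators of `trigSpan`. -/
def trigBasis (a : ℂ) (k m : ℤ) : (ℝ → ℤ → ℂ) × (ℂ → ℂ) :=
  (fun (t : ℝ) (p : ℤ) => macdonald (t * Complex.I + k) (2 * a) * laurentCoeff (p + m) a,
      fun ζ : ℂ => Complex.exp (2 * k * ζ.re) * Complex.exp (2 * (-m : ℤ) * ζ.im * Complex.I))

theorem trigBasis_mem (a : ℂ) (k m : ℤ) : trigBasis a k m ∈ trigSpan a :=
  Submodule.subset_span ⟨(k, m), rfl⟩

/-- In terms of the exponentials of `ζ` and of its conjugate, the generators with `k = m` are powers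
of the latter alone. Hence `cylSum` belongs to `conj(2 cosh ζ)^(2q)`. -/
theorem trigBasis_snd (a : ℂ) (k m : ℤ) (ζ : ℂ) : (trigBasis a k m).2 ζ =
    (Complex.exp ζ * Complex.exp ((starRingEnd ℂ) ζ)) ^ k *
      (Complex.exp ((starRingEnd ℂ) ζ) / Complex.exp ζ) ^ m := by
  simp only [trigBasis]
  rw [← Complex.exp_add ζ, ← Complex.exp_sub, ← Complex.exp_int_mul,
    ← Complex.exp_int_mul, ← Complex.exp_add, ← Complex.exp_add, Complex.add_conj,
    show (starRingEnd ℂ) ζ - ζ = -(ζ - (starRingEnd ℂ) ζ) by ring, Complex.sub_conj]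
  congr 1
  push_cast
  ring

theorem mem_trigSpan_of_sum {a : ℂ} {ι : Type*} (s : Finset ι) (c : ι → ℂ)
    (X : ι → (ℝ → ℤ → ℂ) × (ℂ → ℂ)) (hX : ∀ i, X i ∈ trigSpan a) {F : ℝ → ℤ → ℂ} {P : ℂ → ℂ}
    (hF : ∀ t p, F t p = ∑ i ∈ s, c i * (X i).1 t p)
    (hP : ∀ ζ, P ζ = ∑ i ∈ s, c i * (X i).2 ζ) : (F, P) ∈ trigSpan a := by
  have h : ∑ i ∈ s, c i • X i ∈ trigSpan a :=
    Submodule.sum_mem _ fun i _ => Submodule.smul_mem _ _ (hX i)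
  have e : ∑ i ∈ s, c i • X i = (F, P) := by
    refine Prod.ext ?_ ?_
    · funext t p
      rw [Prod.fst_sum, Finset.sum_apply, Finset.sum_apply]
      refine Eq.trans ?_ (hF t p).symm
      rfl
    · funext ζ
      rw [Prod.snd_sum, Finset.sum_apply]
      refine Eq.trans ?_ (hP ζ).symm
      rfl
  rwa [e] at h

theorem add_inv_pow_eq_sum {d : ℂ} (hd : d ≠ 0) (q : ℕ) :
    (d + d⁻¹) ^ (2 * q) =
      ∑ j ∈ Finset.range (2 * q + 1), ((2 * q).choose j : ℂ) * d ^ (2 * ((q : ℤ) - j)) := by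
  rw [add_comm, add_pow]
  refine Finset.sum_congr rfl fun j hj => ?_
  have hj : j ≤ 2 * q := Nat.lt_succ_iff.1 (Finset.mem_range.1 hj)
  rw [mul_comm, inv_pow, ← zpow_natCast, ← zpow_natCast, ← zpow_neg, ← zpow_add₀ hd]
  congr 2
  push_cast [Nat.cast_sub hj]
  ring

/-- The binomial expansion of `(d + d⁻¹)^(2q)`, differentiated in `d` and multiplied by `d`. -/
theorem sum_choose_mul_zpow {d : ℂ} (hd : d ≠ 0) (q : ℕ) :
    ∑ j ∈ Finset.range (2 * q + 1), ((2 * q).choose j : ℂ) *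
      (2 * ((q : ℂ) - j) * d ^ (2 * ((q : ℤ) - j))) =
      2 * q * (d + d⁻¹) ^ (2 * q - 1) * (d - d⁻¹) := by
  have h1 : HasDerivAt (fun x : ℂ => ∑ j ∈ Finset.range (2 * q + 1), ((2 * q).choose j : ℂ) *
      x ^ (2 * ((q : ℤ) - j))) (∑ j ∈ Finset.range (2 * q + 1), ((2 * q).choose j : ℂ) *
      (((2 * ((q : ℤ) - j) : ℤ) : ℂ) * d ^ (2 * ((q : ℤ) - j) - 1))) d :=
    HasDerivAt.fun_sum fun j _ => (hasDerivAt_zpow _ d (Or.inl hd)).const_mul _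
  have h2 : HasDerivAt (fun x : ℂ => (x + x⁻¹) ^ (2 * q))
      (((2 * q : ℕ) : ℂ) * (d + d⁻¹) ^ (2 * q - 1) * (1 + -(d ^ 2)⁻¹)) d :=
    ((hasDerivAt_id d).add (hasDerivAt_inv hd)).pow (2 * q)
  have h3 : (fun x : ℂ => (x + x⁻¹) ^ (2 * q)) =ᶠ[𝓝 d] fun x : ℂ =>
      ∑ j ∈ Finset.range (2 * q + 1), ((2 * q).choose j : ℂ) * x ^ (2 * ((q : ℤ) - j)) := by
    filter_upwards [isOpen_ne.mem_nhds hd] with x hx using add_inv_pow_eq_sum hx q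
  have h4 := (h2.congr_of_eventuallyEq h3.symm).unique h1
  have h5 := congrArg (d * ·) h4
  simp only [Finset.mul_sum] at h5
  have e : d * (((2 * q : ℕ) : ℂ) * (d + d⁻¹) ^ (2 * q - 1) * (1 + -(d ^ 2)⁻¹)) =
      2 * q * (d + d⁻¹) ^ (2 * q - 1) * (d - d⁻¹) := by
    generalize (d + d⁻¹) ^ (2 * q - 1) = A
    push_cast
    field_simp
    ring
  rw [← e, h5]
  refine Finset.sum_congr rfl fun j _ => ?_
  rw [zpow_sub_one₀ hd]
  push_cast
  field_simp

/-- Multiplication by `p - it` corresponds to the derivative `∂_ζ`. -/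
theorem sub_mul_cylSum_mem {a : ℂ} (ha : 0 < a.re) (q : ℕ) :
    ((fun t p => (p - t * Complex.I) * cylSum q a t p,
      fun ζ => -a * ((starRingEnd ℂ) (2 * Complex.cosh ζ) ^ (2 * q + 1) * (2 * Complex.sinh ζ))) :
        (ℝ → ℤ → ℂ) × (ℂ → ℂ)) ∈ trigSpan a := by
  have ha0 := ne_zero_of_re_pos ha
  refine mem_trigSpan_of_sum (Finset.range (2 * q + 1)) (fun j => ((2 * q).choose j : ℂ))
    (fun j => (-a) • (trigBasis a (q - j) (q - j - 1) - trigBasis a (q - j) (q - j + 1) +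
      trigBasis a (q - j + 1) (q - j) - trigBasis a (q - j - 1) (q - j)))
    (fun j => Submodule.smul_mem _ _ (Submodule.sub_mem _ (Submodule.add_mem _
      (Submodule.sub_mem _ (trigBasis_mem _ _ _) (trigBasis_mem _ _ _)) (trigBasis_mem _ _ _))
      (trigBasis_mem _ _ _))) (fun t p => ?_) fun ζ => ?_
  · rw [cylSum, Finset.mul_sum]
    refine Finset.sum_congr rfl fun j _ => ?_
    -- The multiplier is `p - it = (p + q - j) - (it + q - j)`: the shifts cancel, and each bracket
    -- is absorbed by the recurrence of its own factor.
    have h1 := laurentCoeff_recurrence (p + (q - j)) ha0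
    have h2 := macdonald_recurrence (t * Complex.I + (q - j : ℤ)) (y := 2 * a) (by simpa using ha)
    simp only [trigBasis, Prod.smul_fst, Prod.fst_sub, Prod.fst_add, Pi.smul_apply, Pi.sub_apply,
      Pi.add_apply, smul_eq_mul]
    rw [show p + ((q : ℤ) - j - 1) = p + (q - j) - 1 by ring,
      show p + ((q : ℤ) - j + 1) = p + (q - j) + 1 by ring]
    push_cast at h1 h2 ⊢
    rw [show t * Complex.I + ((q : ℂ) - j + 1) = t * Complex.I + (q - j) + 1 by ring,
      show t * Complex.I + ((q : ℂ) - j - 1) = t * Complex.I + (q - j) - 1 by ring]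
    linear_combination ((2 * q).choose j : ℂ) *
      (macdonald (t * Complex.I + (q - j)) (2 * a) * h1 -
        laurentCoeff (p + (q - j)) a * h2 / 2)
  · have hc := Complex.exp_ne_zero ζ
    have hd := Complex.exp_ne_zero ((starRingEnd ℂ) ζ)
    have hs := add_inv_pow_eq_sum hd q
    simp only [Prod.smul_snd, Prod.snd_sub, Prod.snd_add, Pi.smul_apply, Pi.sub_apply,
      Pi.add_apply, smul_eq_mul, trigBasis_snd]
    rw [map_mul, ← Complex.cosh_conj, Complex.cosh, Complex.sinh, Complex.exp_neg, Complex.exp_neg,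
      map_ofNat, mul_div_cancel₀ _ two_ne_zero, mul_div_cancel₀ _ two_ne_zero, pow_succ, hs]
    generalize Complex.exp ζ = c at *
    generalize Complex.exp ((starRingEnd ℂ) ζ) = d at *
    rw [Finset.sum_mul, Finset.sum_mul, Finset.mul_sum]
    refine Finset.sum_congr rfl fun j _ => ?_
    have hcd := mul_ne_zero hc hd
    have hdc := div_ne_zero hd hc
    have e : d ^ (2 * ((q : ℤ) - j)) = (c * d) ^ ((q : ℤ) - j) * (d / c) ^ ((q : ℤ) - j) := by
      rw [← mul_zpow, zpow_mul]
      congr 1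
      rw [show c * d * (d / c) = d * d by field_simp, ← pow_two]
      rfl
    rw [zpow_sub_one₀ hcd, zpow_sub_one₀ hdc, zpow_add_one₀ hcd, zpow_add_one₀ hdc, e]
    field_simp
    ring

/-- Multiplication by `p + it` corresponds to the derivative `-∂_{ζ̄}`. -/
theorem add_mul_cylSum_mem {a : ℂ} (ha : 0 < a.re) (q : ℕ) :
    ((fun t p => (p + t * Complex.I) * cylSum q a t p,
      fun ζ => a * ((starRingEnd ℂ) (2 * Complex.cosh ζ) ^ (2 * q) * (2 * Complex.cosh ζ) *
          (starRingEnd ℂ) (2 * Complex.sinh ζ)) -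
        2 * q * (starRingEnd ℂ) (2 * Complex.cosh ζ) ^ (2 * q - 1) *
          (starRingEnd ℂ) (2 * Complex.sinh ζ)) :
        (ℝ → ℤ → ℂ) × (ℂ → ℂ)) ∈ trigSpan a := by
  have ha0 := ne_zero_of_re_pos ha
  refine mem_trigSpan_of_sum (Finset.range (2 * q + 1)) (fun j => ((2 * q).choose j : ℂ))
    (fun j => (-a) • (trigBasis a (q - j) (q - j - 1) - trigBasis a (q - j) (q - j + 1) -
      trigBasis a (q - j + 1) (q - j) + trigBasis a (q - j - 1) (q - j)) -
      (2 * ((q : ℂ) - j)) • trigBasis a (q - j) (q - j))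
    (fun j => Submodule.sub_mem _ (Submodule.smul_mem _ _ (Submodule.add_mem _ (Submodule.sub_mem _
      (Submodule.sub_mem _ (trigBasis_mem _ _ _) (trigBasis_mem _ _ _)) (trigBasis_mem _ _ _))
      (trigBasis_mem _ _ _))) (Submodule.smul_mem _ _ (trigBasis_mem _ _ _)))
    (fun t p => ?_) fun ζ => ?_
  · rw [cylSum, Finset.mul_sum]
    refine Finset.sum_congr rfl fun j _ => ?_
    -- Here the two shifts add up: `p + it = (p + q - j) + (it + q - j) - 2(q - j)`. The last term
    -- gives the derivative of `conj(2 cosh ζ)^(2q)`, the recurrences that of the weight.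
    have h1 := laurentCoeff_recurrence (p + (q - j)) ha0
    have h2 := macdonald_recurrence (t * Complex.I + (q - j : ℤ)) (y := 2 * a) (by simpa using ha)
    simp only [trigBasis, Prod.smul_fst, Prod.fst_sub, Prod.fst_add, Pi.smul_apply, Pi.sub_apply,
      Pi.add_apply, smul_eq_mul]
    rw [show p + ((q : ℤ) - j - 1) = p + (q - j) - 1 by ring,
      show p + ((q : ℤ) - j + 1) = p + (q - j) + 1 by ring]
    push_cast at h1 h2 ⊢
    rw [show t * Complex.I + ((q : ℂ) - j + 1) = t * Complex.I + (q - j) + 1 by ring,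
      show t * Complex.I + ((q : ℂ) - j - 1) = t * Complex.I + (q - j) - 1 by ring]
    linear_combination ((2 * q).choose j : ℂ) *
      (macdonald (t * Complex.I + (q - j)) (2 * a) * h1 +
        laurentCoeff (p + (q - j)) a * h2 / 2)
  · have hc := Complex.exp_ne_zero ζ
    have hd := Complex.exp_ne_zero ((starRingEnd ℂ) ζ)
    have hs := add_inv_pow_eq_sum hd q
    have hs' := sum_choose_mul_zpow hd q
    simp only [Prod.smul_snd, Prod.snd_sub, Prod.snd_add, Pi.smul_apply, Pi.sub_apply,
      Pi.add_apply, smul_eq_mul, trigBasis_snd]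
    rw [map_mul, map_mul, ← Complex.cosh_conj, ← Complex.sinh_conj, Complex.cosh, Complex.cosh,
      Complex.sinh, Complex.exp_neg, Complex.exp_neg,
      map_ofNat, mul_div_cancel₀ _ two_ne_zero, mul_div_cancel₀ _ two_ne_zero,
      mul_div_cancel₀ _ two_ne_zero, ← hs', hs]
    generalize Complex.exp ζ = c at *
    generalize Complex.exp ((starRingEnd ℂ) ζ) = d at *
    rw [Finset.sum_mul, Finset.sum_mul, Finset.mul_sum, ← Finset.sum_sub_distrib]
    refine Finset.sum_congr rfl fun j _ => ?_
    have hcd := mul_ne_zero hc hd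
    have hdc := div_ne_zero hd hc
    have e : d ^ (2 * ((q : ℤ) - j)) = (c * d) ^ ((q : ℤ) - j) * (d / c) ^ ((q : ℤ) - j) := by
      rw [← mul_zpow, zpow_mul]
      congr 1
      rw [show c * d * (d / c) = d * d by field_simp, ← pow_two]
      rfl
    rw [zpow_sub_one₀ hcd, zpow_sub_one₀ hdc, zpow_add_one₀ hcd, zpow_add_one₀ hdc, e]
    field_simp
    ring

/-- Complex conjugation of `ζ` corresponds to `p ↦ -p`. -/
theorem trigSpan_conj_mem {a : ℂ} (ha : a ≠ 0) {X : (ℝ → ℤ → ℂ) × (ℂ → ℂ)} (hX : X ∈ trigSpan a) :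
    ((fun t p => X.1 t (-p), fun ζ => X.2 ((starRingEnd ℂ) ζ)) : (ℝ → ℤ → ℂ) × (ℂ → ℂ)) ∈
      trigSpan a := by
  induction hX using Submodule.span_induction with
  | mem X hX =>
    obtain ⟨k, rfl⟩ := hX
    convert trigBasis_mem a k.1 (-k.2) using 1
    refine Prod.ext ?_ ?_
    · funext t p
      simp only [trigBasis]
      rw [← laurentCoeff_neg (-p + k.2) ha]
      congr 2
      ring
    · funext ζ
      simp only [trigBasis, Complex.conj_re, Complex.conj_im]
      push_cast
      ring_nf
  | zero => exact Submodule.zero_mem _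
  | add X Y _ _ hX hY => exact Submodule.add_mem _ hX hY
  | smul c X _ hX => exact Submodule.smul_mem _ c hX

end

/-! ### Parseval's formula for the Bessel transform of the test functions -/

noncomputable section
open MeasureTheory Filter Topology

theorem integral_comp_conj (g : ℂ → ℂ) : ∫ u, g ((starRingEnd ℂ) u) = ∫ u, g u :=
  (Complex.conjLIE.measurePreserving).integral_comp'
    (f := Complex.conjLIE.toHomeomorph.toMeasurableEquiv) g

/-- The test functions: even monomials in `u` or in its conjugate, times Gaussians. -/
def gaussTest (σ : Bool) (q : ℕ) (τ u : ℂ) : ℂ :=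
  gaussMonomial q τ (bif σ then (starRingEnd ℂ) u else u)

theorem gaussTest_conj (σ : Bool) (q : ℕ) (τ u : ℂ) :
    gaussTest σ q τ ((starRingEnd ℂ) u) = gaussTest (!σ) q τ u := by
  cases σ <;> simp [gaussTest]

theorem norm_gaussTest (σ : Bool) (q : ℕ) (τ u : ℂ) :
    ‖gaussTest σ q τ u‖ = ‖u‖ ^ (2 * q) * Real.exp (-τ.re * ‖u‖ ^ 2) := by
  cases σ <;> simp [gaussTest, norm_gaussMonomial]

theorem continuous_gaussTest (σ : Bool) (q : ℕ) (τ : ℂ) : Continuous (gaussTest σ q τ) := by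
  cases σ
  · exact continuous_gaussMonomial q τ
  · exact (continuous_gaussMonomial q τ).comp Complex.continuous_conj

/-- The Bessel transform of `gaussTest σ q τ` on the line `Re ν = 0`. -/
def cylTransform (σ : Bool) (q : ℕ) (τ : ℂ) (t : ℝ) (p : ℤ) : ℂ :=
  2 * (-1) ^ q * ((4 : ℂ) ^ (-q : ℤ) * (1 / τ) ^ (2 * q + 1)) *
    cylSum q (1 / (4 * τ)) t (bif σ then -p else p)

theorem integral_besselK_mul_gaussTest (σ : Bool) (q : ℕ) {τ : ℂ} (hτ : 1 / 2 < τ.re) {t : ℝ}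
    (ht : t ≠ 0) (p : ℤ) :
    ∫ u, besselK (t * Complex.I) p u * gaussTest σ q τ u = cylTransform σ q τ t p := by
  have hτ0 : τ ≠ 0 := ne_zero_of_re_pos (by linarith)
  have hν : (t : ℂ) * Complex.I ≠ 0 := mul_ne_zero (by exact_mod_cast ht) Complex.I_ne_zero
  have key : ∀ p : ℤ, ∫ u, besselK (t * Complex.I) p u * gaussMonomial q τ u =
      cylTransform false q τ t p := by
    intro p
    rw [integral_besselK_mul_gaussMonomial (by simp) hν hτ, cylTransform, cylSum]
    have h2 : 1 / (2 * τ) = 2 * (1 / (4 * τ)) := by field_simp; norm_num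
    simp only [h2, cond_false]
  cases σ
  · exact key p
  · rw [← integral_comp_conj]
    simp only [gaussTest_conj, Bool.not_true]
    refine Eq.trans ?_ (key (-p))
    refine integral_congr_ae ?_
    filter_upwards [ae_ne_zero] with u hu
    rw [besselK_conj _ _ hu]
    rfl

theorem re_inv_four_mul_pos {τ : ℂ} (hτ : 0 < τ.re) : 0 < (1 / (4 * τ)).re := by
  have hτ0 : τ ≠ 0 := ne_zero_of_re_pos hτ
  rw [one_div, Complex.inv_re]
  refine div_pos ?_ (Complex.normSq_pos.2 (mul_ne_zero (by norm_num) hτ0))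
  simpa using hτ

theorem continuous_cylTransform (σ : Bool) (q : ℕ) {τ : ℂ} (hτ : 0 < τ.re) (p : ℤ) :
    Continuous fun t => cylTransform σ q τ t p := by
  have ha := re_inv_four_mul_pos hτ
  unfold cylTransform cylSum
  refine continuous_const.mul (continuous_finsetSum _ fun j _ => continuous_const.mul
    (Continuous.mul ?_ continuous_const))
  exact continuous_macdonald_line _ (by simpa using ha)

/-- The transforms of the test functions decay rapidly. -/
theorem exists_norm_cylTransform_le (σ : Bool) (q : ℕ) {τ : ℂ} (hτ : 0 < τ.re) (n k : ℕ) :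
    ∃ C : ℝ, 0 ≤ C ∧ ∀ (t : ℝ) (p : ℤ),
      (1 + t ^ 2) ^ n * (1 + |(p : ℝ)|) ^ k * ‖cylTransform σ q τ t p‖ ≤ C := by
  have ha := re_inv_four_mul_pos hτ
  have ha0 := ne_zero_of_re_pos ha
  set a := 1 / (4 * τ)
  have h2a : 0 < (2 * a).re := by simpa using ha
  choose A hA0 hA using fun j : ℕ => exists_norm_macdonald_line_le (q - j : ℤ) h2a n
  choose B hB0 hB using fun j : ℕ => exists_norm_laurentCoeff_le ha0 (q - j : ℤ) k
  set c := 2 * (-1) ^ q * ((4 : ℂ) ^ (-q : ℤ) * (1 / τ) ^ (2 * q + 1)) with hc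
  refine ⟨‖c‖ * ∑ j ∈ Finset.range (2 * q + 1), ((2 * q).choose j : ℝ) * (A j * B j),
    mul_nonneg (norm_nonneg _) (Finset.sum_nonneg fun j _ => mul_nonneg (Nat.cast_nonneg _)
      (mul_nonneg (hA0 j) (hB0 j))), fun t p => ?_⟩
  set p' : ℤ := bif σ then -p else p with hp'
  have hpp : |(p : ℝ)| = |(p' : ℝ)| := by cases σ <;> simp [hp']
  rw [cylTransform, norm_mul, ← hc, mul_left_comm]
  refine mul_le_mul_of_nonneg_left ?_ (norm_nonneg _)
  rw [cylSum]
  calc (1 + t ^ 2) ^ n * (1 + |(p : ℝ)|) ^ k * ‖∑ j ∈ Finset.range (2 * q + 1),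
        ((2 * q).choose j : ℂ) * (macdonald (t * Complex.I + (q - j : ℤ)) (2 * a) *
          laurentCoeff (p' + (q - j : ℤ)) a)‖
      ≤ (1 + t ^ 2) ^ n * (1 + |(p : ℝ)|) ^ k * ∑ j ∈ Finset.range (2 * q + 1),
        ‖((2 * q).choose j : ℂ) * (macdonald (t * Complex.I + (q - j : ℤ)) (2 * a) *
          laurentCoeff (p' + (q - j : ℤ)) a)‖ := by
        gcongr
        exact norm_sum_le _ _
    _ = ∑ j ∈ Finset.range (2 * q + 1), ((2 * q).choose j : ℝ) *
        (((1 + t ^ 2) ^ n * ‖macdonald (t * Complex.I + (q - j : ℤ)) (2 * a)‖) *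
          ((1 + |(p' : ℝ)|) ^ k * ‖laurentCoeff (p' + (q - j : ℤ)) a‖)) := by
        rw [Finset.mul_sum, hpp]
        refine Finset.sum_congr rfl fun j _ => ?_
        rw [norm_mul, norm_mul, Complex.norm_natCast]
        ring
    _ ≤ _ := by
        gcongr with j _
        exacts [hA0 j, hA j t, hB j p']

/-- The multipliers satisfy `(p - it)(-p - it) = -(p² + t²)`, and on the cylinder the two
derivatives produce `|2 sinh ζ|²`, the Jacobian of `w = 2 cosh ζ`. What remains is a Gaussian moment
in the `w`-plane. -/
theorem hasSum_integral_cylSum_conj {a b : ℂ} (ha : 0 < a.re) (hb : 0 < b.re) (q r : ℕ) :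
    HasSum (fun p : ℤ => ∫ t : ℝ, cylSum q a t p * cylSum r b t (-p) * ((p : ℂ) ^ 2 + (t : ℂ) ^ 2))
      (a * b * if 2 * q + 1 = 2 * r + 1 then
        Real.pi * (((2 * q + 1).factorial : ℂ) / (a + b) ^ (2 * q + 1 + 1)) else 0) := by
  have hab : 0 < (a + b).re := by rw [Complex.add_re]; linarith
  have h := (isParsevalPair_of_mem_trigSpan ha hb (sub_mul_cylSum_mem ha q)
    (trigSpan_conj_mem (ne_zero_of_re_pos hb) (sub_mul_cylSum_mem hb r))).2.2
  have e1 : ∀ ζ : ℂ, -a * ((starRingEnd ℂ) (2 * Complex.cosh ζ) ^ (2 * q + 1) *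
        (2 * Complex.sinh ζ)) *
      (-b * ((starRingEnd ℂ) (2 * Complex.cosh ((starRingEnd ℂ) (-ζ))) ^ (2 * r + 1) *
        (2 * Complex.sinh ((starRingEnd ℂ) (-ζ))))) * coshWeight (a + b) ζ =
      ((Complex.normSq (2 * Complex.sinh ζ) : ℝ) : ℂ) * (fun w : ℂ => -(a * b) *
        ((starRingEnd ℂ) w ^ (2 * q + 1) * w ^ (2 * r + 1) *
          Complex.exp (-(a + b) * ((‖w‖ : ℝ) : ℂ) ^ 2))) (2 * Complex.cosh ζ) := by
    intro ζ
    simp only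
    rw [← normSq_two_mul_cosh, ← Complex.mul_conj, map_neg, Complex.cosh_neg, Complex.sinh_neg,
      Complex.cosh_conj, Complex.sinh_conj]
    simp only [map_mul, map_ofNat, Complex.conj_conj]
    ring
  simp only [e1] at h
  rw [setIntegral_strip_cosh fun w : ℂ => -(a * b) *
        ((starRingEnd ℂ) w ^ (2 * q + 1) * w ^ (2 * r + 1) *
          Complex.exp (-(a + b) * ((‖w‖ : ℝ) : ℂ) ^ 2)), integral_const_mul,
    integral_conj_pow_mul_pow_mul_gaussian hab] at h
  have h2 := h.neg
  rw [neg_mul, neg_neg] at h2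
  refine h2.of_forall_eq fun p => ?_
  rw [← integral_neg]
  refine integral_congr_ae (Eventually.of_forall fun t => ?_)
  simp only
  push_cast
  linear_combination (cylSum q a t p * cylSum r b t (-p) * (t : ℂ) ^ 2) * Complex.I_sq

/-- The same mechanism with `(p - it)(p + it) = p² + t²`. The extra term from differentiating the
power contributes a moment with unequal exponents, which vanishes. -/
theorem hasSum_integral_cylSum {a b : ℂ} (ha : 0 < a.re) (hb : 0 < b.re) (q r : ℕ) :
    HasSum (fun p : ℤ => ∫ t : ℝ, cylSum q a t p * cylSum r b t p * ((p : ℂ) ^ 2 + (t : ℂ) ^ 2))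
      (a * b * if 2 * q + 2 * r + 1 = 1 then Real.pi * (1 / (a + b) ^ (1 + 1)) else 0) := by
  have hab : 0 < (a + b).re := by rw [Complex.add_re]; linarith
  have h := (isParsevalPair_of_mem_trigSpan ha hb (sub_mul_cylSum_mem ha q)
    (add_mul_cylSum_mem hb r)).2.2
  have e1 : ∀ ζ : ℂ, -a * ((starRingEnd ℂ) (2 * Complex.cosh ζ) ^ (2 * q + 1) *
        (2 * Complex.sinh ζ)) *
      (b * ((starRingEnd ℂ) (2 * Complex.cosh (-ζ)) ^ (2 * r) * (2 * Complex.cosh (-ζ)) *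
          (starRingEnd ℂ) (2 * Complex.sinh (-ζ))) -
        2 * r * (starRingEnd ℂ) (2 * Complex.cosh (-ζ)) ^ (2 * r - 1) *
          (starRingEnd ℂ) (2 * Complex.sinh (-ζ))) * coshWeight (a + b) ζ =
      ((Complex.normSq (2 * Complex.sinh ζ) : ℝ) : ℂ) * (fun w : ℂ => (a * b) *
        ((starRingEnd ℂ) w ^ (2 * q + 2 * r + 1) * w ^ 1 *
          Complex.exp (-(a + b) * ((‖w‖ : ℝ) : ℂ) ^ 2)) - (a * (2 * r)) *
        ((starRingEnd ℂ) w ^ (2 * q + 1 + (2 * r - 1)) * w ^ 0 *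
          Complex.exp (-(a + b) * ((‖w‖ : ℝ) : ℂ) ^ 2))) (2 * Complex.cosh ζ) := by
    intro ζ
    simp only
    rw [← normSq_two_mul_cosh, ← Complex.mul_conj, Complex.cosh_neg, Complex.sinh_neg]
    simp only [map_mul, map_ofNat, map_neg]
    ring
  simp only [e1] at h
  have hgi : ∀ m n : ℕ, Integrable fun w : ℂ => (starRingEnd ℂ) w ^ m * w ^ n *
      Complex.exp (-(a + b) * ((‖w‖ : ℝ) : ℂ) ^ 2) := by
    intro m n
    have := integrable_norm_rpow_mul_gaussian (r := (m + n : ℕ)) (c := (a + b).re)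
      (by have : (0 : ℝ) ≤ (m + n : ℕ) := Nat.cast_nonneg _
          linarith) hab
    refine this.mono' (by fun_prop) (Eventually.of_forall fun w => le_of_eq ?_)
    rw [norm_mul, norm_mul, norm_pow, norm_pow, RCLike.norm_conj, Complex.norm_exp,
      ← Complex.ofReal_pow, Complex.re_mul_ofReal, Complex.neg_re, Real.rpow_natCast,
      Real.rpow_two, pow_add]
  rw [setIntegral_strip_cosh fun w : ℂ => (a * b) *
        ((starRingEnd ℂ) w ^ (2 * q + 2 * r + 1) * w ^ 1 *
          Complex.exp (-(a + b) * ((‖w‖ : ℝ) : ℂ) ^ 2)) - (a * (2 * r)) *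
        ((starRingEnd ℂ) w ^ (2 * q + 1 + (2 * r - 1)) * w ^ 0 *
          Complex.exp (-(a + b) * ((‖w‖ : ℝ) : ℂ) ^ 2)), integral_sub ((hgi _ _).const_mul _) ((hgi _ _).const_mul _),
    integral_const_mul, integral_const_mul, integral_conj_pow_mul_pow_mul_gaussian hab,
    integral_conj_pow_mul_pow_mul_gaussian hab, if_neg (by omega : ¬ 2 * q + 1 + (2 * r - 1) = 0),
    mul_zero, sub_zero] at h
  have hfac : (if 2 * q + 2 * r + 1 = 1 then (Real.pi : ℂ) * (1 / (a + b) ^ (1 + 1)) else 0) =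
      if 2 * q + 2 * r + 1 = 1 then
        (Real.pi : ℂ) * (((2 * q + 2 * r + 1).factorial : ℂ) / (a + b) ^ (2 * q + 2 * r + 1 + 1))
      else 0 := by
    split_ifs with h0
    · rw [h0]; simp
    · rfl
  rw [hfac]
  refine h.of_forall_eq fun p => ?_
  refine integral_congr_ae (Eventually.of_forall fun t => ?_)
  simp only
  linear_combination (cylSum q a t p * cylSum r b t p * (t : ℂ) ^ 2) * Complex.I_sq

theorem integral_gaussTest_mul_false (σ : Bool) (q r : ℕ) {τ τ' : ℂ} (hτ : 0 < τ.re)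
    (hτ' : 0 < τ'.re) :
    ∫ u : ℂ, gaussTest false q τ u * gaussTest σ r τ' u * ((‖u‖ : ℝ) : ℂ) ^ 2 =
      bif σ then (if 2 * q + 1 = 2 * r + 1 then
          Real.pi * (((2 * q + 1).factorial : ℂ) / (τ + τ') ^ (2 * q + 1 + 1)) else 0)
      else if 2 * q + 2 * r + 1 = 1 then Real.pi * (1 / (τ + τ') ^ (1 + 1)) else 0 := by
  have hab : 0 < (τ + τ').re := by rw [Complex.add_re]; linarith
  have hn : ∀ u : ℂ, ((‖u‖ : ℝ) : ℂ) ^ 2 = u * (starRingEnd ℂ) u := fun u => by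
    rw [Complex.mul_conj, Complex.normSq_eq_norm_sq]; push_cast; rfl
  have hexp : ∀ u : ℂ, Complex.exp (-τ * ((‖u‖ : ℝ) : ℂ) ^ 2) *
      Complex.exp (-τ' * ((‖u‖ : ℝ) : ℂ) ^ 2) =
      Complex.exp (-(τ + τ') * ((‖u‖ : ℝ) : ℂ) ^ 2) := fun u => by
    rw [← Complex.exp_add]; congr 1; ring
  cases σ
  · have h := integral_conj_pow_mul_pow_mul_gaussian hab 1 (2 * q + 2 * r + 1)
    simp only [cond_false]
    have hfac : (if 2 * q + 2 * r + 1 = 1 then (Real.pi : ℂ) * (1 / (τ + τ') ^ (1 + 1)) else 0) =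
        if 1 = 2 * q + 2 * r + 1 then (Real.pi : ℂ) * (((1 : ℕ).factorial : ℂ) /
          (τ + τ') ^ (1 + 1)) else 0 := by
      simp [eq_comm]
    rw [hfac, ← h]
    refine integral_congr_ae (Eventually.of_forall fun u => ?_)
    simp only [gaussTest, gaussMonomial, cond_false]
    rw [← hexp, ← mul_assoc, ← mul_assoc]
    conv_lhs => rw [mul_comm _ (((‖u‖ : ℝ) : ℂ) ^ 2), hn]
    rw [← hn]
    generalize Complex.exp (-τ * ((‖u‖ : ℝ) : ℂ) ^ 2) = E
    generalize Complex.exp (-τ' * ((‖u‖ : ℝ) : ℂ) ^ 2) = E'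
    rw [hn]
    ring
  · have h := integral_conj_pow_mul_pow_mul_gaussian hab (2 * r + 1) (2 * q + 1)
    simp only [cond_true]
    have hfac : (if 2 * q + 1 = 2 * r + 1 then (Real.pi : ℂ) *
        (((2 * q + 1).factorial : ℂ) / (τ + τ') ^ (2 * q + 1 + 1)) else 0) =
        if 2 * r + 1 = 2 * q + 1 then (Real.pi : ℂ) *
        (((2 * r + 1).factorial : ℂ) / (τ + τ') ^ (2 * r + 1 + 1)) else 0 := by
      split_ifs with h1 h2 h2
      · rw [h1]
      · omega
      · omega
      · rfl
    rw [hfac, ← h]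
    refine integral_congr_ae (Eventually.of_forall fun u => ?_)
    simp only [gaussTest, gaussMonomial, cond_false, cond_true, RCLike.norm_conj]
    rw [← hexp]
    generalize Complex.exp (-τ * ((‖u‖ : ℝ) : ℂ) ^ 2) = E
    generalize Complex.exp (-τ' * ((‖u‖ : ℝ) : ℂ) ^ 2) = E'
    rw [hn]
    ring

/-- Parseval's formula for the Bessel transform of the test functions. -/
theorem hasSum_integral_cylTransform (σ σ' : Bool) (q r : ℕ) {τ τ' : ℂ} (hτ : 0 < τ.re)
    (hτ' : 0 < τ'.re) :
    HasSum (fun p : ℤ => ∫ t : ℝ, cylTransform σ q τ t p * cylTransform σ' r τ' t p *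
      ((p : ℂ) ^ 2 + (t : ℂ) ^ 2))
      (4 * ∫ u : ℂ, gaussTest σ q τ u * gaussTest σ' r τ' u * ((‖u‖ : ℝ) : ℂ) ^ 2) := by
  have key : ∀ σ' : Bool, HasSum (fun p : ℤ => ∫ t : ℝ, cylTransform false q τ t p *
      cylTransform σ' r τ' t p * ((p : ℂ) ^ 2 + (t : ℂ) ^ 2))
      (4 * ∫ u : ℂ, gaussTest false q τ u * gaussTest σ' r τ' u * ((‖u‖ : ℝ) : ℂ) ^ 2) := by
    have hτ0 := ne_zero_of_re_pos hτ
    have hτ0' := ne_zero_of_re_pos hτ'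
    have hs0 : τ + τ' ≠ 0 := ne_zero_of_re_pos (by rw [Complex.add_re]; linarith)
    -- This relates the Gaussian parameter in the `w`-plane to `τ + τ'` in the `u`-plane; the
    -- remaining powers of `τ` and `τ'` are absorbed by the prefactors of `cylTransform`.
    have hA : 1 / (4 * τ) + 1 / (4 * τ') = (τ + τ') / (4 * τ * τ') := by field_simp; ring
    intro σ'
    rw [integral_gaussTest_mul_false σ' q r hτ hτ']
    set c : ℂ := (2 * (-1) ^ q * ((4 : ℂ) ^ (-q : ℤ) * (1 / τ) ^ (2 * q + 1))) *
      (2 * (-1) ^ r * ((4 : ℂ) ^ (-r : ℤ) * (1 / τ') ^ (2 * r + 1))) with hc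
    cases σ'
    · have h := (hasSum_integral_cylSum (re_inv_four_mul_pos hτ) (re_inv_four_mul_pos hτ')
        q r).mul_left c
      have e : c * (1 / (4 * τ) * (1 / (4 * τ')) * if 2 * q + 2 * r + 1 = 1 then
          Real.pi * (1 / (1 / (4 * τ) + 1 / (4 * τ')) ^ (1 + 1)) else 0) =
          4 * (if 2 * q + 2 * r + 1 = 1 then Real.pi * (1 / (τ + τ') ^ (1 + 1)) else 0) := by
        split_ifs with h0
        · obtain rfl : q = 0 := by omega
          obtain rfl : r = 0 := by omega
          rw [hc, hA]
          simp only [Nat.cast_zero, neg_zero, zpow_zero, mul_zero, pow_zero, zero_add, pow_one]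
          generalize τ + τ' = s at hs0 ⊢
          rw [div_pow]
          field_simp
          ring
        · simp
      rw [e] at h
      refine h.of_forall_eq fun p => ?_
      rw [← integral_const_mul]
      refine integral_congr_ae (Eventually.of_forall fun t => ?_)
      simp only [cylTransform, cond_false, hc]
      ring
    · have h := (hasSum_integral_cylSum_conj (re_inv_four_mul_pos hτ) (re_inv_four_mul_pos hτ')
        q r).mul_left c
      have e : c * (1 / (4 * τ) * (1 / (4 * τ')) * if 2 * q + 1 = 2 * r + 1 then
          Real.pi * (((2 * q + 1).factorial : ℂ) /
            (1 / (4 * τ) + 1 / (4 * τ')) ^ (2 * q + 1 + 1)) else 0) =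
          4 * (if 2 * q + 1 = 2 * r + 1 then Real.pi *
            (((2 * q + 1).factorial : ℂ) / (τ + τ') ^ (2 * q + 1 + 1)) else 0) := by
        split_ifs with h0
        · obtain rfl : q = r := by omega
          rw [hc, hA]
          have s3 : (-1 : ℂ) ^ q * (-1) ^ q = 1 := by rw [← mul_pow]; norm_num
          have hF : ((2 * q + 1).factorial : ℂ) ≠ 0 := by exact_mod_cast Nat.factorial_ne_zero _
          have h4 : (4 : ℂ) ^ (-q : ℤ) * (4 : ℂ) ^ (-q : ℤ) * 4 ^ (2 * q + 1 + 1) = 16 := by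
            rw [← zpow_natCast, ← zpow_add₀ (by norm_num), ← zpow_add₀ (by norm_num),
              show -(q : ℤ) + -q + ((2 * q + 1 + 1 : ℕ) : ℤ) = 2 by push_cast; ring]
            norm_num
          have h5 : (τ + τ') / (4 * τ * τ') = (τ + τ') * (1 / τ) * (1 / τ') / 4 := by field_simp
          have h6 : ((τ + τ') / (4 * τ * τ')) ^ (2 * q + 1 + 1) = (τ + τ') ^ (2 * q + 1 + 1) *
              ((1 / τ) ^ (2 * q + 1) * (1 / τ)) * ((1 / τ') ^ (2 * q + 1) * (1 / τ')) /
              4 ^ (2 * q + 1 + 1) := by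
            rw [h5, div_pow _ (4 : ℂ), mul_pow, mul_pow, pow_succ (1 / τ) (2 * q + 1),
              pow_succ (1 / τ') (2 * q + 1)]
          rw [h6]
          have hx : (1 / τ) ^ (2 * q + 1) ≠ 0 := pow_ne_zero _ (one_div_ne_zero hτ0)
          have hy : (1 / τ') ^ (2 * q + 1) ≠ 0 := pow_ne_zero _ (one_div_ne_zero hτ0')
          have hz : (τ + τ') ^ (2 * q + 1 + 1) ≠ 0 := pow_ne_zero _ hs0
          generalize (1 / τ) ^ (2 * q + 1) = x at hx ⊢
          generalize (1 / τ') ^ (2 * q + 1) = y at hy ⊢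
          generalize (τ + τ') ^ (2 * q + 1 + 1) = z at hz ⊢
          generalize (4 : ℂ) ^ (2 * q + 1 + 1) = D at h4 ⊢
          generalize (4 : ℂ) ^ (-q : ℤ) = F at h4 ⊢
          generalize (-1 : ℂ) ^ q = s at s3 ⊢
          field_simp
          linear_combination 4 * ((D * F ^ 2) * s3 + h4)
        · simp
      rw [e] at h
      refine h.of_forall_eq fun p => ?_
      rw [← integral_const_mul]
      refine integral_congr_ae (Eventually.of_forall fun t => ?_)
      simp only [cylTransform, cond_false, cond_true, hc]
      ring
  cases σ
  · exact key σ'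
  · have h := (Equiv.neg ℤ).hasSum_iff.2 (key (!σ'))
    rw [← integral_comp_conj]
    simp only [gaussTest_conj, Bool.not_true, RCLike.norm_conj]
    refine h.of_forall_eq fun p => ?_
    refine integral_congr_ae (Eventually.of_forall fun t => ?_)
    cases σ' <;> simp [cylTransform]

end

/-! ### The test functions determine even functions of moderate growth -/

noncomputable section
open MeasureTheory Filter Topology FourierTransform

theorem polarCoord_symm_eq_exp {r : ℝ} (hr : 0 < r) (θ : ℝ) :
    Complex.polarCoord.symm (r, θ) = Complex.exp ((Real.log r : ℝ) + θ * Complex.I) := by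
  rw [Complex.polarCoord_symm_apply, Complex.exp_add, ← Complex.ofReal_exp, Real.exp_log hr,
    Complex.exp_mul_I, Complex.ofReal_cos, Complex.ofReal_sin]

theorem integrableOn_polar {F : ℂ → ℂ} (hF : Integrable F) (hc : ContinuousOn F {0}ᶜ) :
    IntegrableOn (fun x : ℝ × ℝ => x.1 • F (Complex.polarCoord.symm x))
      (Set.Ioi 0 ×ˢ Set.Ioo (-Real.pi) Real.pi) := by
  have hm : MeasurableSet (Set.Ioi (0 : ℝ) ×ˢ Set.Ioo (-Real.pi) Real.pi) :=
    measurableSet_Ioi.prod measurableSet_Ioo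
  constructor
  · refine ContinuousOn.aestronglyMeasurable ?_ hm
    refine continuousOn_fst.smul (hc.comp ?_ ?_)
    · have : Continuous fun x : ℝ × ℝ => Complex.polarCoord.symm x := by
        simp only [Complex.polarCoord_symm_apply]
        fun_prop
      exact this.continuousOn
    · rintro x ⟨hx, -⟩
      have : ‖Complex.polarCoord.symm x‖ ≠ 0 := by
        rw [Complex.norm_polarCoord_symm]
        exact abs_ne_zero.mpr (ne_of_gt hx)
      simpa using norm_ne_zero_iff.mp this
  · rw [hasFiniteIntegral_iff_enorm]
    have h := Complex.lintegral_comp_polarCoord_symm fun u => ‖F u‖ₑ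
    rw [polarCoord_target] at h
    calc _ = ∫⁻ x in Set.Ioi (0 : ℝ) ×ˢ Set.Ioo (-Real.pi) Real.pi,
          ENNReal.ofReal x.1 • ‖F (Complex.polarCoord.symm x)‖ₑ := by
          refine setLIntegral_congr_fun hm fun x hx => ?_
          have hx1 : (0 : ℝ) < x.1 := hx.1
          simp only [enorm_smul, smul_eq_mul]
          rw [Real.enorm_of_nonneg hx1.le]
      _ < ⊤ := by
          rw [h]
          exact hF.2

theorem integrableOn_integral_polar {F : ℂ → ℂ} (hF : Integrable F) (hc : ContinuousOn F {0}ᶜ) :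
    IntegrableOn (fun r : ℝ => ∫ θ in Set.Ioo (-Real.pi) Real.pi,
      r • F (Complex.polarCoord.symm (r, θ))) (Set.Ioi 0) := by
  have h := integrableOn_polar hF hc
  rw [IntegrableOn, Measure.volume_eq_prod, ← Measure.prod_restrict] at h
  exact h.integral_prod_left

theorem integral_eq_integral_polar {F : ℂ → ℂ} (hF : Integrable F) (hc : ContinuousOn F {0}ᶜ) :
    ∫ u, F u = ∫ r in Set.Ioi (0 : ℝ), ∫ θ in Set.Ioo (-Real.pi) Real.pi,
      r • F (Complex.polarCoord.symm (r, θ)) := by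
  have h := integrableOn_polar hF hc
  rw [← Complex.integral_comp_polarCoord_symm, polarCoord_target, Measure.volume_eq_prod,
    setIntegral_prod _ h]

/-- Injectivity of the Fourier transform, in the variable `r²` on the half-line. -/
theorem eq_zero_of_integral_exp_sq_eq_zero {k : ℝ → ℂ} (hc : ContinuousOn k (Set.Ioi 0))
    (hi : IntegrableOn (fun r : ℝ => (r : ℂ) * k r) (Set.Ioi 0))
    (h : ∀ ξ : ℝ, ∫ r in Set.Ioi (0 : ℝ),
      (r : ℂ) * k r * Complex.exp (-(ξ * Complex.I) * (r : ℂ) ^ 2) = 0)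
    {r : ℝ} (hr : 0 < r) : k r = 0 := by
  -- In the variable `s = r²` the hypothesis at `ξ = 2πw` says that the Fourier transform of `g`,
  -- extended by zero, vanishes at `w`.
  set g : ℝ → ℂ := fun s => k (Real.sqrt s) with hg
  have hsub : ∀ r : ℝ, 0 < r → Real.sqrt (r ^ (2 : ℝ)) = r := fun r hr => by
    rw [Real.rpow_two, Real.sqrt_sq hr.le]
  have h1 : (2 : ℝ) - 1 = 1 := by norm_num
  have hgi : IntegrableOn g (Set.Ioi 0) := by
    rw [← integrableOn_Ioi_comp_rpow_iff' g (p := 2) two_ne_zero]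
    refine hi.congr_fun (fun r hr => ?_) measurableSet_Ioi
    simp only [hg, h1, Real.rpow_one, hsub r hr, Complex.real_smul]
  have hFg : 𝓕 (Set.indicator (Set.Ioi (0 : ℝ)) g) = fun _ => 0 := by
    funext w
    rw [Real.fourier_real_eq_integral_exp_smul]
    have e : ∀ v : ℝ, Complex.exp (↑(-2 * Real.pi * v * w) * Complex.I) •
        Set.indicator (Set.Ioi (0 : ℝ)) g v = Set.indicator (Set.Ioi (0 : ℝ))
        (fun v => Complex.exp (↑(-2 * Real.pi * v * w) * Complex.I) * g v) v := by
      intro v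
      by_cases hv : v ∈ Set.Ioi (0 : ℝ)
      · simp [hv]
      · simp [hv]
    simp only [e]
    rw [integral_indicator measurableSet_Ioi, ← integral_comp_rpow_Ioi _ (p := 2) two_ne_zero]
    have := h (2 * Real.pi * w)
    rw [← mul_zero (2 : ℂ), ← this, ← integral_const_mul]
    refine setIntegral_congr_fun measurableSet_Ioi fun r hr => ?_
    simp only [hg, h1, Real.rpow_one, Complex.real_smul, Real.rpow_two, abs_two,
      Real.sqrt_sq (le_of_lt (Set.mem_Ioi.mp hr))]
    push_cast
    rw [show -2 * (Real.pi : ℂ) * r ^ 2 * w * Complex.I =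
      -(2 * Real.pi * w * Complex.I) * (r : ℂ) ^ 2 by ring]
    ring
  have hint : Integrable (Set.indicator (Set.Ioi (0 : ℝ)) g) := by
    rwa [integrable_indicator_iff measurableSet_Ioi]
  have hr2 : r ^ 2 ∈ Set.Ioi (0 : ℝ) := by
    have : 0 < r ^ 2 := by positivity
    exact this
  have hcont : ContinuousAt (Set.indicator (Set.Ioi (0 : ℝ)) g) (r ^ 2) := by
    have : g =ᶠ[𝓝 (r ^ 2)] Set.indicator (Set.Ioi (0 : ℝ)) g := by
      filter_upwards [isOpen_Ioi.mem_nhds hr2] with s hs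
      simp [Set.indicator_of_mem hs]
    refine ContinuousAt.congr ?_ this
    refine ContinuousAt.comp (g := k) ?_ Real.continuous_sqrt.continuousAt
    rw [Real.sqrt_sq hr.le]
    exact hc.continuousAt (isOpen_Ioi.mem_nhds hr)
  have hinv := hint.fourierInv_fourier_eq (by rw [hFg]; exact integrable_zero _ _ _) hcont
  rw [hFg, Set.indicator_of_mem hr2, hg] at hinv
  simp only [Real.sqrt_sq hr.le] at hinv
  rw [← hinv, Real.fourierInv_eq]
  simp

/-- A continuous `π`-periodic function all of whose Fourier coefficients vanish is zero. -/
theorem eq_zero_of_periodic_of_fourier_eq_zero {g : ℝ → ℂ} (hg : Continuous g)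
    (hp : Function.Periodic g Real.pi)
    (h : ∀ n : ℤ, ∫ θ in Set.Ioo (-Real.pi) Real.pi,
      g θ * Complex.exp (((2 * n : ℤ) : ℂ) * (θ * Complex.I)) = 0) (θ : ℝ) : g θ = 0 := by
  have : Fact (0 < Real.pi) := ⟨Real.pi_pos⟩
  set G : C(AddCircle Real.pi, ℂ) :=
    ⟨hp.lift, continuous_coinduced_dom.mpr hg⟩ with hG
  have hcoe : ∀ x : ℝ, G (x : AddCircle Real.pi) = g x := fun x => hp.lift_coe x
  have hcoef : ∀ n : ℤ, fourierCoeff G n = 0 := by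
    intro n
    rw [fourierCoeff_eq_intervalIntegral G n 0]
    have hper : Function.Periodic (fun x : ℝ => g x *
        Complex.exp (((2 * (-n) : ℤ) : ℂ) * (x * Complex.I))) Real.pi := by
      intro x
      simp only [hp x]
      congr 1
      rw [Complex.exp_eq_exp_iff_exists_int]
      exact ⟨-n, by push_cast; ring⟩
    have h2 := h (-n)
    have hcont : Continuous fun x : ℝ => g x *
        Complex.exp (((2 * (-n) : ℤ) : ℂ) * (x * Complex.I)) := by fun_prop
    rw [← integral_Ioc_eq_integral_Ioo,
      ← intervalIntegral.integral_of_le (by linarith [Real.pi_pos]),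
      ← intervalIntegral.integral_add_adjacent_intervals (b := 0)
        (hcont.intervalIntegrable _ _) (hcont.intervalIntegrable _ _)] at h2
    -- The interval `(-π, π)` consists of two periods, with equal integrals.
    have h3 := hper.intervalIntegral_add_eq (-Real.pi) 0
    rw [neg_add_cancel, zero_add] at h3
    rw [h3, ← two_mul] at h2
    have h4 := (mul_eq_zero.mp h2).resolve_left two_ne_zero
    rw [zero_add]
    have e : ∀ x : ℝ, @fourier Real.pi (-n) x • G (x : AddCircle Real.pi) = g x *
        Complex.exp (((2 * (-n) : ℤ) : ℂ) * (x * Complex.I)) := by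
      intro x
      rw [hcoe, fourier_coe_apply, smul_eq_mul, mul_comm]
      congr 2
      have : (Real.pi : ℂ) ≠ 0 := by exact_mod_cast Real.pi_ne_zero
      push_cast
      field_simp
    simp only [e, h4, smul_zero]
  have hs := has_pointwise_sum_fourier_series_of_summable (f := G)
    (by rw [show fourierCoeff G = fun _ => 0 from funext hcoef]; exact summable_zero)
    (θ : AddCircle Real.pi)
  rw [hcoe] at hs
  simp only [hcoef, zero_smul] at hs
  exact hs.unique hasSum_zero

theorem gaussTest_polar (σ : Bool) (q : ℕ) (τ : ℂ) {r : ℝ} (hr : 0 < r) (θ : ℝ) :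
    gaussTest σ q τ (Complex.polarCoord.symm (r, θ)) =
      (r : ℂ) ^ (2 * q) * Complex.exp (-τ * (r : ℂ) ^ 2) *
        Complex.exp (((2 * (bif σ then -(q : ℤ) else q) : ℤ) : ℂ) * (θ * Complex.I)) := by
  have hn : ‖Complex.polarCoord.symm (r, θ)‖ = r := by
    rw [Complex.norm_polarCoord_symm, abs_of_pos hr]
  have hp : Complex.polarCoord.symm (r, θ) = r * Complex.exp (θ * Complex.I) := by
    rw [Complex.polarCoord_symm_apply, Complex.exp_mul_I, Complex.ofReal_cos, Complex.ofReal_sin]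
  cases σ
  · simp only [gaussTest, cond_false, gaussMonomial, hn]
    rw [hp, mul_pow, ← Complex.exp_nat_mul]
    push_cast
    rw [show 2 * (q : ℂ) * (θ * Complex.I) = 2 * q * (θ * Complex.I) by ring]
    ring
  · simp only [gaussTest, cond_true, gaussMonomial, RCLike.norm_conj, hn]
    rw [hp, map_mul, Complex.conj_ofReal, ← Complex.exp_conj, mul_pow, ← Complex.exp_nat_mul]
    simp only [map_mul, Complex.conj_ofReal, Complex.conj_I]
    push_cast
    rw [show 2 * (q : ℂ) * (θ * -Complex.I) = 2 * -q * (θ * Complex.I) by ring]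
    ring

theorem growth_mul_norm_gaussTest (σ : Bool) (q : ℕ) (τ u : ℂ) :
    growth u * ‖gaussTest σ q τ u‖ =
      growth u * (‖u‖ ^ (2 * q) * Real.exp (-τ.re * ‖u‖ ^ 2)) := by
  rw [norm_gaussTest]

theorem integrable_growth_mul_norm_gaussTest (σ : Bool) (q : ℕ) {τ : ℂ} (hτ : 2 < τ.re) :
    Integrable fun u => growth u * ‖gaussTest σ q τ u‖ := by
  simp only [growth_mul_norm_gaussTest]
  exact integrable_growth_mul_pow_mul_gaussian _ hτ

/-- Even functions of moderate growth are determined by their integrals against the functions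
`gaussTest`. -/
theorem eq_zero_of_forall_integral_mul_gaussTest_eq_zero {Φ : ℂ → ℂ} {C : ℝ}
    (hc : ContinuousOn Φ {0}ᶜ) (he : ∀ u, Φ (-u) = Φ u)
    (hb : ∀ u, u ≠ 0 → ‖Φ u‖ ≤ C * growth u)
    (h : ∀ (σ : Bool) (q : ℕ) (ξ : ℝ), ∫ u, Φ u * gaussTest σ q (4 + ξ * Complex.I) u = 0)
    {u : ℂ} (hu : u ≠ 0) : Φ u = 0 := by
  have hexpc : Continuous fun x : ℝ × ℝ => Φ (Complex.exp (x.1 + x.2 * Complex.I)) :=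
    hc.comp_continuous (by fun_prop) fun x => Complex.exp_ne_zero _
  have hre : ∀ ξ : ℝ, (4 + ξ * Complex.I : ℂ).re = 4 := by intro ξ; simp
  have hcg : ∀ (σ : Bool) (q : ℕ) (ξ : ℝ),
      ContinuousOn (fun u => Φ u * gaussTest σ q (4 + ξ * Complex.I) u) {0}ᶜ := fun σ q ξ =>
    hc.mul (continuous_gaussTest σ q _).continuousOn
  have hint : ∀ (σ : Bool) (q : ℕ) (ξ : ℝ),
      Integrable fun u => Φ u * gaussTest σ q (4 + ξ * Complex.I) u := by
    intro σ q ξ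
    refine ((integrable_growth_mul_norm_gaussTest σ q (τ := 4 + ξ * Complex.I)
      (by rw [hre]; norm_num)).const_mul C).mono'
      (aestronglyMeasurable_of_continuousOn_compl_zero (hcg σ q ξ)) ?_
    filter_upwards [ae_ne_zero] with u hu
    rw [norm_mul, ← mul_assoc]
    exact mul_le_mul_of_nonneg_right (hb u hu) (norm_nonneg _)
  -- Letting `ξ` vary isolates each circle, so every even angular Fourier coefficient vanishes
  -- there; `σ` is the sign of the frequency. The real part `4` of `τ` exceeds the exponent `2` in
  -- `growth`, which makes the integrals converge.
  have hH : ∀ (σ : Bool) (q : ℕ) {r : ℝ}, 0 < r → ∫ θ in Set.Ioo (-Real.pi) Real.pi,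
      Φ (Complex.exp ((Real.log r : ℝ) + θ * Complex.I)) *
        Complex.exp (((2 * (bif σ then -(q : ℤ) else q) : ℤ) : ℂ) * (θ * Complex.I)) = 0 := by
    intro σ q
    set n : ℤ := bif σ then -(q : ℤ) else q with hn
    set H : ℝ → ℂ := fun x => ∫ θ in Set.Ioo (-Real.pi) Real.pi,
      Φ (Complex.exp (x + θ * Complex.I)) *
        Complex.exp (((2 * n : ℤ) : ℂ) * (θ * Complex.I)) with hHdef
    have hHc : Continuous H := by
      have := intervalIntegral.continuous_parametric_intervalIntegral_of_continuous'
        (μ := volume) (f := fun x θ : ℝ => Φ (Complex.exp (x + θ * Complex.I)) *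
        Complex.exp (((2 * n : ℤ) : ℂ) * (θ * Complex.I)))
        (by
          refine Continuous.mul hexpc ?_
          fun_prop) (-Real.pi) Real.pi
      refine this.congr fun x => ?_
      rw [intervalIntegral.integral_of_le (by linarith [Real.pi_pos]),
        integral_Ioc_eq_integral_Ioo]
    set k : ℝ → ℂ := fun r => (r : ℂ) ^ (2 * q) * Complex.exp (-4 * (r : ℂ) ^ 2) *
      H (Real.log r) with hk
    have hpol : ∀ (ξ : ℝ) {r : ℝ}, 0 < r → ∫ θ in Set.Ioo (-Real.pi) Real.pi,
        r • (Φ (Complex.polarCoord.symm (r, θ)) *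
          gaussTest σ q (4 + ξ * Complex.I) (Complex.polarCoord.symm (r, θ))) =
        (r : ℂ) * k r * Complex.exp (-(ξ * Complex.I) * (r : ℂ) ^ 2) := by
      intro ξ r hr
      simp only [gaussTest_polar σ q _ hr, ← hn]
      simp only [hk, hHdef, polarCoord_symm_eq_exp hr, Complex.real_smul]
      rw [show (r : ℂ) * ((r : ℂ) ^ (2 * q) * Complex.exp (-4 * (r : ℂ) ^ 2) *
        ∫ θ in Set.Ioo (-Real.pi) Real.pi, Φ (Complex.exp ((Real.log r : ℝ) + θ * Complex.I)) *
        Complex.exp (((2 * n : ℤ) : ℂ) * (θ * Complex.I))) *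
        Complex.exp (-(ξ * Complex.I) * (r : ℂ) ^ 2) =
        ((r : ℂ) * (r : ℂ) ^ (2 * q) * (Complex.exp (-4 * (r : ℂ) ^ 2) *
        Complex.exp (-(ξ * Complex.I) * (r : ℂ) ^ 2))) *
        ∫ θ in Set.Ioo (-Real.pi) Real.pi, Φ (Complex.exp ((Real.log r : ℝ) + θ * Complex.I)) *
        Complex.exp (((2 * n : ℤ) : ℂ) * (θ * Complex.I)) by ring,
        ← Complex.exp_add, ← integral_const_mul]
      refine integral_congr_ae (Eventually.of_forall fun θ => ?_)
      simp only
      rw [show -(4 + ξ * Complex.I) * (r : ℂ) ^ 2 =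
        -4 * (r : ℂ) ^ 2 + -(ξ * Complex.I) * (r : ℂ) ^ 2 by ring]
      ring
    have hkc : ContinuousOn k (Set.Ioi 0) := by
      refine ContinuousOn.mul (by fun_prop) (hHc.comp_continuousOn ?_)
      exact Real.continuousOn_log.mono fun r hr => ne_of_gt hr
    have hk0 : ∀ {r : ℝ}, 0 < r → k r = 0 := by
      refine eq_zero_of_integral_exp_sq_eq_zero hkc ?_ fun ξ => ?_
      · refine (integrableOn_integral_polar (hint σ q 0) (hcg σ q 0)).congr_fun
          (fun r hr => ?_) measurableSet_Ioi
        simp only [hpol 0 hr]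
        simp
      · rw [← h σ q ξ, integral_eq_integral_polar (hint σ q ξ) (hcg σ q ξ)]
        exact setIntegral_congr_fun measurableSet_Ioi fun r hr => (hpol ξ hr).symm
    intro r hr
    have := hk0 hr
    simp only [hk, mul_eq_zero, Complex.exp_ne_zero, or_false] at this
    rcases this with h0 | h0
    · exact absurd h0 (pow_ne_zero _ (by exact_mod_cast hr.ne'))
    · exact h0
  -- Evenness of `Φ` is periodicity with period `π` in the angle, so the even frequencies suffice.
  have hper : Function.Periodic (fun θ : ℝ =>
      Φ (Complex.exp ((Real.log ‖u‖ : ℝ) + θ * Complex.I))) Real.pi := by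
    intro θ
    simp only
    rw [← he, Complex.ofReal_add, add_mul, ← add_assoc, Complex.exp_add _ (Real.pi * Complex.I),
      Complex.exp_pi_mul_I, mul_neg_one, neg_neg]
  have hfin := eq_zero_of_periodic_of_fourier_eq_zero (hexpc.comp
    (Continuous.prodMk (continuous_const (y := Real.log ‖u‖)) continuous_id)) hper
    (fun n => by
      rcases Int.eq_nat_or_neg n with ⟨q, rfl | rfl⟩
      · exact hH false q (norm_pos_iff.mpr hu)
      · exact hH true q (norm_pos_iff.mpr hu)) (Complex.arg u)
  simp only [Function.comp_apply, id] at hfin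
  rwa [Complex.exp_add, ← Complex.ofReal_exp, Real.exp_log (norm_pos_iff.mpr hu),
    Complex.norm_mul_exp_arg_mul_I] at hfin

end

/-! ### Wirtinger derivatives and integration by parts -/

noncomputable section
open MeasureTheory Filter Topology

/-- `F` is real differentiable at `u` with `∂F/∂u = a` and `∂F/∂ū = b`. -/
def HasWirtingerAt (F : ℂ → ℂ) (a b u : ℂ) : Prop :=
  HasFDerivAt F (a • (ContinuousLinearMap.id ℝ ℂ) +
    b • (Complex.conjCLE : ℂ →L[ℝ] ℂ)) u

/-- The Wirtinger derivative `∂F/∂u`. -/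
def wirtinger (F : ℂ → ℂ) (u : ℂ) : ℂ :=
  (fderiv ℝ F u 1 - Complex.I * fderiv ℝ F u Complex.I) / 2

theorem HasWirtingerAt.wirtinger_eq {F : ℂ → ℂ} {a b u : ℂ} (h : HasWirtingerAt F a b u) :
    wirtinger F u = a := by
  rw [wirtinger, HasFDerivAt.fderiv h]
  simp
  linear_combination (b - a) / 2 * Complex.I_mul_I

theorem HasWirtingerAt.mul {F G : ℂ → ℂ} {a b a' b' u : ℂ} (h : HasWirtingerAt F a b u)
    (h' : HasWirtingerAt G a' b' u) :
    HasWirtingerAt (fun u => F u * G u) (a * G u + F u * a') (b * G u + F u * b') u := by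
  refine (HasFDerivAt.mul h h').congr_fderiv ?_
  ext 
  simp; ring

theorem HasWirtingerAt.comp {F c : ℂ → ℂ} {a b c' u : ℂ} (hc : HasDerivAt c c' (F u))
    (h : HasWirtingerAt F a b u) :
    HasWirtingerAt (fun u => c (F u)) (c' * a) (c' * b) u := by
  refine ((hc.hasFDerivAt.restrictScalars ℝ).comp u h).congr_fderiv ?_
  ext 
  simp; ring

theorem hasWirtingerAt_id (u : ℂ) : HasWirtingerAt (fun u => u) 1 0 u := by
  refine (hasFDerivAt_id u).congr_fderiv ?_
  ext
  simp

theorem hasWirtingerAt_conj (u : ℂ) : HasWirtingerAt (fun u => (starRingEnd ℂ) u) 0 1 u := by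
  refine (Complex.conjCLE.hasFDerivAt (x := u)).congr_fderiv ?_
  ext
  simp

theorem HasDerivAt.hasWirtingerAt {c : ℂ → ℂ} {c' u : ℂ} (hc : HasDerivAt c c' u) :
    HasWirtingerAt c c' 0 u := by
  have := HasWirtingerAt.comp hc (hasWirtingerAt_id u)
  simpa using this

theorem DifferentiableAt.hasWirtingerAt {F : ℂ → ℂ} {u : ℂ} (h : DifferentiableAt ℝ F u) :
    HasWirtingerAt F (wirtinger F u)
      ((fderiv ℝ F u 1 + Complex.I * fderiv ℝ F u Complex.I) / 2) u := by
  refine h.hasFDerivAt.congr_fderiv (ContinuousLinearMap.ext fun z => ?_)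
  have hz : fderiv ℝ F u z = z.re * fderiv ℝ F u 1 + z.im * fderiv ℝ F u Complex.I := by
    conv_lhs => rw [show z = z.re • (1 : ℂ) + z.im • Complex.I by simp]
    rw [map_add, map_smul, map_smul, Complex.real_smul, Complex.real_smul]
  rw [hz]
  simp only [wirtinger, add_apply, smul_apply,
    ContinuousLinearMap.id_apply, ContinuousLinearEquiv.coe_coe, Complex.conjCLE_apply,
    smul_eq_mul]
  have h1 := Complex.re_add_im z
  have h2 : (starRingEnd ℂ) z = z.re - z.im * Complex.I := by
    apply Complex.ext <;> simp
  rw [h2]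
  nth_rw 3 [← h1]
  linear_combination (z.im * fderiv ℝ F u Complex.I) * Complex.I_mul_I

theorem HasWirtingerAt.congr_of_eventuallyEq {F G : ℂ → ℂ} {a b u : ℂ}
    (h : HasWirtingerAt F a b u) (hG : G =ᶠ[𝓝 u] F) : HasWirtingerAt G a b u :=
  HasFDerivAt.congr_of_eventuallyEq h hG

theorem integrable_mul_of_zero_notMem_tsupport {F g : ℂ → ℂ} (hF : ContinuousOn F {0}ᶜ)
    (hg : Continuous g) (hc : HasCompactSupport g) (h0 : (0 : ℂ) ∉ tsupport g) :
    Integrable fun u => F u * g u := by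
  have hsub : tsupport (fun u => F u * g u) ⊆ tsupport g := tsupport_mul_subset_right
  refine Continuous.integrable_of_hasCompactSupport ?_ hc.mul_left
  refine continuous_iff_continuousAt.mpr fun u => ?_
  by_cases hu : u ∈ tsupport fun u => F u * g u
  swap
  · exact continuousAt_const.congr (notMem_tsupport_iff_eventuallyEq.mp hu).symm
  have hu0 : u ≠ 0 := fun h => h0 (h ▸ hsub hu)
  exact (hF.continuousAt (isOpen_compl_singleton.mem_nhds hu0)).mul hg.continuousAt

theorem integral_wirtinger_mul {F g : ℂ → ℂ} (hF : ContDiffOn ℝ 1 F {0}ᶜ)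
    (hg : ContDiff ℝ 1 g) (hc : HasCompactSupport g) (h0 : (0 : ℂ) ∉ tsupport g) :
    ∫ u, wirtinger F u * g u = -∫ u, F u * wirtinger g u := by
  have hFd := hF.continuousOn_fderiv_of_isOpen isOpen_compl_singleton le_rfl
  have hgd := hg.continuous_fderiv one_ne_zero
  have h1 : ∀ v : ℂ, Integrable fun u => fderiv ℝ F u v * g u := fun v =>
    integrable_mul_of_zero_notMem_tsupport (by fun_prop) hg.continuous hc h0
  have h2 : ∀ v : ℂ, Integrable fun u => F u * fderiv ℝ g u v := fun v =>
    integrable_mul_of_zero_notMem_tsupport hF.continuousOn (by fun_prop)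
      (hc.fderiv_apply ℝ v) fun h => h0 (tsupport_fderiv_apply_subset ℝ v h)
  have key : ∀ v : ℂ, ∫ u, F u * fderiv ℝ g u v = -∫ u, fderiv ℝ F u v * g u := fun v =>
    integral_mul_fderiv_eq_neg_fderiv_mul_of_integrable (h1 v) (h2 v)
      (integrable_mul_of_zero_notMem_tsupport hF.continuousOn hg.continuous hc h0)
      (fun u hu => (hF.differentiableOn one_ne_zero).differentiableAt
        (isOpen_compl_singleton.mem_nhds fun h => h0 (h ▸ hu)))
      (fun u _ => hg.differentiable one_ne_zero u)
  have e1 : ∀ u, wirtinger F u * g u = 1 / 2 * (fderiv ℝ F u 1 * g u) -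
      Complex.I / 2 * (fderiv ℝ F u Complex.I * g u) := fun u => by
    rw [wirtinger]; ring
  have e2 : ∀ u, F u * wirtinger g u = 1 / 2 * (F u * fderiv ℝ g u 1) -
      Complex.I / 2 * (F u * fderiv ℝ g u Complex.I) := fun u => by
    rw [wirtinger]; ring
  simp only [e1, e2]
  rw [integral_sub ((h1 1).const_mul _) ((h1 Complex.I).const_mul _),
    integral_sub ((h2 1).const_mul _) ((h2 Complex.I).const_mul _)]
  simp only [integral_const_mul, key]
  ring

/-- The operator `u ∂/∂u`. -/
def euler (F : ℂ → ℂ) (u : ℂ) : ℂ := u * wirtinger F u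

/-- Smooth functions with compact support in `ℂ^×`. -/
def IsTestFunction (f : ℂ → ℂ) : Prop :=
  ContDiff ℝ (⊤ : ℕ∞) f ∧ HasCompactSupport f ∧ (0 : ℂ) ∉ tsupport f

theorem IsTestFunction.euler {f : ℂ → ℂ} (hf : IsTestFunction f) : IsTestFunction (euler f) := by
  obtain ⟨h1, h2, h3⟩ := hf
  have hsub : Function.support (_root_.euler f) ⊆ tsupport f := by
    intro u hu
    by_contra h
    apply hu
    simp [_root_.euler, wirtinger, fderiv_of_notMem_tsupport ℝ h]
  refine ⟨?_, h2.mono' hsub, fun h => h3 (closure_minimal hsub isClosed_closure h)⟩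
  have : ContDiff ℝ (⊤ : ℕ∞) (fderiv ℝ f) := h1.fderiv_right (by simp)
  unfold _root_.euler wirtinger
  have h4 : ∀ v : ℂ, ContDiff ℝ (⊤ : ℕ∞) fun u => fderiv ℝ f u v := fun v =>
    this.clm_apply contDiff_const
  exact contDiff_id.mul (((h4 1).sub (contDiff_const.mul (h4 Complex.I))).div_const _)

/-- The multiplier may be singular at `0`, since the test function vanishes near `0`. -/
theorem IsTestFunction.mul_of_contDiffOn {f c : ℂ → ℂ} (hf : IsTestFunction f)
    (hc : ContDiffOn ℝ (⊤ : ℕ∞) c {0}ᶜ) : IsTestFunction fun u => c u * f u := by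
  obtain ⟨h1, h2, h3⟩ := hf
  have hsub : tsupport (fun u => c u * f u) ⊆ tsupport f := tsupport_mul_subset_right
  refine ⟨contDiff_iff_contDiffAt.mpr fun u => ?_, h2.mul_left, fun h => h3 (hsub h)⟩
  by_cases hu : u ∈ tsupport fun u => c u * f u
  swap
  · exact contDiffAt_const.congr_of_eventuallyEq (notMem_tsupport_iff_eventuallyEq.mp hu)
  have hu0 : u ≠ 0 := fun h => h3 (h ▸ hsub hu)
  exact (hc.contDiffAt (isOpen_compl_singleton.mem_nhds hu0)).mul h1.contDiffAt

theorem IsTestFunction.add {f g : ℂ → ℂ} (hf : IsTestFunction f) (hg : IsTestFunction g) :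
    IsTestFunction fun u => f u + g u :=
  ⟨hf.1.add hg.1, hf.2.1.add hg.2.1, fun h => by
    rcases tsupport_add f g h with h | h
    · exact hf.2.2 h
    · exact hg.2.2 h⟩

theorem lebesgueDensity_eq (f : ℂ → ℂ) (u : ℂ) :
    lebesgueDensity f u = u⁻¹ * (((starRingEnd ℂ) u)⁻¹ * f u) := by
  rw [lebesgueDensity, ← mul_assoc, ← mul_inv, Complex.mul_conj, Complex.normSq_eq_norm_sq]
  push_cast
  rfl

theorem contDiffOn_inv_conj : ContDiffOn ℝ (⊤ : ℕ∞) (fun u : ℂ => ((starRingEnd ℂ) u)⁻¹) {0}ᶜ := by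
  refine ContDiffOn.inv (Complex.conjCLE.contDiff.contDiffOn) fun u hu => ?_
  simpa using hu

/-- `u ∂/∂u` is antisymmetric for the measure `|u|⁻² du`. -/
theorem integral_euler_mul_lebesgueDensity {F f : ℂ → ℂ} (hF : ContDiffOn ℝ 1 F {0}ᶜ)
    (hf : IsTestFunction f) :
    ∫ u, euler F u * lebesgueDensity f u = -∫ u, F u * lebesgueDensity (euler f) u := by
  -- The factor `u` of the Euler operator cancels half of the density `1/(u ū)`; the other half is
  -- antiholomorphic and commutes with `∂/∂u`.
  have hg := hf.mul_of_contDiffOn contDiffOn_inv_conj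
  have h := integral_wirtinger_mul hF (hg.1.of_le (by exact_mod_cast le_top)) hg.2.1 hg.2.2
  have e1 : ∫ u, euler F u * lebesgueDensity f u =
      ∫ u, wirtinger F u * (((starRingEnd ℂ) u)⁻¹ * f u) := by
    refine integral_congr_ae ?_
    filter_upwards [ae_ne_zero] with u hu
    rw [lebesgueDensity_eq, euler]
    field_simp
  have e2 : ∫ u, F u * lebesgueDensity (euler f) u =
      ∫ u, F u * wirtinger (fun u => ((starRingEnd ℂ) u)⁻¹ * f u) u := by
    refine integral_congr_ae ?_
    filter_upwards [ae_ne_zero] with u hu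
    have hcu : (starRingEnd ℂ) u ≠ 0 := by simpa using hu
    have h1 := HasWirtingerAt.comp (c := fun z => z⁻¹) (hasDerivAt_inv hcu) (hasWirtingerAt_conj u)
    have h2 := (hf.1.differentiable (by simp) u).hasWirtingerAt
    rw [(h1.mul h2).wirtinger_eq, lebesgueDensity_eq, euler]
    field_simp
    ring
  rw [e1, e2, h]

end

/-! ### Bessel's differential equation for the kernel -/

noncomputable section
open MeasureTheory Filter Topology

/-- The factor of `𝒥_{ν,p}` complementary to `J*_{ν-p}(u)`. -/
def kernelModulus (ν : ℂ) (p : ℤ) (u : ℂ) : ℂ :=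
  (u / 2 * (starRingEnd ℂ) (u / 2)) ^ (ν + p) * (u / 2) ^ (-2 * p) *
    clifford (ν + p) (-((starRingEnd ℂ) u / 2) ^ 2)

theorem mul_conj_mem_slitPlane {u : ℂ} (hu : u ≠ 0) :
    u / 2 * (starRingEnd ℂ) (u / 2) ∈ Complex.slitPlane := by
  rw [Complex.mul_conj]
  left
  rw [Complex.ofReal_re]
  exact Complex.normSq_pos.mpr (by simpa using hu)

theorem besselJKernel_eq_kernelModulus_mul (ν : ℂ) (p : ℤ) {u : ℂ} (hu : u ≠ 0) :
    besselJKernel ν p u = kernelModulus ν p u * clifford (ν - p) (-(u / 2) ^ 2) := by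
  have hr0 := norm_half_ne_zero hu
  have hr : 0 < ‖u / 2‖ := by
    rw [norm_pos_iff]; simpa using hu
  have h1 : (u / 2 * (starRingEnd ℂ) (u / 2)) ^ (ν + p) =
      ((‖u / 2‖ : ℝ) : ℂ) ^ (2 * ν) * ((‖u / 2‖ : ℝ) : ℂ) ^ (2 * p) := by
    rw [Complex.mul_conj, Complex.normSq_eq_norm_sq, sq, Complex.ofReal_mul,
      Complex.mul_cpow_ofReal_nonneg hr.le hr.le, Complex.cpow_add _ _ hr0, two_mul ν,
      Complex.cpow_add _ _ hr0, Complex.cpow_intCast, two_mul p, zpow_add₀ hr0]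
    ring
  have h2 : (u / ((‖u‖ : ℝ) : ℂ)) ^ (-2 * p) =
      ((‖u / 2‖ : ℝ) : ℂ) ^ (2 * p) * (u / 2) ^ (-2 * p) := by
    have : u / ((‖u‖ : ℝ) : ℂ) = (((‖u / 2‖ : ℝ) : ℂ))⁻¹ * (u / 2) := by
      have : ((‖u‖ : ℝ) : ℂ) ≠ 0 := by simpa using hu
      rw [norm_div, Complex.norm_ofNat]
      push_cast
      field_simp
    rw [this, mul_zpow, inv_zpow', neg_mul, neg_neg]
  rw [besselJKernel, kernelModulus, h1, h2, besselJStar_eq_clifford, besselJStar_eq_clifford]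
  ring

theorem hasDerivAt_clifford_sq (μ u : ℂ) : HasDerivAt (fun u => clifford μ (-(u / 2) ^ 2))
    (clifford (μ + 1) (-(u / 2) ^ 2) * -(u / 2)) u := by
  have h := (hasDerivAt_clifford μ (-(u / 2) ^ 2)).comp u
    ((((hasDerivAt_id u).div_const 2).pow 2).neg)
  refine h.congr_deriv ?_
  simp only [Nat.cast_ofNat, id_eq, Nat.add_one_sub_one, pow_one]
  ring

/-- As far as `∂/∂u` is concerned, the function behaves like `u^(ν-p)`: the exponent is `ν + p` from
the modulus and `-2p` from the power, and the Clifford factor is antiholomorphic. The conjugate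
derivative is never needed and stays existential. -/
theorem hasWirtingerAt_kernelModulus (ν : ℂ) (p : ℤ) {u : ℂ} (hu : u ≠ 0) :
    ∃ b, HasWirtingerAt (kernelModulus ν p) ((ν - p) * kernelModulus ν p u / u) b u := by
  have hs := mul_conj_mem_slitPlane hu
  have hhalf : HasDerivAt (fun u : ℂ => u / 2) (1 / 2) u := (hasDerivAt_id u).div_const 2
  have h2 : u / 2 ≠ 0 := by simpa using hu
  have h2c : (starRingEnd ℂ) (u / 2) ≠ 0 := by simpa using hu
  have hc := HasWirtingerAt.comp (c := fun z => z / 2)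
    ((hasDerivAt_id ((starRingEnd ℂ) u)).div_const 2) (hasWirtingerAt_conj u)
  have hN := hhalf.hasWirtingerAt.mul hc
  have e : ∀ z : ℂ, (starRingEnd ℂ) z / 2 = (starRingEnd ℂ) (z / 2) := fun z => by
    simp only [map_div₀, map_ofNat]
  simp only [e] at hN
  have hA := HasWirtingerAt.comp (c := fun z => z ^ (ν + p))
    (F := fun u => u / 2 * (starRingEnd ℂ) (u / 2))
    (Complex.hasStrictDerivAt_cpow_const hs).hasDerivAt hN
  have hB : HasWirtingerAt (fun u => (u / 2) ^ (-2 * p))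
      (((-2 * p : ℤ) : ℂ) * (u / 2) ^ (-2 * p - 1) * (1 / 2)) 0 u :=
    (HasDerivAt.comp (h₂ := fun z : ℂ => z ^ (-2 * p)) u
      (hasDerivAt_zpow (-2 * p) (u / 2) (Or.inl h2)) hhalf).hasWirtingerAt
  have hD := HasWirtingerAt.comp (hasDerivAt_clifford_sq (ν + p) ((starRingEnd ℂ) u))
    (hasWirtingerAt_conj u)
  have hM := (hA.mul hB).mul hD
  refine ⟨_, (congrArg (fun a => HasWirtingerAt _ a _ u) ?_).mp hM⟩
  simp only [kernelModulus, mul_zero, add_zero]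
  rw [Complex.cpow_sub _ _ (Complex.slitPlane_ne_zero hs), Complex.cpow_one, zpow_sub_one₀ h2]
  generalize (u / 2 * (starRingEnd ℂ) (u / 2)) ^ (ν + p) = X
  generalize (u / 2) ^ (-2 * p) = Y
  generalize clifford (ν + p) (-((starRingEnd ℂ) u / 2) ^ 2) = Z
  generalize (starRingEnd ℂ) (u / 2) = w at h2c ⊢
  push_cast
  field_simp
  ring

theorem contDiff_clifford (μ : ℂ) : ContDiff ℝ (⊤ : ℕ∞) (clifford μ) := by
  have : Differentiable ℂ (clifford μ) := fun y => (hasDerivAt_clifford μ y).differentiableAt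
  exact (this.contDiff (n := (⊤ : ℕ∞))).restrict_scalars ℝ

theorem contDiffOn_kernelModulus (ν : ℂ) (p : ℤ) :
    ContDiffOn ℝ (⊤ : ℕ∞) (kernelModulus ν p) {0}ᶜ := by
  intro u hu
  have hu : u ≠ 0 := hu
  refine ContDiffAt.contDiffWithinAt ?_
  have hconj : ContDiff ℝ (⊤ : ℕ∞) (starRingEnd ℂ : ℂ → ℂ) := Complex.conjCLE.contDiff
  have hhalf : ContDiff ℝ (⊤ : ℕ∞) fun u : ℂ => u / 2 := contDiff_id.div_const _
  refine ContDiffAt.mul (ContDiffAt.mul ?_ ?_) ?_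
  · have h1 : ContDiffAt ℂ (⊤ : ℕ∞) (fun z : ℂ => z ^ (ν + p))
        (u / 2 * (starRingEnd ℂ) (u / 2)) :=
      (AnalyticAt.cpow analyticAt_id analyticAt_const (mul_conj_mem_slitPlane hu)).contDiffAt
    exact (h1.restrict_scalars ℝ).comp u
      (hhalf.mul (hconj.comp hhalf)).contDiffAt
  · have h1 : ContDiffAt ℂ (⊤ : ℕ∞) (fun z : ℂ => z ^ (-2 * p)) (u / 2) :=
      (AnalyticAt.zpow analyticAt_id (by simpa using hu)).contDiffAt
    exact (h1.restrict_scalars ℝ).comp u hhalf.contDiffAt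
  · exact ((contDiff_clifford _).comp ((hhalf.comp hconj).pow 2).neg).contDiffAt

/-- `u ∂/∂u` applied to `𝒥_{ν,p}`. -/
def eulerKernel (ν : ℂ) (p : ℤ) (u : ℂ) : ℂ :=
  kernelModulus ν p u * ((ν - p) * clifford (ν - p) (-(u / 2) ^ 2) +
    2 * -(u / 2) ^ 2 * clifford (ν - p + 1) (-(u / 2) ^ 2))

theorem hasWirtingerAt_besselJKernel (ν : ℂ) (p : ℤ) {u : ℂ} (hu : u ≠ 0) :
    ∃ b, HasWirtingerAt (besselJKernel ν p) (eulerKernel ν p u / u) b u := by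
  obtain ⟨b, hb⟩ := hasWirtingerAt_kernelModulus ν p hu
  have h := hb.mul (hasDerivAt_clifford_sq (ν - p) u).hasWirtingerAt
  have h' := h.congr_of_eventuallyEq (G := besselJKernel ν p) (by
    filter_upwards [isOpen_compl_singleton.mem_nhds hu] with v hv
    exact besselJKernel_eq_kernelModulus_mul ν p hv)
  refine ⟨_, (congrArg (fun a => HasWirtingerAt _ a _ u) ?_).mp h'⟩
  rw [eulerKernel]
  field_simp

/-- The derivative brings in the Clifford function of index `ν - p + 2`, which the recurrence at `ν
- p + 1` eliminates. This is Bessel's equation of order `ν - p` in the holomorphic variable. -/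
theorem hasWirtingerAt_eulerKernel (ν : ℂ) (p : ℤ) {u : ℂ} (hu : u ≠ 0) :
    ∃ b, HasWirtingerAt (eulerKernel ν p)
      (((ν - p) ^ 2 - u ^ 2) * besselJKernel ν p u / u) b u := by
  obtain ⟨b, hb⟩ := hasWirtingerAt_kernelModulus ν p hu
  have hy : HasDerivAt (fun u : ℂ => 2 * -(u / 2) ^ 2) (-u) u := by
    refine (((((hasDerivAt_id u).div_const 2).pow 2).neg).const_mul 2).congr_deriv ?_
    simp only [Nat.cast_ofNat, id_eq, Nat.add_one_sub_one, pow_one]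
    ring
  have h := hb.mul (((hasDerivAt_clifford_sq (ν - p) u).const_mul (ν - p)).add
    (hy.mul (hasDerivAt_clifford_sq (ν - p + 1) u))).hasWirtingerAt
  refine ⟨_, (congrArg (fun a => HasWirtingerAt _ a _ u) ?_).mp h⟩
  have hrec := clifford_recurrence (ν - p + 1) (-(u / 2) ^ 2)
  rw [add_sub_cancel_right] at hrec
  rw [besselJKernel_eq_kernelModulus_mul ν p hu, hrec]
  simp only [Pi.add_apply, Pi.mul_apply]
  rw [hrec]
  field_simp
  ring

theorem contDiffOn_clifford_sq (μ : ℂ) (s : Set ℂ) :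
    ContDiffOn ℝ (⊤ : ℕ∞) (fun u => clifford μ (-(u / 2) ^ 2)) s :=
  ((contDiff_clifford μ).comp ((contDiff_id.div_const 2).pow 2).neg).contDiffOn

theorem contDiffOn_besselJKernel (ν : ℂ) (p : ℤ) :
    ContDiffOn ℝ (⊤ : ℕ∞) (besselJKernel ν p) {0}ᶜ :=
  ((contDiffOn_kernelModulus ν p).mul (contDiffOn_clifford_sq (ν - p) _)).congr
    fun _ hu => besselJKernel_eq_kernelModulus_mul ν p hu

theorem contDiffOn_eulerKernel (ν : ℂ) (p : ℤ) :
    ContDiffOn ℝ (⊤ : ℕ∞) (eulerKernel ν p) {0}ᶜ :=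
  (contDiffOn_kernelModulus ν p).mul ((contDiffOn_const.mul (contDiffOn_clifford_sq _ _)).add
    ((contDiff_const.mul ((contDiff_id.div_const 2).pow 2).neg).contDiffOn.mul
      (contDiffOn_clifford_sq _ _)))

/-- The differential equation of `𝒥_{ν,p}`, in weak form. -/
theorem integral_besselJKernel_mul_euler_euler (ν : ℂ) (p : ℤ) {f : ℂ → ℂ}
    (hf : IsTestFunction f) :
    ∫ u, besselJKernel ν p u * lebesgueDensity (euler (euler f)) u =
      ∫ u, ((ν - p) ^ 2 - u ^ 2) * besselJKernel ν p u * lebesgueDensity f u := by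
  have h1 := integral_euler_mul_lebesgueDensity
    ((contDiffOn_besselJKernel ν p).of_le (by exact_mod_cast le_top)) hf.euler
  have h2 := integral_euler_mul_lebesgueDensity
    ((contDiffOn_eulerKernel ν p).of_le (by exact_mod_cast le_top)) hf
  have e1 : ∫ u, euler (besselJKernel ν p) u * lebesgueDensity (euler f) u =
      ∫ u, eulerKernel ν p u * lebesgueDensity (euler f) u := by
    refine integral_congr_ae ?_
    filter_upwards [ae_ne_zero] with u hu
    obtain ⟨b, hb⟩ := hasWirtingerAt_besselJKernel ν p hu
    rw [euler, hb.wirtinger_eq, mul_div_cancel₀ _ hu]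
  have e2 : ∫ u, euler (eulerKernel ν p) u * lebesgueDensity f u =
      ∫ u, ((ν - p) ^ 2 - u ^ 2) * besselJKernel ν p u * lebesgueDensity f u := by
    refine integral_congr_ae ?_
    filter_upwards [ae_ne_zero] with u hu
    obtain ⟨b, hb⟩ := hasWirtingerAt_eulerKernel ν p hu
    rw [euler, hb.wirtinger_eq, mul_div_cancel₀ _ hu]
  rw [← e2, h2, ← e1, h1, neg_neg]

end

/-! ### Rapid decay of the Bessel transform -/

noncomputable section
open MeasureTheory Filter Topology

/-- The differential operator `(u ∂/∂u)² + u²`. -/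
def besselOperator (f : ℂ → ℂ) (u : ℂ) : ℂ := euler (euler f) u + u ^ 2 * f u

theorem IsTestFunction.besselOperator {f : ℂ → ℂ} (hf : IsTestFunction f) :
    IsTestFunction (besselOperator f) :=
  hf.euler.euler.add (hf.mul_of_contDiffOn (contDiff_id.pow 2).contDiffOn)

theorem IsTestFunction.integrable_mul_lebesgueDensity {F f : ℂ → ℂ} (hf : IsTestFunction f)
    (hF : ContinuousOn F {0}ᶜ) : Integrable fun u => F u * lebesgueDensity f u :=
  integrable_mul_of_zero_notMem_tsupport hF
    (continuous_lebesgueDensity hf.1.continuous hf.2.2)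
    (hasCompactSupport_lebesgueDensity hf.2.1)
    fun h => hf.2.2 (tsupport_lebesgueDensity_subset f h)

theorem integral_besselJKernel_mul_besselOperator (ν : ℂ) (p : ℤ) {f : ℂ → ℂ}
    (hf : IsTestFunction f) :
    ∫ u, besselJKernel ν p u * lebesgueDensity (besselOperator f) u =
      (ν - p) ^ 2 * ∫ u, besselJKernel ν p u * lebesgueDensity f u := by
  have hJ := (contDiffOn_besselJKernel ν p).continuousOn
  have h := integral_besselJKernel_mul_euler_euler ν p hf
  have e : ∀ u, besselJKernel ν p u * lebesgueDensity (besselOperator f) u =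
      besselJKernel ν p u * lebesgueDensity (euler (euler f)) u +
        u ^ 2 * besselJKernel ν p u * lebesgueDensity f u := fun u => by
    simp only [lebesgueDensity, besselOperator]; ring
  simp only [e]
  have i1 : Integrable fun u => u ^ 2 * besselJKernel ν p u * lebesgueDensity f u :=
    hf.integrable_mul_lebesgueDensity (by fun_prop)
  have i2 : Integrable fun u => ((ν - p) ^ 2 - u ^ 2) * besselJKernel ν p u *
      lebesgueDensity f u := hf.integrable_mul_lebesgueDensity (by fun_prop)
  rw [integral_add (hf.euler.euler.integrable_mul_lebesgueDensity hJ) i1, h,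
    ← integral_add i2 i1, ← integral_const_mul]
  exact integral_congr_ae (Eventually.of_forall fun u => by ring)

theorem besselKTransform_eq_div {ν : ℂ} (h : Complex.sin (Real.pi * ν) ≠ 0) (p : ℤ) {f : ℂ → ℂ}
    (hf : IsTestFunction f) :
    besselKTransform f ν p = ((∫ u, besselJKernel (-ν) (-p) u * lebesgueDensity f u) -
      ∫ u, besselJKernel ν p u * lebesgueDensity f u) / Complex.sin (Real.pi * ν) := by
  rw [besselKTransform_eq, ← integral_sub
    (hf.integrable_mul_lebesgueDensity (contDiffOn_besselJKernel _ _).continuousOn)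
    (hf.integrable_mul_lebesgueDensity (contDiffOn_besselJKernel _ _).continuousOn),
    ← integral_div]
  refine integral_congr_ae (Eventually.of_forall fun u => ?_)
  simp only [besselK_of_sin_ne_zero h, besselKQuotient]
  ring

/-- The two halves of the kernel have the same eigenvalue, as `(-ν + p)² = (ν - p)²`. -/
theorem besselKTransform_besselOperator {ν : ℂ} (h : Complex.sin (Real.pi * ν) ≠ 0) (p : ℤ)
    {f : ℂ → ℂ} (hf : IsTestFunction f) :
    besselKTransform (besselOperator f) ν p = (ν - p) ^ 2 * besselKTransform f ν p := by
  rw [besselKTransform_eq_div h p hf, besselKTransform_eq_div h p hf.besselOperator,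
    integral_besselJKernel_mul_besselOperator ν p hf,
    integral_besselJKernel_mul_besselOperator (-ν) (-p) hf]
  push_cast
  ring

theorem sin_pi_mul_I_ne_zero {t : ℝ} (ht : t ≠ 0) :
    Complex.sin (Real.pi * (t * Complex.I)) ≠ 0 := by
  rw [Ne, sin_pi_mul_eq_zero_iff]
  rintro ⟨n, hn⟩
  have := congrArg Complex.im hn
  simp at this
  exact ht this

theorem IsTestFunction.integrable_growth_mul_norm {f : ℂ → ℂ} (hf : IsTestFunction f) :
    Integrable fun u => growth u * ‖lebesgueDensity f u‖ := by
  have hc : ContinuousOn (fun u => ((growth u : ℝ) : ℂ)) {0}ᶜ := by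
    unfold growth
    refine Complex.continuous_ofReal.comp_continuousOn (ContinuousOn.mul ?_ (by fun_prop))
    exact continuous_norm.continuousOn.add
      (continuous_norm.continuousOn.inv₀ fun u hu => norm_ne_zero_iff.mpr hu)
  refine (hf.integrable_mul_lebesgueDensity hc).norm.congr (Eventually.of_forall fun u => ?_)
  simp only [norm_mul, Complex.norm_real, Real.norm_of_nonneg (growth_nonneg u)]

theorem exists_norm_besselKTransform_le {f : ℂ → ℂ} (hf : IsTestFunction f) :
    ∃ C : ℝ, 0 ≤ C ∧ ∀ (t : ℝ) (p : ℤ),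
      ‖besselKTransform f (t * Complex.I) p‖ ≤ C * (1 + |(p : ℝ)|) := by
  obtain ⟨C, hC0, hC⟩ := exists_norm_besselK_le
  refine ⟨C * ∫ u, growth u * ‖lebesgueDensity f u‖, mul_nonneg hC0
    (integral_nonneg fun u => mul_nonneg (growth_nonneg u) (norm_nonneg _)), fun t p => ?_⟩
  rw [besselKTransform_eq]
  calc _ ≤ ∫ u, C * (1 + |(p : ℝ)|) * (growth u * ‖lebesgueDensity f u‖) := by
        refine norm_integral_le_of_norm_le (hf.integrable_growth_mul_norm.const_mul _) ?_
        filter_upwards [ae_ne_zero] with u hu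
        rw [norm_mul, ← mul_assoc]
        exact mul_le_mul_of_nonneg_right (hC t p u hu) (norm_nonneg _)
    _ = _ := by rw [integral_const_mul]; ring

theorem norm_mul_I_sub_intCast_sq (t : ℝ) (p : ℤ) :
    ‖(t * Complex.I - p) ^ 2‖ = (p : ℝ) ^ 2 + t ^ 2 := by
  rw [norm_pow, ← Complex.normSq_eq_norm_sq, Complex.normSq_apply]
  simp
  ring

/-- Rapid decay of the Bessel transform of a test function. -/
theorem exists_pow_mul_norm_besselKTransform_le (n : ℕ) : ∀ {f : ℂ → ℂ}, IsTestFunction f →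
    ∃ C : ℝ, 0 ≤ C ∧ ∀ (t : ℝ) (p : ℤ), t ≠ 0 →
      (1 + ((p : ℝ) ^ 2 + t ^ 2)) ^ n * ‖besselKTransform f (t * Complex.I) p‖ ≤
        C * (1 + |(p : ℝ)|) := by
  induction n with
  | zero =>
    intro f hf
    obtain ⟨C, hC0, hC⟩ := exists_norm_besselKTransform_le hf
    exact ⟨C, hC0, fun t p _ => by simpa using hC t p⟩
  | succ n ih =>
    intro f hf
    obtain ⟨C, hC0, hC⟩ := ih hf
    obtain ⟨C', hC0', hC'⟩ := ih hf.besselOperator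
    refine ⟨C + C', add_nonneg hC0 hC0', fun t p ht => ?_⟩
    -- On the line, `|(it - p)²| = p² + t²`, so each use of `besselOperator` gains one power of the
    -- weight.
    have h := hC' t p ht
    rw [besselKTransform_besselOperator (sin_pi_mul_I_ne_zero ht) p hf, norm_mul,
      norm_mul_I_sub_intCast_sq] at h
    calc _ = (1 + ((p : ℝ) ^ 2 + t ^ 2)) ^ n * ‖besselKTransform f (t * Complex.I) p‖ +
          (1 + ((p : ℝ) ^ 2 + t ^ 2)) ^ n *
            (((p : ℝ) ^ 2 + t ^ 2) * ‖besselKTransform f (t * Complex.I) p‖) := by ring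
      _ ≤ _ := by linarith [hC t p ht]

theorem exists_norm_besselKTransform_mul_le {f : ℂ → ℂ} (hf : IsTestFunction f) :
    ∃ C : ℝ, 0 ≤ C ∧ ∀ (t : ℝ) (p : ℤ), t ≠ 0 →
      ‖besselKTransform f (t * Complex.I) p * ((p : ℂ) ^ 2 + (t : ℂ) ^ 2)‖ * (1 + |(p : ℝ)|) ≤
        C * ((1 + t ^ 2)⁻¹ * (1 + (p : ℝ) ^ 2)⁻¹) := by
  obtain ⟨C, hC0, hC⟩ := exists_pow_mul_norm_besselKTransform_le 4 hf
  refine ⟨2 * C, by positivity, fun t p ht => ?_⟩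
  have hn : ‖(p : ℂ) ^ 2 + (t : ℂ) ^ 2‖ = (p : ℝ) ^ 2 + t ^ 2 := by
    rw [show (p : ℂ) ^ 2 + (t : ℂ) ^ 2 = (((p : ℝ) ^ 2 + t ^ 2 : ℝ) : ℂ) by push_cast; rfl,
      Complex.norm_real, Real.norm_of_nonneg (by positivity)]
  rw [norm_mul, hn, ← mul_inv, ← div_eq_mul_inv, le_div_iff₀ (by positivity)]
  set x := (p : ℝ) ^ 2 + t ^ 2 with hx
  set N := ‖besselKTransform f (t * Complex.I) p‖ with hN
  have hN0 : 0 ≤ N := norm_nonneg _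
  have hx0 : 0 ≤ x := by positivity
  have h1 : (1 + |(p : ℝ)|) ^ 2 ≤ 2 * (1 + x) := by
    have := sq_abs (p : ℝ)
    nlinarith [sq_nonneg (1 - |(p : ℝ)|), sq_nonneg t]
  have h2 : (1 + t ^ 2) * (1 + (p : ℝ) ^ 2) ≤ (1 + x) ^ 2 := by
    nlinarith [sq_nonneg t, sq_nonneg (p : ℝ), sq_nonneg ((p : ℝ) ^ 2), sq_nonneg (t ^ 2),
      mul_nonneg (sq_nonneg t) (sq_nonneg (p : ℝ))]
  have h3 := hC t p ht
  rw [← hN, ← hx] at h3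
  have hp : 0 < 1 + |(p : ℝ)| := by positivity
  have h4 : (1 + x) * (N * x * (1 + |(p : ℝ)|) * ((1 + t ^ 2) * (1 + (p : ℝ) ^ 2))) ≤
      (1 + x) * (2 * C) := by
    calc _ ≤ (1 + x) * (N * (1 + x) * (1 + |(p : ℝ)|) * (1 + x) ^ 2) := by
          gcongr
          linarith
      _ = ((1 + x) ^ 4 * N) * (1 + |(p : ℝ)|) := by ring
      _ ≤ C * (1 + |(p : ℝ)|) * (1 + |(p : ℝ)|) := by gcongr
      _ = C * (1 + |(p : ℝ)|) ^ 2 := by ring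
      _ ≤ C * (2 * (1 + x)) := by gcongr
      _ = _ := by ring
  exact le_of_mul_le_mul_left h4 (by positivity)

end

/-! ### Convergence of the inverse transform and Fubini's theorem -/

noncomputable section
open MeasureTheory Filter Topology

theorem integrable_mul_of_norm_le_growth {Φ g : ℂ → ℂ} {C : ℝ} (hc : ContinuousOn Φ {0}ᶜ)
    (hb : ∀ u, u ≠ 0 → ‖Φ u‖ ≤ C * growth u) (hg : AEStronglyMeasurable g volume)
    (hi : Integrable fun u => growth u * ‖g u‖) : Integrable fun u => Φ u * g u := by
  refine (hi.const_mul C).mono' ((aestronglyMeasurable_of_continuousOn_compl_zero hc).mul hg) ?_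
  filter_upwards [ae_ne_zero] with u hu
  rw [norm_mul, ← mul_assoc]
  exact mul_le_mul_of_nonneg_right (hb u hu) (norm_nonneg _)

theorem one_le_growth {u : ℂ} (hu : u ≠ 0) : 1 ≤ growth u := by
  have hn : 0 < ‖u‖ := norm_pos_iff.mpr hu
  have h1 : 1 ≤ ‖u‖ + ‖u‖⁻¹ := by
    rcases le_total 1 ‖u‖ with h | h
    · linarith [inv_pos.mpr hn]
    · linarith [(one_le_inv₀ hn).mpr h]
  exact one_le_mul_of_one_le_of_one_le h1 (Real.one_le_exp (by positivity))

theorem ae_ne_zero_real : ∀ᵐ t : ℝ, t ≠ 0 := by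
  simp [ae_iff]

/-- Functions on the spectral side that decay sufficiently for the inverse transform to
converge. -/
def IsDecaying (N : ℝ → ℤ → ℂ) : Prop :=
  (∀ p, AEStronglyMeasurable (fun t => N t p) volume) ∧ ∃ C : ℝ, 0 ≤ C ∧ ∀ (t : ℝ) (p : ℤ),
    t ≠ 0 → ‖N t p‖ * (1 + |(p : ℝ)|) ≤ C * ((1 + t ^ 2)⁻¹ * (1 + (p : ℝ) ^ 2)⁻¹)

/-- The inverse transform, up to a constant factor. -/
def kernelSum (N : ℝ → ℤ → ℂ) (u : ℂ) : ℂ :=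
  ∑' p : ℤ, ∫ t : ℝ, besselK (t * Complex.I) p u * N t p

theorem summable_inv_one_add_sq : Summable fun p : ℤ => (1 + (p : ℝ) ^ 2)⁻¹ := by
  refine Summable.of_norm_bounded_eventually (g := fun p : ℤ => 1 / (p : ℝ) ^ 2)
    (Real.summable_one_div_int_pow.mpr one_lt_two) ?_
  have : ∀ᶠ p : ℤ in cofinite, p ≠ 0 := by
    exact (Set.finite_singleton (0 : ℤ)).compl_mem_cofinite
  filter_upwards [this] with p hp
  have hp' : (0 : ℝ) < (p : ℝ) ^ 2 := by positivity
  rw [Real.norm_of_nonneg (by positivity), one_div]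
  exact inv_anti₀ hp' (by linarith)

/-- Joint continuity is available off `u = 0` and `t = 0`, and both of these sets are null for the
product measure. -/
theorem aestronglyMeasurable_besselK_line (p : ℤ) : AEStronglyMeasurable
    (fun x : ℂ × ℝ => besselK (x.2 * Complex.I) p x.1) (volume.prod volume) := by
  set s : Set (ℂ × ℝ) := {x | x.1 ≠ 0 ∧ x.2 ≠ 0} with hs
  have hso : IsOpen s :=
    (isOpen_ne_fun continuous_fst continuous_const).inter
      (isOpen_ne_fun continuous_snd continuous_const)
  have hc : ContinuousOn (fun x : ℂ × ℝ => besselK (x.2 * Complex.I) p x.1) s := by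
    refine (continuousOn_besselK p).comp (f := fun x : ℂ × ℝ => ((x.2 : ℂ) * Complex.I, x.1))
      (by fun_prop) fun x hx => ⟨sin_pi_mul_I_ne_zero hx.2, hx.1⟩
  have h := hc.aestronglyMeasurable (μ := volume.prod volume) hso.measurableSet
  have hae : ∀ᵐ x ∂((volume : Measure ℂ).prod (volume : Measure ℝ)), x ∈ s := by
    have h1 : ∀ᵐ x ∂((volume : Measure ℂ).prod (volume : Measure ℝ)), x.1 ≠ 0 :=
      Measure.quasiMeasurePreserving_fst.ae ae_ne_zero
    have h2 : ∀ᵐ x ∂((volume : Measure ℂ).prod (volume : Measure ℝ)), x.2 ≠ 0 :=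
      Measure.quasiMeasurePreserving_snd.ae ae_ne_zero_real
    filter_upwards [h1, h2] with x h1 h2 using ⟨h1, h2⟩
  rwa [Measure.restrict_eq_self_of_ae_mem hae] at h

/-- The factor `1 + |p|` in the definition of `IsDecaying` pays for the linear growth of the kernel
in `p`. -/
theorem IsDecaying.exists_norm_le {N : ℝ → ℤ → ℂ} (hN : IsDecaying N) :
    ∃ C : ℝ, 0 ≤ C ∧ ∀ (t : ℝ) (p : ℤ) (u : ℂ), t ≠ 0 → u ≠ 0 →
      ‖besselK (t * Complex.I) p u * N t p‖ ≤
        C * (1 + (p : ℝ) ^ 2)⁻¹ * growth u * (1 + t ^ 2)⁻¹ := by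
  obtain ⟨-, C, hC0, hC⟩ := hN
  obtain ⟨D, hD0, hD⟩ := exists_norm_besselK_le
  refine ⟨D * C, by positivity, fun t p u ht hu => ?_⟩
  have hg := growth_nonneg u
  rw [norm_mul]
  calc _ ≤ D * (1 + |(p : ℝ)|) * growth u * ‖N t p‖ := by gcongr; exact hD t p u hu
    _ = D * growth u * (‖N t p‖ * (1 + |(p : ℝ)|)) := by ring
    _ ≤ D * growth u * (C * ((1 + t ^ 2)⁻¹ * (1 + (p : ℝ) ^ 2)⁻¹)) := by
      exact mul_le_mul_of_nonneg_left (hC t p ht) (by positivity)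
    _ = _ := by ring

theorem aestronglyMeasurable_besselK_line_mul {N : ℝ → ℤ → ℂ} (hN : IsDecaying N) (p : ℤ) {u : ℂ}
    (hu : u ≠ 0) :
    AEStronglyMeasurable (fun t : ℝ => besselK (t * Complex.I) p u * N t p) volume := by
  refine AEStronglyMeasurable.mul ?_ (hN.1 p)
  have hc : ContinuousOn (fun t : ℝ => besselK (t * Complex.I) p u) {0}ᶜ :=
    (continuousOn_besselK p).comp (f := fun t : ℝ => ((t : ℂ) * Complex.I, u))
      (by fun_prop) fun t ht => ⟨sin_pi_mul_I_ne_zero ht, hu⟩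
  have h := hc.aestronglyMeasurable (μ := volume) (measurableSet_singleton 0).compl
  rwa [Measure.restrict_eq_self_of_ae_mem (by filter_upwards [ae_ne_zero_real] with t ht using ht)]
    at h

theorem IsDecaying.integrable {N : ℝ → ℤ → ℂ} (hN : IsDecaying N) (p : ℤ) {u : ℂ} (hu : u ≠ 0) :
    Integrable fun t : ℝ => besselK (t * Complex.I) p u * N t p := by
  obtain ⟨C, -, hC⟩ := hN.exists_norm_le
  refine (integrable_inv_one_add_sq.const_mul (C * (1 + (p : ℝ) ^ 2)⁻¹ * growth u)).mono'
    (aestronglyMeasurable_besselK_line_mul hN p hu) ?_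
  filter_upwards [ae_ne_zero_real] with t ht using hC t p u ht hu

theorem IsDecaying.exists_integral_norm_le {N : ℝ → ℤ → ℂ} (hN : IsDecaying N) :
    ∃ C : ℝ, 0 ≤ C ∧ ∀ (p : ℤ) (u : ℂ), u ≠ 0 →
      ∫ t : ℝ, ‖besselK (t * Complex.I) p u * N t p‖ ≤ C * growth u * (1 + (p : ℝ) ^ 2)⁻¹ := by
  obtain ⟨C, hC0, hC⟩ := hN.exists_norm_le
  refine ⟨C * Real.pi, by positivity, fun p u hu => ?_⟩
  calc _ ≤ ∫ t : ℝ, C * (1 + (p : ℝ) ^ 2)⁻¹ * growth u * (1 + t ^ 2)⁻¹ := by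
        refine integral_mono_ae (hN.integrable p hu).norm
          (integrable_inv_one_add_sq.const_mul _) ?_
        filter_upwards [ae_ne_zero_real] with t ht using hC t p u ht hu
    _ = _ := by
        rw [integral_const_mul, integral_univ_inv_one_add_sq]
        ring

theorem IsDecaying.summable {N : ℝ → ℤ → ℂ} (hN : IsDecaying N) {u : ℂ} (hu : u ≠ 0) :
    Summable fun p : ℤ => ∫ t : ℝ, ‖besselK (t * Complex.I) p u * N t p‖ := by
  obtain ⟨C, -, hC⟩ := hN.exists_integral_norm_le
  exact Summable.of_nonneg_of_le (fun p => integral_nonneg fun t => norm_nonneg _)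
    (fun p => hC p u hu) (summable_inv_one_add_sq.mul_left _)

theorem IsDecaying.exists_norm_kernelSum_le {N : ℝ → ℤ → ℂ} (hN : IsDecaying N) :
    ∃ C : ℝ, ∀ u, u ≠ 0 → ‖kernelSum N u‖ ≤ C * growth u := by
  obtain ⟨C, hC0, hC⟩ := hN.exists_integral_norm_le
  refine ⟨C * ∑' p : ℤ, (1 + (p : ℝ) ^ 2)⁻¹, fun u hu => ?_⟩
  have h := tsum_of_norm_bounded (f := fun p : ℤ => ∫ t : ℝ, besselK (t * Complex.I) p u * N t p)
    (summable_inv_one_add_sq.hasSum.mul_left (C * growth u))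
    fun p => (norm_integral_le_integral_norm _).trans (hC p u hu)
  calc _ ≤ _ := h
    _ = _ := by ring

theorem continuousOn_growth : ContinuousOn growth {0}ᶜ := by
  unfold growth
  refine ContinuousOn.mul ?_ (by fun_prop)
  exact continuous_norm.continuousOn.add
    (continuous_norm.continuousOn.inv₀ fun u hu => norm_ne_zero_iff.mpr hu)

theorem IsDecaying.continuousOn_kernelSum {N : ℝ → ℤ → ℂ} (hN : IsDecaying N) :
    ContinuousOn (kernelSum N) {0}ᶜ := by
  intro u₀ hu₀
  have hu₀ : u₀ ≠ 0 := hu₀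
  refine ContinuousAt.continuousWithinAt ?_
  set s : Set ℂ := {u | u ≠ 0 ∧ growth u < growth u₀ + 1} with hs
  have hsn : s ∈ 𝓝 u₀ := by
    have h1 : ∀ᶠ u in 𝓝 u₀, u ≠ 0 := isOpen_compl_singleton.mem_nhds hu₀
    have h2 : ∀ᶠ u in 𝓝 u₀, growth u < growth u₀ + 1 :=
      (continuousOn_growth.continuousAt (isOpen_compl_singleton.mem_nhds hu₀)).eventually_lt
        continuousAt_const (by linarith)
    filter_upwards [h1, h2] with u h1 h2 using ⟨h1, h2⟩
  refine ContinuousOn.continuousAt (s := s) ?_ hsn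
  obtain ⟨C, hC0, hC⟩ := hN.exists_norm_le
  obtain ⟨D, hD0, hD⟩ := hN.exists_integral_norm_le
  refine continuousOn_tsum (u := fun p : ℤ => D * (growth u₀ + 1) * (1 + (p : ℝ) ^ 2)⁻¹)
    (fun p => ?_) (summable_inv_one_add_sq.mul_left _) fun p u hu => ?_
  · refine continuousOn_of_dominated
      (bound := fun t => C * (1 + (p : ℝ) ^ 2)⁻¹ * (growth u₀ + 1) * (1 + t ^ 2)⁻¹)
      (fun u hu => aestronglyMeasurable_besselK_line_mul hN p hu.1) (fun u hu => ?_)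
      (integrable_inv_one_add_sq.const_mul _) ?_
    · filter_upwards [ae_ne_zero_real] with t ht
      refine (hC t p u ht hu.1).trans ?_
      have := hu.2.le
      gcongr
    · filter_upwards [ae_ne_zero_real] with t ht
      exact ((continuousOn_besselK_right (sin_pi_mul_I_ne_zero ht) p).mono fun u hu => hu.1).mul
        continuousOn_const
  · refine (norm_integral_le_integral_norm _).trans ((hD p u hu.1).trans ?_)
    have := hu.2.le
    gcongr

theorem kernelSum_neg (N : ℝ → ℤ → ℂ) (u : ℂ) : kernelSum N (-u) = kernelSum N u := by
  simp only [kernelSum, besselK_neg_arg]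

/-- Fubini's theorem for the kernel `𝒦`. -/
theorem IsDecaying.hasSum_integral_kernelSum_mul {N : ℝ → ℤ → ℂ} (hN : IsDecaying N) {g : ℂ → ℂ}
    (hg : AEStronglyMeasurable g volume) (hi : Integrable fun u => growth u * ‖g u‖) :
    HasSum (fun p : ℤ => ∫ t : ℝ, (∫ u, besselK (t * Complex.I) p u * g u) * N t p)
      (∫ u, kernelSum N u * g u) := by
  obtain ⟨C, hC0, hC⟩ := hN.exists_norm_le
  obtain ⟨D, hD0, hD⟩ := hN.exists_integral_norm_le
  have hprod : ∀ p : ℤ, Integrable (fun x : ℂ × ℝ =>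
      besselK (x.2 * Complex.I) p x.1 * N x.2 p * g x.1) (volume.prod volume) := by
    intro p
    refine ((hi.mul_prod integrable_inv_one_add_sq).const_mul (C * (1 + (p : ℝ) ^ 2)⁻¹)).mono'
      (((aestronglyMeasurable_besselK_line p).mul (hN.1 p).comp_snd).mul hg.comp_fst) ?_
    have h1 : ∀ᵐ x ∂((volume : Measure ℂ).prod (volume : Measure ℝ)), x.1 ≠ 0 :=
      Measure.quasiMeasurePreserving_fst.ae ae_ne_zero
    have h2 : ∀ᵐ x ∂((volume : Measure ℂ).prod (volume : Measure ℝ)), x.2 ≠ 0 :=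
      Measure.quasiMeasurePreserving_snd.ae ae_ne_zero_real
    filter_upwards [h1, h2] with x h1 h2
    rw [norm_mul]
    calc _ ≤ C * (1 + (p : ℝ) ^ 2)⁻¹ * growth x.1 * (1 + x.2 ^ 2)⁻¹ * ‖g x.1‖ := by
          gcongr
          exact hC x.2 p x.1 h2 h1
      _ = _ := by ring
  have hF : ∀ p : ℤ, ∫ u, (∫ t : ℝ, besselK (t * Complex.I) p u * N t p) * g u =
      ∫ t : ℝ, (∫ u, besselK (t * Complex.I) p u * g u) * N t p := by
    intro p
    have := integral_integral_swap
      (f := fun (u : ℂ) (t : ℝ) => besselK (t * Complex.I) p u * N t p * g u) (hprod p)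
    simp only [← integral_mul_const] at this ⊢
    rw [this]
    refine integral_congr_ae (Eventually.of_forall fun t => ?_)
    exact integral_congr_ae (Eventually.of_forall fun u => by ring)
  have hint : ∀ p : ℤ, Integrable fun u =>
      (∫ t : ℝ, besselK (t * Complex.I) p u * N t p) * g u := by
    intro p
    have := (hprod p).integral_prod_left
    simpa only [integral_mul_const] using this
  have hsum := hasSum_integral_of_summable_integral_norm hint (by
    refine Summable.of_nonneg_of_le (fun p => integral_nonneg fun u => norm_nonneg _)
      (fun p => ?_) (summable_inv_one_add_sq.mul_left (D * ∫ u, growth u * ‖g u‖))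
    calc _ ≤ ∫ u, D * (1 + (p : ℝ) ^ 2)⁻¹ * (growth u * ‖g u‖) := by
          refine integral_mono_ae (hint p).norm (hi.const_mul _) ?_
          filter_upwards [ae_ne_zero] with u hu
          simp only [norm_mul]
          calc _ ≤ D * growth u * (1 + (p : ℝ) ^ 2)⁻¹ * ‖g u‖ := by
                gcongr
                exact (norm_integral_le_integral_norm _).trans (hD p u hu)
            _ = _ := by ring
      _ = _ := by rw [integral_const_mul]; ring)
  simp only [hF, tsum_mul_right] at hsum
  exact hsum

end

/-! ### The inversion formula -/

noncomputable section
open MeasureTheory Filter Topology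

theorem isDecaying_besselKTransform {f : ℂ → ℂ} (hf : IsTestFunction f) :
    IsDecaying fun t p => besselKTransform f (t * Complex.I) p * ((p : ℂ) ^ 2 + (t : ℂ) ^ 2) := by
  obtain ⟨C, hC0, hC⟩ := exists_norm_besselKTransform_mul_le hf
  refine ⟨fun p => AEStronglyMeasurable.mul ?_ (by fun_prop), C, hC0, hC⟩
  simp only [besselKTransform_eq]
  have h : AEStronglyMeasurable (fun x : ℂ × ℝ => besselK (x.2 * Complex.I) p x.1 *
      lebesgueDensity f x.1) (volume.prod volume) :=
    (aestronglyMeasurable_besselK_line p).mul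
      (continuous_lebesgueDensity hf.1.continuous hf.2.2).aestronglyMeasurable.comp_fst
  exact h.prod_swap.integral_prod_right'

theorem isDecaying_cylTransform (σ : Bool) (q : ℕ) {τ : ℂ} (hτ : 0 < τ.re) :
    IsDecaying fun t p => cylTransform σ q τ t p * ((p : ℂ) ^ 2 + (t : ℂ) ^ 2) := by
  -- The weight `p² + t²` costs `(1 + t²)(1 + |p|)²`, the decay required costs the same again, and
  -- one further factor `1 + |p|` belongs to the kernel.
  obtain ⟨C, hC0, hC⟩ := exists_norm_cylTransform_le σ q hτ 2 5
  refine ⟨fun p => ((continuous_cylTransform σ q hτ p).mul (by fun_prop)).aestronglyMeasurable,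
    C, hC0, fun t p _ => ?_⟩
  have hn : ‖(p : ℂ) ^ 2 + (t : ℂ) ^ 2‖ = (p : ℝ) ^ 2 + t ^ 2 := by
    rw [show (p : ℂ) ^ 2 + (t : ℂ) ^ 2 = (((p : ℝ) ^ 2 + t ^ 2 : ℝ) : ℂ) by push_cast; rfl,
      Complex.norm_real, Real.norm_of_nonneg (by positivity)]
  rw [norm_mul, hn, ← mul_inv, ← div_eq_mul_inv, le_div_iff₀ (by positivity)]
  refine le_trans ?_ (hC t p)
  have h1 : (p : ℝ) ^ 2 + t ^ 2 ≤ (1 + t ^ 2) * (1 + (p : ℝ) ^ 2) := by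
    nlinarith [mul_nonneg (sq_nonneg t) (sq_nonneg (p : ℝ))]
  have h2 : 1 + (p : ℝ) ^ 2 ≤ (1 + |(p : ℝ)|) ^ 2 := by
    nlinarith [sq_abs (p : ℝ), abs_nonneg (p : ℝ)]
  calc _ ≤ ‖cylTransform σ q τ t p‖ * ((1 + t ^ 2) * (1 + |(p : ℝ)|) ^ 2) * (1 + |(p : ℝ)|) *
        ((1 + t ^ 2) * (1 + |(p : ℝ)|) ^ 2) := by
        gcongr
        exact h1.trans (by gcongr)
    _ = _ := by ring

theorem gaussTest_neg_arg (σ : Bool) (q : ℕ) (τ u : ℂ) :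
    gaussTest σ q τ (-u) = gaussTest σ q τ u := by
  cases σ <;> simp [gaussTest, gaussMonomial, (even_two_mul q).neg_pow]

theorem norm_gaussTest_mul_sq_le (σ : Bool) (q : ℕ) {τ : ℂ} (hτ : 1 ≤ τ.re) (u : ℂ) :
    ‖gaussTest σ q τ u * ((‖u‖ : ℝ) : ℂ) ^ 2‖ ≤ (q + 1).factorial := by
  rw [norm_mul, norm_gaussTest, norm_pow, Complex.norm_real, norm_norm]
  have h := Real.pow_div_factorial_le_exp (‖u‖ ^ 2) (by positivity) (q + 1)
  rw [div_le_iff₀ (by positivity)] at h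
  calc _ = (‖u‖ ^ 2) ^ (q + 1) * Real.exp (-τ.re * ‖u‖ ^ 2) := by rw [← pow_mul]; ring
    _ ≤ Real.exp (‖u‖ ^ 2) * (q + 1).factorial * Real.exp (-1 * ‖u‖ ^ 2) := by gcongr
    _ = (Real.exp (‖u‖ ^ 2) * Real.exp (-1 * ‖u‖ ^ 2)) * (q + 1).factorial := by ring
    _ = _ := by rw [← Real.exp_add]; simp

/-- Two functions of moderate growth agree as soon as they have the same integrals against the
functions `gaussTest`. -/
theorem eq_of_forall_integral_mul_gaussTest_eq {Φ Ψ : ℂ → ℂ} {A B : ℝ}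
    (hΦ : ContinuousOn Φ {0}ᶜ) (hΨ : ContinuousOn Ψ {0}ᶜ) (hΦe : ∀ u, Φ (-u) = Φ u)
    (hΨe : ∀ u, Ψ (-u) = Ψ u) (hA : ∀ u, u ≠ 0 → ‖Φ u‖ ≤ A * growth u)
    (hB : ∀ u, u ≠ 0 → ‖Ψ u‖ ≤ B * growth u)
    (h : ∀ (σ : Bool) (q : ℕ) (τ : ℂ), τ.re = 4 →
      ∫ u, Φ u * gaussTest σ q τ u = ∫ u, Ψ u * gaussTest σ q τ u) {u : ℂ} (hu : u ≠ 0) :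
    Φ u = Ψ u := by
  refine sub_eq_zero.mp (eq_zero_of_forall_integral_mul_gaussTest_eq_zero (C := A + B)
    (Φ := fun u => Φ u - Ψ u) (hΦ.sub hΨ) (fun u => by rw [hΦe, hΨe]) (fun u hu => ?_)
    (fun σ q ξ => ?_) hu)
  · refine (norm_sub_le _ _).trans ?_
    rw [add_mul]
    exact add_le_add (hA u hu) (hB u hu)
  · have hre : (4 + ξ * Complex.I : ℂ).re = 4 := by simp
    have hi := integrable_growth_mul_norm_gaussTest σ q (τ := 4 + ξ * Complex.I)
      (by rw [hre]; norm_num)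
    have hm := (continuous_gaussTest σ q (4 + ξ * Complex.I)).aestronglyMeasurable
      (μ := (volume : Measure ℂ))
    simp only [sub_mul]
    rw [integral_sub (integrable_mul_of_norm_le_growth hΦ hA hm hi)
      (integrable_mul_of_norm_le_growth hΨ hB hm hi), h σ q _ hre, sub_self]

/-- The inversion formula for the functions `gaussTest`. -/
theorem kernelSum_cylTransform (σ : Bool) (q : ℕ) {τ : ℂ} (hτ : τ.re = 4) {u : ℂ} (hu : u ≠ 0) :
    kernelSum (fun t p => cylTransform σ q τ t p * ((p : ℂ) ^ 2 + (t : ℂ) ^ 2)) u =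
      4 * (gaussTest σ q τ u * ((‖u‖ : ℝ) : ℂ) ^ 2) := by
  have hN := isDecaying_cylTransform σ q (τ := τ) (by rw [hτ]; norm_num)
  obtain ⟨C, hC⟩ := hN.exists_norm_kernelSum_le
  have hc : Continuous fun u => 4 * (gaussTest σ q τ u * ((‖u‖ : ℝ) : ℂ) ^ 2) := by
    have := continuous_gaussTest σ q τ
    fun_prop
  refine eq_of_forall_integral_mul_gaussTest_eq
    (Ψ := fun u => 4 * (gaussTest σ q τ u * ((‖u‖ : ℝ) : ℂ) ^ 2))
    (B := 4 * (q + 1).factorial) hN.continuousOn_kernelSum hc.continuousOn (kernelSum_neg _)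
    (fun u => by rw [gaussTest_neg_arg, norm_neg]) hC (fun u hu => ?_)
    (fun σ' r τ' hτ' => ?_) hu
  · rw [norm_mul, Complex.norm_ofNat, mul_assoc]
    refine mul_le_mul_of_nonneg_left ((norm_gaussTest_mul_sq_le σ q (by rw [hτ]; norm_num)
      u).trans (le_mul_of_one_le_right (by positivity) (one_le_growth hu))) (by norm_num)
  -- Paired with another test function, the left side becomes the spectral side of Parseval's
  -- formula by Fubini, and the right side is its plane side.
  · have h1 := hN.hasSum_integral_kernelSum_mul
      (continuous_gaussTest σ' r τ').aestronglyMeasurable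
      (integrable_growth_mul_norm_gaussTest σ' r (by rw [hτ']; norm_num))
    have h2 := hasSum_integral_cylTransform σ σ' q r (τ := τ) (τ' := τ')
      (by rw [hτ]; norm_num) (by rw [hτ']; norm_num)
    have e : ∀ p : ℤ, ∫ t : ℝ, (∫ u, besselK (t * Complex.I) p u * gaussTest σ' r τ' u) *
        (cylTransform σ q τ t p * ((p : ℂ) ^ 2 + (t : ℂ) ^ 2)) =
        ∫ t : ℝ, cylTransform σ q τ t p * cylTransform σ' r τ' t p *
          ((p : ℂ) ^ 2 + (t : ℂ) ^ 2) := by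
      intro p
      refine integral_congr_ae ?_
      filter_upwards [ae_ne_zero_real] with t ht
      rw [integral_besselK_mul_gaussTest σ' r (by rw [hτ']; norm_num) ht p]
      ring
    simp only [e] at h1
    rw [h1.unique h2, ← integral_const_mul]
    exact integral_congr_ae (Eventually.of_forall fun u => by ring)

/-- For a test function `g`, the spectral pairing of the transforms of `f` and `g` is evaluated
twice by Fubini's theorem: as the inverse transform of `Kf` paired with `g`, and as the inverse
transform belonging to `g` paired with `f`. The latter is known from `kernelSum_cylTransform`, and
its factor `|u|²` cancels the density of `d^×u`. -/
theorem kernelSum_besselKTransform {f : ℂ → ℂ} (hf : IsTestFunction f)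
    (hf_even : ∀ u, f (-u) = f u) {u : ℂ} (hu : u ≠ 0) :
    kernelSum (fun t p => besselKTransform f (t * Complex.I) p *
      ((p : ℂ) ^ 2 + (t : ℂ) ^ 2)) u = 4 * f u := by
  have hN := isDecaying_besselKTransform hf
  obtain ⟨C, hC⟩ := hN.exists_norm_kernelSum_le
  obtain ⟨D, hD⟩ := hf.1.continuous.bounded_above_of_compact_support hf.2.1
  have hD0 : 0 ≤ D := (norm_nonneg _).trans (hD 0)
  refine eq_of_forall_integral_mul_gaussTest_eq (Ψ := fun u => 4 * f u)
    (B := 4 * D) hN.continuousOn_kernelSum (hf.1.continuous.const_smul (4 : ℂ)).continuousOn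
    (kernelSum_neg _) (fun u => by rw [hf_even]) hC (fun u hu => ?_) (fun σ q τ hτ => ?_) hu
  · rw [norm_mul, Complex.norm_ofNat, mul_assoc]
    exact mul_le_mul_of_nonneg_left ((hD u).trans
      (le_mul_of_one_le_right hD0 (one_le_growth hu))) (by norm_num)
  · have h1 := hN.hasSum_integral_kernelSum_mul
      (continuous_gaussTest σ q τ).aestronglyMeasurable
      (integrable_growth_mul_norm_gaussTest σ q (by rw [hτ]; norm_num))
    have h2 := (isDecaying_cylTransform σ q (τ := τ)
      (by rw [hτ]; norm_num)).hasSum_integral_kernelSum_mul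
      (continuous_lebesgueDensity hf.1.continuous hf.2.2).aestronglyMeasurable
      hf.integrable_growth_mul_norm
    have e : ∀ p : ℤ, ∫ t : ℝ, (∫ u, besselK (t * Complex.I) p u * gaussTest σ q τ u) *
        (besselKTransform f (t * Complex.I) p * ((p : ℂ) ^ 2 + (t : ℂ) ^ 2)) =
        ∫ t : ℝ, (∫ u, besselK (t * Complex.I) p u * lebesgueDensity f u) *
        (cylTransform σ q τ t p * ((p : ℂ) ^ 2 + (t : ℂ) ^ 2)) := by
      intro p
      refine integral_congr_ae ?_
      filter_upwards [ae_ne_zero_real] with t ht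
      rw [integral_besselK_mul_gaussTest σ q (by rw [hτ]; norm_num) ht p, besselKTransform_eq]
      ring
    simp only [e] at h1
    rw [h1.unique h2]
    refine integral_congr_ae ?_
    filter_upwards [ae_ne_zero] with u hu
    have hn : ((‖u‖ : ℝ) : ℂ) ≠ 0 := by simpa using hu
    rw [kernelSum_cylTransform σ q hτ hu, lebesgueDensity]
    push_cast
    field_simp

theorem besselBIntegrand_eq (h : ℂ → ℤ → ℂ) (u : ℂ) (p : ℤ) (t : ℝ) :
    besselBIntegrand h u p t = Complex.I * (besselK (t * Complex.I) p u *
      (h (t * Complex.I) p * ((p : ℂ) ^ 2 + (t : ℂ) ^ 2))) := by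
  rw [besselBIntegrand, mul_pow, Complex.I_sq]
  ring

theorem besselB_eq_kernelSum (h : ℂ → ℤ → ℂ) (u : ℂ) :
    besselB h u = 1 / (8 * (Real.pi : ℂ)) *
      kernelSum (fun t p => h (t * Complex.I) p * ((p : ℂ) ^ 2 + (t : ℂ) ^ 2)) u := by
  have hpi : (Real.pi : ℂ) ≠ 0 := by exact_mod_cast Real.pi_ne_zero
  have hI := Complex.I_ne_zero
  simp only [besselB, kernelSum, besselBIntegrand_eq, integral_const_mul]
  rw [← tsum_mul_left]
  refine tsum_congr fun p => ?_
  field_simp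

theorem theorem11p1 (f : ℂ → ℂ) (hf_even : ∀ u : ℂ, f (-u) = f u)
    (hf_smooth : ContDiff ℝ (⊤ : ℕ∞) f)
    (hf_compact : HasCompactSupport f) (hf_zero : (0 : ℂ) ∉ tsupport f) :
    (∀ (ν : ℂ) (p : ℤ),
      MeasureTheory.Integrable (fun u : ℂ => besselK ν p u * f u) mulLebesgue) ∧
    ∀ u : ℂ, u ≠ 0 →
      (∀ p : ℤ, MeasureTheory.Integrable
        (fun t : ℝ => besselBIntegrand (besselKTransform f) u p t)) ∧
      (Summable fun p : ℤ => ∫ t : ℝ, ‖besselBIntegrand (besselKTransform f) u p t‖) ∧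
      2 * (Real.pi : ℂ) * besselB (besselKTransform f) u = f u := by
  have hf : IsTestFunction f := ⟨hf_smooth, hf_compact, hf_zero⟩
  have hN := isDecaying_besselKTransform hf
  refine ⟨fun ν p => integrable_besselK_mul_mulLebesgue ν p hf_smooth.continuous hf_compact
    hf_zero, fun u hu => ⟨fun p => ?_, ?_, ?_⟩⟩
  · simp only [besselBIntegrand_eq]
    exact (hN.integrable p hu).const_mul _
  · simp only [besselBIntegrand_eq, norm_mul Complex.I, Complex.norm_I, one_mul]
    exact hN.summable hu
  · have hpi : (Real.pi : ℂ) ≠ 0 := by exact_mod_cast Real.pi_ne_zero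
    rw [besselB_eq_kernelSum, kernelSum_besselKTransform hf hf_even hu]
    field_simp
    norm_num

end
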